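/- Let $\Sigma$ be an infinite, totally ordered set of labels with a least element $\bot$; comparing two labels and accessing $\bot$ take constant time. Trees are finite, rooted, unordered and $\Sigma$-labelled; $\mathrm{Tree}_1$ is the set of trees $t$ with a selected node $\mathrm{sel}_t$ other than the root. The size of a tree is its number of nodes. A sample is a finite nonempty set of trees from $\mathrm{Tree}_1$; its size is the sum of the sizes of its trees. A unary path query is a path $q=b_0e_1b_1\cdots e_mb_m$ ($m\ge 1$) with labels $b_i\in\Sigma\cup\{\star\}$ and edges $e_i\in\{/,/\!/\}$ (child or descendant); node $m$ is the selecting node, and $|q|=m+1$. It is anchored, $q\in\mathrm{AnchPath}_1$, if a $/\!/$-edge is incident to a $\star$-node only when this node is the root or the selecting node. An embedding of $q$ in $t\in\mathrm{Tree}_1$ maps the root to the root and the selecting node to $\mathrm{sel}_t$, maps $/$-edges to parent-child pairs and $/\!/$-edges to pairs (ancestor, proper descendant), and preserves labels other than $\star$. Let $\mathcal L(q)$ be the set of $t\in\mathrm{Tree}_1$ in which $q$ can be embedded; $q$ and $q'$ are equivalent if $\mathcal L(q)=\mathcal L(q')$; $q$ is consistent with $S$ if $S\subseteq\mathcal L(q)$.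 **Algorithm** $\mathsf{learner}(S)$. Let $w=a_0a_1\cdots a_n$ be the least word, first by length and then lexicographically, among the words spelled by the paths from the root to the selected node in the trees of $S$. Start with $p=\star/\!/\star$. 1. For every nonempty factor $u$ of $a_1\cdots a_{n-1}$, in order of decreasing lengths: replace $/\!/$-edges of $p$ by $/\!/u/\!/$ for as long as this is possible with $p$ remaining consistent with $S$. 2. Replace the root label of $p$ by $a_0$ if the result is consistent with $S$; then replace the label of the selecting node by $a_n$ if the result is consistent with $S$. 3. For each $/\!/$-edge of $p$, one after the other: find the maximal $\ell$ such that replacing the edge by $/\!/(\star/)^{\ell}$ gives a query consistent with $S$; if replacing it by $/(\star/)^{\ell}$ is also consistent with $S$, make this replacement in $p$. Return $p$. The order among factors of equal length, the choice of the edges in step 1 and the order of the edges in step 3 are arbitrary. For $q\in\mathrm{AnchPath}_1$ let $a_1\ne a_2$ be labels that do not occur in $q$ and differ from $\bot$. The match set $\mathit{CS}_q=\{t_0,t_1\}$ consists of two paths with selected leaf: $t_0$ is obtained from $q$ by replacing every $\star$ by $\bot$ and every $/\!/$-edge by a child edge; $t_1$ by replacing every $\star$ by $a_1$ and every $/\!/$-edge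 by a path through $|q|$ new nodes labelled $a_2$. **Theorem.** Unary anchored path queries are learnable in polynomial time and data from positive examples: there are an algorithm that runs in time polynomial in the size of its input sample and a polynomial $\mathrm{poly}$ such that (soundness) on every sample $S$ it returns a query in $\mathrm{AnchPath}_1$ consistent with $S$, or the value Null if there is none, and (completeness) for every $q\in\mathrm{AnchPath}_1$ there is a sample $\mathit{CS}\subseteq\mathcal L(q)$ of size at most $\mathrm{poly}(|q|)$ such that on every sample $S$ with $\mathit{CS}\subseteq S\subseteq\mathcal L(q)$ it returns a query equivalent to $q$. More precisely: - $\mathsf{learner}$, with suitable choices, can be carried out in time polynomial in the size of the sample; - whatever the choices, $\mathsf{learner}(S)$ returns a query in $\mathrm{AnchPath}_1$ consistent with $S$; - for every $q\in\mathrm{AnchPath}_1$, $\mathit{CS}_q\subseteq\mathcal L(q)$ has size polynomial in $|q|$, and for every sample $S$ with $\mathit{CS}_q\subseteq S\subseteq\mathcal L(q)$, whatever the choices, $\mathsf{learner}(S)$ returns a query equivalent to $q$. -/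

import Mathlib

namespace TwigLearn

universe u

/-! ### Decorated trees -/

/-- Unranked unordered trees with labels in `α`: a finite node set, a root, a labelling and an
acyclic parent-child relation in which every non-root node has exactly one predecessor. -/
structure LTree (α : Type u) where
  n : ℕ
  root : Fin n
  lab : Fin n → α
  child : Fin n → Fin n → Prop
  acyclic : ∀ v, ¬ Relation.TransGen child v v
  unique_pred : ∀ v, v ≠ root → ∃! u, child u v

/-- Decorated trees: a tree with a selected node other than the root. -/
structure DTree (α : Type u) extends LTree α where
  sel : Fin n
  sel_ne_root : sel ≠ root

/-- The size of a tree is the number of its nodes. -/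
def DTree.size {α : Type u} (t : DTree α) : ℕ := t.n

/-- `IsSelPath t w`: the word `w` is spelled by the path from the root of `t` to its selected
node (both included). -/
def IsSelPath {α : Type u} (t : DTree α) (w : List α) : Prop :=
  ∃ vs : List (Fin t.n), vs.head? = some t.root ∧ vs.getLast? = some t.sel ∧
    List.IsChain t.child vs ∧ w = vs.map t.lab

/-- The words spelled by the selecting paths of the trees of a sample. -/
def selPaths {α : Type u} (S : Finset (DTree α)) : Set (List α) :=
  {w | ∃ t ∈ S, IsSelPath t w}

/-- The canonical order on words: by length, then lexicographically. -/
def CanLE {α : Type u} [LinearOrder α] (w w' : List α) : Prop :=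
  w = w' ∨ List.Shortlex (· < ·) w w'

/-! ### Unary path queries -/

/-- The two kinds of edges of a query: child edges `/` and descendant edges `//`. -/
inductive Axis where
  | child
  | desc

/-- A unary path query `b₀ e₁ b₁ … eₘ bₘ`, where `bᵢ` is a label or the wildcard (`none`) and
`eᵢ` is the kind of the edge from node `i - 1` to node `i`. The root is node `0` and the selecting
node is the last one. -/
@[ext]
structure PathQuery (α : Type u) where
  head : Option α
  steps : List (Axis × Option α)

namespace PathQuery

variable {α : Type u}

/-- The size of a query is the number of its nodes. -/
def size (q : PathQuery α) : ℕ := q.steps.length + 1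

/-- The label of a node. -/
def label (q : PathQuery α) : Fin (q.steps.length + 1) → Option α :=
  Fin.cons q.head fun i => (q.steps.get i).2

/-- The kind of the edge from node `i` to node `i + 1`. -/
def axis (q : PathQuery α) (i : Fin q.steps.length) : Axis := (q.steps.get i).1

/-- Embeddings of a unary path query in a decorated tree. -/
structure IsEmbedding (q : PathQuery α) (t : DTree α)
    (f : Fin (q.steps.length + 1) → Fin t.n) : Prop where
  root : f 0 = t.root
  child : ∀ i, q.axis i = Axis.child → t.child (f i.castSucc) (f i.succ)
  desc : ∀ i, q.axis i = Axis.desc → Relation.TransGen t.child (f i.castSucc) (f i.succ)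
  lab : ∀ i a, q.label i = some a → t.lab (f i) = a
  sel : f (Fin.last _) = t.sel

/-- The language of a query: the decorated trees in which it can be embedded. -/
def lang (q : PathQuery α) : Set (DTree α) := {t | ∃ f, q.IsEmbedding t f}

/-- Unary anchored path queries: the selecting node is not the root, and a descendant edge is
incident to a wildcard node only if this node is the root or the selecting node. -/
def IsAnchored (q : PathQuery α) : Prop :=
  q.steps ≠ [] ∧ ∀ i, q.axis i = Axis.desc →
    (q.label i.castSucc = none → i.castSucc = 0) ∧
    (q.label i.succ = none → i.succ = Fin.last _)

/-- The label `a` is used in the query. -/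
def Uses (q : PathQuery α) (a : α) : Prop := ∃ i, q.label i = some a

/-- Consistency of a query with a sample. -/
def Consistent (S : Finset (DTree α)) (q : PathQuery α) : Prop := (S : Set (DTree α)) ⊆ q.lang

end PathQuery

/-- The class of unary anchored path queries. -/
def AnchPath (α : Type u) : Type u := {q : PathQuery α // q.IsAnchored}

/-! ### The two-tree match set -/

section matchSet

variable {α : Type u}

/-- The tree that consists of a single path spelling `w`, with its leaf selected. -/
def chainTree (w : List α) (hw : 2 ≤ w.length) : DTree α where
  n := w.length
  root := ⟨0, by omega⟩
  lab := w.get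
  child i j := (i : ℕ) + 1 = j
  acyclic := by
    intro v h
    have key : ∀ a b : Fin w.length,
        Relation.TransGen (fun i j : Fin w.length => (i : ℕ) + 1 = j) a b → (a : ℕ) < b := by
      intro a b hab
      induction hab with
      | single h => omega
      | tail _ h ih => omega
    exact lt_irrefl _ (key v v h)
  unique_pred := by
    intro v hv
    have hv0 : (v : ℕ) ≠ 0 := fun h => hv (Fin.ext h)
    refine ⟨⟨(v : ℕ) - 1, by omega⟩, ?_, ?_⟩
    · show (v : ℕ) - 1 + 1 = v
      omega
    · intro y hy
      apply Fin.ext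
      show (y : ℕ) = (v : ℕ) - 1
      have : (y : ℕ) + 1 = v := hy
      omega
  sel := ⟨w.length - 1, by omega⟩
  sel_ne_root := by
    intro h
    have := congrArg Fin.val h
    simp only at this
    omega

/-- Every wildcard becomes `a₀` and every descendant edge becomes a child edge. -/
def matchWord₀ (a₀ : α) (q : PathQuery α) : List α :=
  q.head.getD a₀ :: q.steps.map fun s => s.2.getD a₀

/-- The nodes put in place of an edge: none for a child edge, `N` nodes labelled `a₂` for a
descendant edge. -/
def edgeFill (N : ℕ) (a₂ : α) : Axis → List α
  | Axis.child => []
  | Axis.desc => List.replicate N a₂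

/-- Every wildcard becomes `a₁` and every descendant edge becomes a path through `|q|` nodes
labelled `a₂`. -/
def matchWord₁ (a₁ a₂ : α) (q : PathQuery α) : List α :=
  q.head.getD a₁ :: q.steps.flatMap fun s => edgeFill q.size a₂ s.1 ++ [s.2.getD a₁]

theorem two_le_matchWord₀ (a₀ : α) (q : PathQuery α) (hq : q.IsAnchored) :
    2 ≤ (matchWord₀ a₀ q).length := by
  have := List.length_pos_iff.2 hq.1
  simp only [matchWord₀, List.length_cons, List.length_map]
  omega

theorem two_le_matchWord₁ (a₁ a₂ : α) (q : PathQuery α) (hq : q.IsAnchored) :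
    2 ≤ (matchWord₁ a₁ a₂ q).length := by
  obtain ⟨h, l⟩ := q
  cases l with
  | nil => exact absurd rfl hq.1
  | cons s l =>
    simp only [matchWord₁, List.flatMap_cons, List.length_cons, List.length_append,
      List.length_nil]
    omega

open Classical in
/-- The match set `{t₀, t₁}` of an anchored path query, built with the least label `⊥` and the
labels `a₁`, `a₂`. -/
noncomputable def matchSet [LinearOrder α] [OrderBot α] (a₁ a₂ : α) (q : AnchPath α) :
    Finset (DTree α) :=
  {chainTree (matchWord₀ ⊥ q.1) (two_le_matchWord₀ ⊥ q.1 q.2),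
    chainTree (matchWord₁ a₁ a₂ q.1) (two_le_matchWord₁ a₁ a₂ q.1 q.2)}

end matchSet

/-! ### The learning algorithm for unary anchored path queries

The algorithm leaves some choices open (the order among subpaths of the same length, the edge that
is replaced, the order in which descendant edges are treated). It is therefore given as a relation:
`LearnerAnchPath S p` says that some run of the algorithm on the sample `S` returns `p`. -/

section learner

variable {α : Type u}

/-- The universal query, a wildcard root with a wildcard descendant. -/
def universalQuery (α : Type u) : PathQuery α := ⟨none, [(Axis.desc, none)]⟩

/-- The steps `//u₁/u₂/…/uₖ`. -/
def factorSteps : List α → List (Axis × Option α)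
  | [] => []
  | a :: u => (Axis.desc, some a) :: u.map fun b => (Axis.child, some b)

/-- One replacement of a descendant edge of `p` by `//u//` that keeps consistency with `S`. -/
def InsertStep (S : Finset (DTree α)) (u : List α) (p p' : PathQuery α) : Prop :=
  ∃ l b r, p.steps = l ++ (Axis.desc, b) :: r ∧
    p' = ⟨p.head, l ++ factorSteps u ++ (Axis.desc, b) :: r⟩ ∧ p'.Consistent S

/-- Replace descendant edges of `p` by `//u//` for as long as this is possible. -/
def InsertAll (S : Finset (DTree α)) (u : List α) (p p' : PathQuery α) : Prop :=
  Relation.ReflTransGen (InsertStep S u) p p' ∧ ∀ p'', ¬ InsertStep S u p' p''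

/-- First stage: treat the factors in the given list one after the other. -/
def Stage1 (S : Finset (DTree α)) : List (List α) → PathQuery α → PathQuery α → Prop
  | [], p, p' => p' = p
  | u :: us, p, p' => ∃ m, InsertAll S u p m ∧ Stage1 S us m p'

/-- Replace the label of the root. -/
def setHead (p : PathQuery α) (a : α) : PathQuery α := ⟨some a, p.steps⟩

/-- Replace the label of the selecting node. -/
def setLast (p : PathQuery α) (a : α) : PathQuery α :=
  ⟨p.head, p.steps.modifyLast fun s => (s.1, some a)⟩

open Classical in
/-- Second stage: try to specialize the label of the root, then that of the selecting node. -/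
noncomputable def stage2 (S : Finset (DTree α)) (a₀ aₙ : α) (p : PathQuery α) : PathQuery α :=
  let p' := if (setHead p a₀).Consistent S then setHead p a₀ else p
  if (setLast p' aₙ).Consistent S then setLast p' aₙ else p'

/-- The steps that lead, through `k` wildcard nodes, to a node labelled `b`; the first edge is of
kind `x`, all others are child edges. -/
def starSteps : Axis → ℕ → Option α → List (Axis × Option α)
  | x, 0, b => [(x, b)]
  | x, k + 1, b => (x, none) :: starSteps Axis.child k b

/-- Third stage, treatment of one descendant edge. Steps marked `true` are the descendant edges
that are still to be treated. With `k` maximal such that the edge can be replaced by `//` followed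
by `k` wildcards, the edge is replaced by `/` followed by `k` wildcards if this is consistent with
the sample, and stays a descendant edge otherwise. -/
def ResolveStep (S : Finset (DTree α)) (h : Option α)
    (m m' : List (Bool × (Axis × Option α))) : Prop :=
  ∃ l b r k, m = l ++ (true, (Axis.desc, b)) :: r ∧
    IsGreatest {j | PathQuery.Consistent S
      ⟨h, l.map Prod.snd ++ starSteps Axis.desc j b ++ r.map Prod.snd⟩} k ∧
    ((PathQuery.Consistent S ⟨h, l.map Prod.snd ++ starSteps Axis.child k b ++ r.map Prod.snd⟩ ∧
        m' = l ++ (starSteps Axis.child k b).map (Prod.mk false) ++ r) ∨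
      (¬ PathQuery.Consistent S
          ⟨h, l.map Prod.snd ++ starSteps Axis.child k b ++ r.map Prod.snd⟩ ∧
        m' = l ++ (false, (Axis.desc, b)) :: r))

/-- Mark exactly the descendant edges. -/
def markStep : Axis × Option α → Bool × (Axis × Option α)
  | (Axis.child, b) => (false, (Axis.child, b))
  | (Axis.desc, b) => (true, (Axis.desc, b))

/-- Third stage: every descendant edge is treated once, in any order. -/
def Stage3 (S : Finset (DTree α)) (p p' : PathQuery α) : Prop :=
  ∃ m, Relation.ReflTransGen (ResolveStep S p.head) (p.steps.map markStep) m ∧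
    (∀ s ∈ m, s.1 = false) ∧ p' = ⟨p.head, m.map Prod.snd⟩

/-- Some run of the learning algorithm on the sample `S` returns `p`. The word `a₀ … aₙ` is the
canonically least selecting path, and `us` lists the nonempty subpaths of `a₁ … aₙ₋₁` by decreasing
lengths. -/
def LearnerAnchPath [LinearOrder α] (S : Finset (DTree α)) (p : PathQuery α) : Prop :=
  ∃ (a₀ aₙ : α) (inner : List α) (us : List (List α)) (p₁ : PathQuery α),
    a₀ :: (inner ++ [aₙ]) ∈ selPaths S ∧
    (∀ w ∈ selPaths S, CanLE (a₀ :: (inner ++ [aₙ])) w) ∧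
    (∀ u, u ∈ us ↔ u ≠ [] ∧ u <:+: inner) ∧
    us.Pairwise (fun u v => v.length ≤ u.length) ∧
    Stage1 S us (universalQuery α) p₁ ∧
    Stage3 S (stage2 S a₀ aₙ p₁) p

end learner

/-! ### A machine model with a step count

Programs work on binary trees whose leaves are `nil` or labels. Every basic operation costs one
step; this includes the comparison of two labels and the access to the least label. -/

/-- The data on which programs work. -/
inductive Data (α : Type u) where
  | nil
  | atom (a : α)
  | cons (x y : Data α)

namespace Data

variable {α : Type u}

/-- First component (`nil` if there is none). -/
def hd : Data α → Data α
  | cons x _ => x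
  | _ => nil

/-- Second component (`nil` if there is none). -/
def tl : Data α → Data α
  | cons _ y => y
  | _ => nil

/-- The truth value `true`. -/
def yes : Data α := cons nil nil

open Classical in
/-- Comparison of the two labels of a pair of labels. -/
noncomputable def cmp [LE α] : Data α → Data α
  | cons (atom a) (atom b) => if a ≤ b then yes else nil
  | _ => nil

/-- Unary representation of numbers. -/
def num : ℕ → Data α
  | 0 => nil
  | k + 1 => cons nil (num k)

/-- Representation of lists. -/
def list : List (Data α) → Data α
  | [] => nil
  | x :: l => cons x (list l)

end Data

/-- Programs. They do not mention the set of labels. -/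
inductive Code where
  | id
  | nil
  | bot
  | hd
  | tl
  | le
  | pair (f g : Code)
  | comp (g f : Code)
  | cond (c f g : Code)
  | loop (c f : Code)

/-- `Code.Eval c x y k`: the program `c` halts on input `x` with output `y` after `k` steps.
Here `cond c f g` runs `f` if `c` does not return `nil` and `g` otherwise, and `loop c f` applies
`f` as long as `c` does not return `nil`. -/
inductive Code.Eval {α : Type u} [LE α] [OrderBot α] : Code → Data α → Data α → ℕ → Prop
  | id (x) : Code.Eval .id x x 1
  | nil (x) : Code.Eval .nil x .nil 1
  | bot (x) : Code.Eval .bot x (.atom ⊥) 1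
  | hd (x) : Code.Eval .hd x x.hd 1
  | tl (x) : Code.Eval .tl x x.tl 1
  | le (x) : Code.Eval .le x x.cmp 1
  | pair {f g x y z s t} : Code.Eval f x y s → Code.Eval g x z t →
      Code.Eval (.pair f g) x (.cons y z) (s + t + 1)
  | comp {f g x y z s t} : Code.Eval f x y s → Code.Eval g y z t →
      Code.Eval (.comp g f) x z (s + t + 1)
  | cond_true {c f g x y z s t} : Code.Eval c x y s → y ≠ .nil → Code.Eval f x z t →
      Code.Eval (.cond c f g) x z (s + t + 1)
  | cond_false {c f g x z s t} : Code.Eval c x .nil s → Code.Eval g x z t →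
      Code.Eval (.cond c f g) x z (s + t + 1)
  | loop_done {c f x s} : Code.Eval c x .nil s → Code.Eval (.loop c f) x x (s + 1)
  | loop_step {c f x y x' z r s t} : Code.Eval c x y s → y ≠ .nil → Code.Eval f x x' t →
      Code.Eval (.loop c f) x' z r → Code.Eval (.loop c f) x z (s + t + r + 1)

/-! ### Representation of trees and queries as data -/

section encoding

variable {α : Type u}

open Classical in
/-- The list of the child edges of a tree. -/
noncomputable def LTree.edges (t : LTree α) : List (Fin t.n × Fin t.n) :=
  ((List.finRange t.n).product (List.finRange t.n)).filter fun e => t.child e.1 e.2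

/-- A decorated tree is given by its root, its selected node, the labels of the nodes
`0, …, n - 1` and the list of the child edges. -/
noncomputable def encodeTree (t : DTree α) : Data α :=
  .cons (.num t.root) (.cons (.num t.sel) (.cons
    (.list ((List.finRange t.n).map fun v => .atom (t.lab v)))
    (.list (t.edges.map fun e => .cons (.num e.1) (.num e.2)))))

/-- A wildcard is given by `nil`, a label by itself. -/
def encodeLabel : Option α → Data α
  | none => .nil
  | some a => .atom a

/-- Representation of the kinds of edges. -/
def encodeAxis : Axis → Data α
  | Axis.child => .nil
  | Axis.desc => .yes

/-- A path query is given by the label of its root and the list of its steps. -/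
def encodeQuery (q : PathQuery α) : Data α :=
  .cons (encodeLabel q.head)
    (.list (q.steps.map fun s => .cons (encodeAxis s.1) (encodeLabel s.2)))

end encoding

/-! ### The learning framework -/

/-- A learning setting: examples, queries and the semantics that maps a query to the set of its
examples, together with the sizes of examples and queries and their representations as data. -/
structure LearningSetting (α : Type u) where
  Example : Type u
  Query : Type u
  lang : Query → Set Example
  exampleSize : Example → ℕ
  querySize : Query → ℕ
  encodeExample : Example → Data α
  encodeOutput : Query → Data α

namespace LearningSetting

variable {α : Type u} (K : LearningSetting α)

/-- The size of a sample is the sum of the sizes of its examples. -/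
def sampleSize (S : Finset K.Example) : ℕ := ∑ e ∈ S, K.exampleSize e

/-- Representation of the outputs of a learning algorithm; `none` is the special value Null. -/
def encodeOption : Option K.Query → Data α
  | none => .nil
  | some q => .cons .yes (K.encodeOutput q)

/-- Given the examples of the sample `S`, listed without repetition in the order `l`, the program
`c` halts after `k` steps and returns `o`. -/
def Returns [LE α] [OrderBot α] (c : Code) (S : Finset K.Example) (l : List K.Example)
    (o : Option K.Query) (k : ℕ) : Prop :=
  S.val = (l : Multiset K.Example) ∧
    c.Eval (.list (l.map K.encodeExample)) (K.encodeOption o) k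

/-- Soundness of an output: it is a query consistent with the sample, or Null if there is none. -/
def SoundOutput (S : Finset K.Example) : Option K.Query → Prop
  | none => ¬ ∃ q, (S : Set K.Example) ⊆ K.lang q
  | some q => (S : Set K.Example) ⊆ K.lang q

/-- Learnability in polynomial time and data. -/
def Learnable [LE α] [OrderBot α] : Prop :=
  ∃ (c : Code) (time poly : Polynomial ℕ),
    (∀ (S : Finset K.Example) (l : List K.Example), S.Nonempty → S.val = (l : Multiset _) →
      ∃ o k, K.Returns c S l o k ∧ k ≤ time.eval (K.sampleSize S) ∧ K.SoundOutput S o) ∧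
    (∀ q : K.Query, ∃ CS : Finset K.Example, CS.Nonempty ∧ (CS : Set K.Example) ⊆ K.lang q ∧
      K.sampleSize CS ≤ poly.eval (K.querySize q) ∧
      ∀ (S : Finset K.Example) (l : List K.Example), CS ⊆ S → (S : Set K.Example) ⊆ K.lang q →
        S.val = (l : Multiset _) →
        ∃ q' k, K.Returns c S l (some q') k ∧ K.lang q' = K.lang q)

end LearningSetting

/-- The setting for learning unary anchored path queries from positive examples. -/
noncomputable def anchPathSetting (α : Type u) : LearningSetting α where
  Example := DTree α
  Query := AnchPath α
  lang q := q.1.lang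
  exampleSize := DTree.size
  querySize q := q.1.size
  encodeExample := encodeTree
  encodeOutput q := encodeQuery q.1

end TwigLearn

open TwigLearn

/-! Every node other than the root has exactly one parent, so a tree has a single path from its root
to its selected node, and an embedding of a path query, once its descendant edges are expanded,
traces this path. Membership in a language thus depends only on the selecting word (`mem_lang_iff`),
and learning becomes a problem about words. Soundness is then cheap: the initial query matches every
word of length at least two, and every replacement is tested for consistency and preserves
anchoredness (`LearnerAnchPath.sound`).

For completeness the learner is shown to return `q` itself, not merely an equivalent query. The
labelled interior nodes of an anchored query form runs, joined inside by child edges and separated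
by a plain descendant edge or by `k` wildcards on child edges (`exists_blocks`). No word matched by
`q` precedes the word of `t₀`: none is shorter, and one of equal length dominates it letter by
letter. So the learner works with that word; all runs are factors of its interior, and it contains
neither `a₁` nor `a₂`. In the word of `t₁` the gaps between runs are nonempty and consist of `a₁`
and `a₂` only, so a factor of the least word occurs there only inside a run.

Stage 1 is governed by the excess, the sum of the truncated differences `|f| - L` over a list of
words. If words of length at least `L ≥ 1` occur disjointly in a run, their excess is at most that
of the run, and equality makes them a sublist of the run alone, since two words lose `L` twice
(`Occ.excess_le`, summed over the runs in `Occ.excess_blocks`). When factors of length `L` are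
treated, all longer runs are present already, so the excess is maximal; a factor of length `L` does
not change it, and every consistent insertion yields a sublist of the runs. Conversely each such
sublist is consistent, so the stage ends with exactly the runs (`stage1_eq_factorQuery`). In stage 2
a wildcard at either end survives because `t₁` shows `a₁` there and not `⊥`.

In stage 3, counting the letters other than `a₁` and `a₂` in `t₁` pins every run to its own place
(`gaps_forced`), so each separator of a consistent query must accept the gap found there: `k` for
`k` wildcards, `|q|` for a descendant edge. The length of `t₀` keeps the number of wildcards below
`|q|`. Hence the child version is accepted exactly when `q` has it, with the right number of
wildcards (`resolveStep_markBlock`).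

For the running time, one run is programmed on words. Matching fills a table over suffixes, and the
length of the least word bounds the repetitions in stages 1 and 3. The predicate `PT` is closed
under the constructions used, where loops require a polynomial bound on the size of their state. -/

namespace TwigLearn

universe u

variable {α : Type u}

/-! ### Selecting words -/

namespace LTree

variable (t : LTree α)

theorem wellFounded_child : WellFounded t.child := by
  have : IsTrans (Fin t.n) (Relation.TransGen t.child) := ⟨fun _ _ _ => Relation.TransGen.trans⟩
  have : Std.Irrefl (Relation.TransGen t.child) := ⟨t.acyclic⟩
  exact Subrelation.wf (fun h => Relation.TransGen.single h)
    (Finite.wellFounded_of_trans_of_irrefl (Relation.TransGen t.child))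

theorem reflTransGen_root (v : Fin t.n) : Relation.ReflTransGen t.child t.root v := by
  induction v using t.wellFounded_child.induction with
  | _ v ih =>
    by_cases hv : v = t.root
    · rw [hv]
    · obtain ⟨u, hu, -⟩ := t.unique_pred v hv
      exact (ih u hu).tail hu

theorem not_child_root (v : Fin t.n) : ¬ t.child v t.root := fun h =>
  t.acyclic v (Relation.TransGen.head' h (t.reflTransGen_root v))

theorem eq_of_child {u v w : Fin t.n} (hu : t.child u w) (hv : t.child v w) : u = v := by
  have hw : w ≠ t.root := fun h => t.not_child_root u (h ▸ hu)
  exact (t.unique_pred w hw).unique hu hv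

/-- The paths are compared from their common last node backwards: predecessors are unique, and as
the root has no predecessor neither path can stop before the other. -/
theorem path_unique (vs : List (Fin t.n)) : ∀ vs' : List (Fin t.n),
    vs.head? = some t.root → vs'.head? = some t.root → vs.getLast? = vs'.getLast? →
    vs.IsChain t.child → vs'.IsChain t.child → vs = vs' := by
  induction vs using List.reverseRecOn with
  | nil => intro vs' h; simp at h
  | append_singleton l x ih =>
    intro vs' h h' hl hc hc'
    rcases List.eq_nil_or_concat vs' with rfl | ⟨l', y, rfl⟩
    · simp at h'
    simp only [List.concat_eq_append] at *
    simp only [List.getLast?_append, List.getLast?_singleton, Option.some_or,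
      Option.some.injEq] at hl
    subst hl
    rw [List.isChain_append] at hc hc'
    rcases List.eq_nil_or_concat l with rfl | ⟨m, z, rfl⟩
    · rcases List.eq_nil_or_concat l' with rfl | ⟨m', z', rfl⟩
      · rfl
      · simp at h
        subst h
        exact absurd (hc'.2.2 z' (by simp) _ (by simp)) (t.not_child_root _)
    · rcases List.eq_nil_or_concat l' with rfl | ⟨m', z', rfl⟩
      · simp at h'
        subst h'
        exact absurd (hc.2.2 z (by simp) _ (by simp)) (t.not_child_root _)
      · have hz : z = z' := t.eq_of_child (hc.2.2 z (by simp) x (by simp))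
          (hc'.2.2 z' (by simp) x (by simp))
        subst hz
        rw [ih _ (by simpa using h) (by simpa using h') (by simp) hc.1 hc'.1]

end LTree

theorem exists_isSelPath (t : DTree α) : ∃ w, IsSelPath t w := by
  obtain ⟨l, hl, hlast⟩ := List.exists_isChain_cons_of_relationReflTransGen
    (t.reflTransGen_root t.sel)
  refine ⟨_, t.root :: l, rfl, ?_, hl, rfl⟩
  rw [← hlast, List.getLast?_eq_getLast_of_ne_nil]

/-- The word spelled by the path from the root to the selected node. -/
noncomputable def selWord (t : DTree α) : List α := (exists_isSelPath t).choose

theorem isSelPath_selWord (t : DTree α) : IsSelPath t (selWord t) := (exists_isSelPath t).choose_spec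

theorem isSelPath_iff {t : DTree α} {w : List α} : IsSelPath t w ↔ w = selWord t := by
  refine ⟨?_, fun h => h ▸ isSelPath_selWord t⟩
  rintro ⟨vs, h₁, h₂, h₃, rfl⟩
  obtain ⟨vs', h₁', h₂', h₃', h⟩ := isSelPath_selWord t
  rw [h, t.path_unique vs vs' h₁ h₁' (h₂.trans h₂'.symm) h₃ h₃']

theorem mem_selPaths {S : Finset (DTree α)} {w : List α} :
    w ∈ selPaths S ↔ ∃ t ∈ S, w = selWord t := by
  simp [selPaths, isSelPath_iff]

theorem selWord_chainTree (w : List α) (hw : 2 ≤ w.length) : selWord (chainTree w hw) = w := by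
  symm
  rw [← isSelPath_iff]
  have h₁ : (List.finRange w.length).head? = some ⟨0, by omega⟩ := by
    rw [List.head?_eq_getElem?, List.getElem?_eq_getElem (by simp; omega)]
    simp
  have h₂ : (List.finRange w.length).getLast? = some ⟨w.length - 1, by omega⟩ := by
    rw [List.getLast?_eq_getElem?, List.getElem?_eq_getElem (by simp; omega)]
    simp
  have h₃ : (List.finRange w.length).IsChain (fun i j : Fin w.length => (i : ℕ) + 1 = j) := by
    rw [List.isChain_iff_getElem]
    intro i hi
    simp
  exact ⟨List.finRange w.length, h₁, h₂, h₃, (List.map_get_finRange w).symm⟩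

/-! ### Matching a query against a word -/

/-- A letter satisfies the label condition of a query node. -/
def LabelOK (b : Option α) (c : α) : Prop := ∀ a, b = some a → c = a

@[simp] theorem labelOK_none (c : α) : LabelOK none c := by simp [LabelOK]

@[simp] theorem labelOK_some (a c : α) : LabelOK (some a) c ↔ c = a := by simp [LabelOK]

/-- The steps of a path query match a word. -/
def StepsMatch : List (Axis × Option α) → List α → Prop
  | [], w => w = []
  | (x, b) :: s, w => ∃ g c w', w = g ++ c :: w' ∧ (x = Axis.child → g = []) ∧ LabelOK b c ∧
      StepsMatch s w'

/-- A path query matches a word. -/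
def QueryMatch (q : PathQuery α) (w : List α) : Prop :=
  ∃ c w', w = c :: w' ∧ LabelOK q.head c ∧ StepsMatch q.steps w'

/-- Each descendant edge is expanded into a chain of child edges; the letters strictly inside the
chain are those skipped by `StepsMatch`. -/
theorem exists_path_of_embedding {n : ℕ} {R : Fin n → Fin n → Prop} (lab : Fin n → α) :
    ∀ (s : List (Axis × Option α)) (f : Fin (s.length + 1) → Fin n),
    (∀ i : Fin s.length, (s.get i).1 = Axis.child → R (f i.castSucc) (f i.succ)) →
    (∀ i : Fin s.length, (s.get i).1 = Axis.desc →
      Relation.TransGen R (f i.castSucc) (f i.succ)) →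
    (∀ i : Fin s.length, LabelOK (s.get i).2 (lab (f i.succ))) →
    ∃ vs, List.IsChain R (f 0 :: vs) ∧ (f 0 :: vs).getLast? = some (f (Fin.last _)) ∧
      StepsMatch s (vs.map lab)
  | [], f, _, _, _ => ⟨[], by simp, by simp, rfl⟩
  | (x, b) :: s, f, hc, hd, hl => by
    obtain ⟨vs, h₁, h₂, h₃⟩ := exists_path_of_embedding lab s (fun i => f i.succ)
      (fun i h => hc i.succ h) (fun i h => hd i.succ h) (fun i => hl i.succ)
    have hlab : LabelOK b (lab (f (Fin.succ 0))) := hl 0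
    obtain ⟨g, hg, hxg⟩ : ∃ g : List (Fin n), List.IsChain R (f 0 :: (g ++ [f (Fin.succ 0)])) ∧
        (x = Axis.child → g = []) := by
      cases x with
      | child => exact ⟨[], by simpa using hc 0 rfl, fun _ => rfl⟩
      | desc =>
        obtain ⟨c, hac, hcb⟩ := Relation.TransGen.tail'_iff.1 (hd 0 rfl)
        obtain ⟨l, hl, hlast⟩ := List.exists_isChain_cons_of_relationReflTransGen hac
        refine ⟨l, ?_, by simp⟩
        rw [← List.cons_append, List.isChain_append]
        refine ⟨hl, by simp, ?_⟩
        intro y hy z hz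
        have : y = c := by
          rw [← hlast]
          rw [List.getLast?_eq_getLast_of_ne_nil (by simp)] at hy
          simpa using hy.symm
        simp at hz
        subst this
        rw [← hz]
        exact hcb
    refine ⟨g ++ f (Fin.succ 0) :: vs, ?_, ?_, g.map lab, _, vs.map lab, by simp,
      fun h => by simp [hxg h], hlab, h₃⟩
    · have := List.IsChain.append_overlap (l₁ := f 0 :: g) (l₂ := [f (Fin.succ 0)]) (l₃ := vs)
        (by simpa using hg) (by simpa using h₁) (by simp)
      simpa using this
    · rw [← List.cons_append, List.getLast?_append, h₂]
      rfl

theorem exists_embedding_of_path {n : ℕ} {R : Fin n → Fin n → Prop} (lab : Fin n → α) :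
    ∀ (s : List (Axis × Option α)) (v : Fin n) (vs : List (Fin n)),
    List.IsChain R (v :: vs) → StepsMatch s (vs.map lab) →
    ∃ f : Fin (s.length + 1) → Fin n, f 0 = v ∧ (v :: vs).getLast? = some (f (Fin.last _)) ∧
    (∀ i : Fin s.length, (s.get i).1 = Axis.child → R (f i.castSucc) (f i.succ)) ∧
    (∀ i : Fin s.length, (s.get i).1 = Axis.desc →
      Relation.TransGen R (f i.castSucc) (f i.succ)) ∧
    (∀ i : Fin s.length, LabelOK (s.get i).2 (lab (f i.succ)))
  | [], v, vs, _, h => by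
    have : vs = [] := by simpa [StepsMatch] using h
    subst this
    exact ⟨fun _ => v, rfl, by simp, fun i => i.elim0, fun i => i.elim0, fun i => i.elim0⟩
  | (x, b) :: s, v, vs, hc, h => by
    obtain ⟨g, c, w', hw, hx, hb, hs⟩ := h
    obtain ⟨g', vs₁, rfl, rfl, h₁⟩ := List.map_eq_append_iff.1 hw
    obtain ⟨z, vs', rfl, rfl, rfl⟩ := List.map_eq_cons_iff.1 h₁
    rw [← List.cons_append, List.isChain_append] at hc
    obtain ⟨f, hf0, hfl, hfc, hfd, hfb⟩ := exists_embedding_of_path lab s z vs' hc.2.1 hs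
    have htr : Relation.TransGen R v z := by
      have : List.IsChain R (v :: (g' ++ [z])) := by
        rw [← List.cons_append, List.isChain_append]
        exact ⟨hc.1, by simp, fun x hx y hy => hc.2.2 x hx y (by simpa using hy)⟩
      refine Relation.TransGen.tail'_iff.2 ⟨(v :: g').getLast (by simp), ?_, ?_⟩
      · exact List.relationReflTransGen_of_exists_isChain_cons g' hc.1 rfl
      · exact hc.2.2 _ (by rw [List.getLast?_eq_getLast_of_ne_nil (by simp)]; rfl) _ (by simp)
    refine ⟨Fin.cons v f, rfl, ?_, ?_, ?_, ?_⟩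
    · rw [← List.cons_append, List.getLast?_append, hfl]
      rfl
    · intro i
      refine Fin.cases ?_ (fun j => ?_) i
      · intro h
        have hg : g' = [] := by simpa using hx h
        subst hg
        have := hc.2.2 v (by simp) z (by simp)
        simpa [hf0] using this
      · intro h
        exact hfc j h
    · intro i
      refine Fin.cases ?_ (fun j => ?_) i
      · intro h
        simpa [hf0] using htr
      · intro h
        exact hfd j h
    · intro i
      refine Fin.cases ?_ (fun j => ?_) i
      · simpa [hf0] using hb
      · exact hfb j

/-- The expanded embedding runs from the root to the selected node, hence is the selecting path by
uniqueness. From here on trees enter only through their selecting words. -/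
theorem mem_lang_iff {q : PathQuery α} {t : DTree α} : t ∈ q.lang ↔ QueryMatch q (selWord t) := by
  constructor
  · rintro ⟨f, hf⟩
    obtain ⟨vs, h₁, h₂, h₃⟩ := exists_path_of_embedding t.lab q.steps f hf.child hf.desc
      (fun i a h => hf.lab i.succ a (by simpa [PathQuery.label] using h))
    have : selWord t = (f 0 :: vs).map t.lab :=
      (isSelPath_iff.1 ⟨_, by simp [hf.root], h₂.trans (by rw [hf.sel]), h₁, rfl⟩).symm
    exact ⟨_, _, this, fun a h => hf.lab 0 a (by simpa [PathQuery.label] using h), h₃⟩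
  · rintro ⟨c, w', hw, hb, hs⟩
    obtain ⟨vs, h₁, h₂, h₃, h⟩ := isSelPath_selWord t
    rw [hw] at h
    obtain ⟨v, vs, rfl, rfl, rfl⟩ := List.map_eq_cons_iff.1 h.symm
    obtain ⟨f, hf0, hfl, hfc, hfd, hfb⟩ := exists_embedding_of_path t.lab q.steps v vs h₃ hs
    refine ⟨f, ?_, hfc, hfd, ?_, ?_⟩
    · simpa [hf0] using h₁
    · intro i
      refine Fin.cases ?_ (fun j => ?_) i
      · intro a h
        rw [hf0]
        exact hb a (by simpa [PathQuery.label] using h)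
      · intro a h
        exact hfb j a (by simpa [PathQuery.label] using h)
    · rw [hfl] at h₂
      simpa using h₂

theorem consistent_iff {S : Finset (DTree α)} {q : PathQuery α} :
    q.Consistent S ↔ ∀ w ∈ selPaths S, QueryMatch q w := by
  constructor
  · rintro h w hw
    obtain ⟨t, ht, rfl⟩ := mem_selPaths.1 hw
    exact mem_lang_iff.1 (h ht)
  · intro h t ht
    exact mem_lang_iff.2 (h _ (mem_selPaths.2 ⟨t, ht, rfl⟩))

theorem two_le_length_selWord (t : DTree α) : 2 ≤ (selWord t).length := by
  obtain ⟨vs, h₁, h₂, h₃, h⟩ := isSelPath_selWord t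
  rw [h, List.length_map]
  match vs with
  | [] => simp at h₁
  | [v] =>
    simp at h₁ h₂
    exact absurd (h₂.symm.trans h₁) t.sel_ne_root
  | _ :: _ :: _ => simp

end TwigLearn

namespace TwigLearn

universe u

variable {α : Type u}

/-! ### Anchoredness along the list of steps -/

/-- Anchoredness of a list of steps; `ok` says that the node before the first step may be
incident to a descendant edge. -/
def AnchSteps : Prop → List (Axis × Option α) → Prop
  | _, [] => True
  | ok, (x, b) :: s => (x = Axis.desc → ok ∧ (b = none → s = [])) ∧ AnchSteps (b ≠ none) s

theorem anchSteps_iff : ∀ (ok : Prop) (s : List (Axis × Option α)), AnchSteps ok s ↔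
    ∀ i : Fin s.length, (s.get i).1 = Axis.desc →
      (i.castSucc = 0 → ok) ∧ (∀ j : Fin s.length, j.succ = i.castSucc → (s.get j).2 ≠ none) ∧
      ((s.get i).2 = none → i.succ = Fin.last _)
  | ok, [] => by simp [AnchSteps]
  | ok, (x, b) :: s => by
    rw [AnchSteps, anchSteps_iff]
    constructor
    · rintro ⟨h₁, h₂⟩ i
      refine Fin.cases ?_ (fun i => ?_) i
      · intro h
        refine ⟨fun _ => (h₁ h).1, fun j hj => ?_, fun hb => ?_⟩
        · simp at hj
        · have := (h₁ h).2 hb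
          subst this
          rfl
      · intro h
        obtain ⟨h₃, h₄, h₅⟩ := h₂ i h
        refine ⟨fun h0 => ?_, fun j => ?_, fun hb => ?_⟩
        · simp [Fin.ext_iff] at h0
        · refine Fin.cases ?_ (fun j => ?_) j
          · intro hj
            exact h₃ (by simpa [Fin.ext_iff, eq_comm] using hj)
          · intro hj
            exact h₄ j (by simpa [Fin.ext_iff] using hj)
        · have := h₅ hb
          simpa [Fin.ext_iff] using this
    · intro h
      refine ⟨fun hx => ⟨(h 0 hx).1 rfl, fun hb => ?_⟩, fun i hi => ⟨fun h0 => ?_, fun j hj => ?_,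
        fun hb => ?_⟩⟩
      · have := (h 0 hx).2.2 hb
        simpa [Fin.ext_iff, eq_comm] using this
      · exact (h i.succ hi).2.1 0 (by simpa [Fin.ext_iff, eq_comm] using h0)
      · exact (h i.succ hi).2.1 j.succ (by simpa [Fin.ext_iff] using hj)
      · have := (h i.succ hi).2.2 hb
        simpa [Fin.ext_iff] using this

theorem isAnchored_iff (q : PathQuery α) :
    q.IsAnchored ↔ q.steps ≠ [] ∧ AnchSteps True q.steps := by
  rw [anchSteps_iff, PathQuery.IsAnchored]
  refine and_congr_right fun _ => forall_congr' fun i => forall_congr' fun _ => ?_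
  constructor
  · rintro ⟨h₁, h₂⟩
    refine ⟨fun _ => trivial, fun j hj hb => ?_, h₂⟩
    have : q.label i.castSucc = none := by
      rw [← hj]
      exact hb
    have := h₁ this
    rw [← hj] at this
    exact Fin.succ_ne_zero _ this
  · rintro ⟨-, h₁, h₂⟩
    refine ⟨fun hb => ?_, h₂⟩
    by_contra h0
    obtain ⟨j, hj⟩ := Fin.exists_succ_eq.2 h0
    refine h₁ j hj ?_
    rw [← hj] at hb
    exact hb

/-- Since `s` is nonempty, a node before it is not the last one, so the target of any earlier
descendant edge is labelled and stays harmless. Only the replaced segment has to be checked, for an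
arbitrary flag. -/
theorem AnchSteps.replace {s s' r : List (Axis × Option α)} (hs : s ≠ [])
    (h : ∀ ok, AnchSteps ok (s ++ r) → AnchSteps ok (s' ++ r)) :
    ∀ (l : List (Axis × Option α)) (ok : Prop), AnchSteps ok (l ++ s ++ r) →
      AnchSteps ok (l ++ s' ++ r)
  | [], ok, hl => h ok hl
  | (x, b) :: l, ok, hl => by
    refine ⟨fun hx => ⟨(hl.1 hx).1, fun hb => ?_⟩, AnchSteps.replace hs h l _ hl.2⟩
    have := (hl.1 hx).2 hb
    simp [hs] at this

theorem anchSteps_map_child {r : List (Axis × Option α)} (hr : AnchSteps True r) :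
    ∀ (ok : Prop) (u : List α), ok →
    AnchSteps ok (u.map (fun b => (Axis.child, some b)) ++ r)
  | ok, [], h => by simpa [h] using hr
  | ok, a :: u, _ => ⟨by simp, anchSteps_map_child hr _ u (by simp)⟩

theorem anchSteps_factorSteps {ok : Prop} {u : List α} {b : Option α}
    {r : List (Axis × Option α)} (h : AnchSteps ok ((Axis.desc, b) :: r)) :
    AnchSteps ok (factorSteps u ++ (Axis.desc, b) :: r) := by
  cases u with
  | nil => exact h
  | cons a u =>
    refine ⟨fun _ => ⟨(h.1 rfl).1, by simp⟩, ?_⟩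
    refine anchSteps_map_child ?_ _ u (by simp)
    exact ⟨fun hx => ⟨trivial, (h.1 hx).2⟩, h.2⟩

theorem anchSteps_starSteps {b : Option α} {r : List (Axis × Option α)}
    (h : AnchSteps (b ≠ none) r) :
    ∀ (k : ℕ) (ok : Prop), AnchSteps ok (starSteps Axis.child k b ++ r)
  | 0, ok => ⟨by simp, h⟩
  | k + 1, ok => ⟨by simp, anchSteps_starSteps h k _⟩

/-! ### Soundness: every step preserves anchoredness and consistency -/

theorem InsertStep.isAnchored {S : Finset (DTree α)} {u : List α} {p p' : PathQuery α}
    (h : InsertStep S u p p') (hp : p.IsAnchored) : p'.IsAnchored ∧ p'.Consistent S := by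
  obtain ⟨l, b, r, hs, rfl, hc⟩ := h
  refine ⟨?_, hc⟩
  rw [isAnchored_iff] at hp ⊢
  refine ⟨by simp, ?_⟩
  have := AnchSteps.replace (s := [(Axis.desc, b)]) (s' := factorSteps u ++ [(Axis.desc, b)])
    (r := r) (by simp) (fun ok h => by simpa using anchSteps_factorSteps h) l True
    (by simpa [hs] using hp.2)
  simpa using this

theorem Stage1.isAnchored {S : Finset (DTree α)} : ∀ {us : List (List α)} {p p' : PathQuery α},
    Stage1 S us p p' → p.IsAnchored ∧ p.Consistent S → p'.IsAnchored ∧ p'.Consistent S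
  | [], p, p', h, hp => by rw [show p' = p from h]; exact hp
  | u :: us, p, p', ⟨m, hm, h⟩, hp => by
    refine Stage1.isAnchored h ?_
    have := hm.1
    clear hm h
    induction this with
    | refl => exact hp
    | tail _ h ih => exact h.isAnchored ih.1

theorem setHead_isAnchored {p : PathQuery α} {a : α} (hp : p.IsAnchored) :
    (setHead p a).IsAnchored := by
  rw [isAnchored_iff] at *
  exact hp

theorem modifyLast_steps (l : List (Axis × Option α)) (x : Axis) (b : Option α) (a : α) :
    (l ++ [(x, b)]).modifyLast (fun s => (s.1, some a)) = l ++ [(x, some a)] := by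
  rw [List.modifyLast_concat]

theorem setLast_isAnchored {p : PathQuery α} {a : α} (hp : p.IsAnchored) :
    (setLast p a).IsAnchored := by
  rw [isAnchored_iff] at *
  obtain ⟨h, s⟩ := p
  rcases List.eq_nil_or_concat s with rfl | ⟨l, ⟨x, b⟩, rfl⟩
  · simp at hp
  · rw [setLast]
    simp only [List.concat_eq_append, modifyLast_steps]
    refine ⟨by simp, ?_⟩
    have := AnchSteps.replace (s := [(x, b)]) (s' := [(x, some a)])
      (r := []) (by simp) ?_ l True (by simpa using hp.2)
    · simpa using this
    · intro ok h
      exact ⟨fun hx => ⟨(h.1 hx).1, by simp⟩, trivial⟩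

open Classical in
theorem stage2_isAnchored {S : Finset (DTree α)} {a₀ aₙ : α} {p : PathQuery α}
    (hp : p.IsAnchored ∧ p.Consistent S) :
    (stage2 S a₀ aₙ p).IsAnchored ∧ (stage2 S a₀ aₙ p).Consistent S := by
  have key : ∀ p' : PathQuery α, p'.IsAnchored ∧ p'.Consistent S →
      (if (setLast p' aₙ).Consistent S then setLast p' aₙ else p').IsAnchored ∧
      (if (setLast p' aₙ).Consistent S then setLast p' aₙ else p').Consistent S := by
    intro p' hp'
    split_ifs with h
    · exact ⟨setLast_isAnchored hp'.1, h⟩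
    · exact hp'
  unfold stage2
  refine key _ ?_
  split_ifs with h
  · exact ⟨setHead_isAnchored hp.1, h⟩
  · exact hp

theorem ResolveStep.isAnchored {S : Finset (DTree α)} {h : Option α}
    {m m' : List (Bool × (Axis × Option α))} (hm : ResolveStep S h m m')
    (hp : PathQuery.IsAnchored ⟨h, m.map Prod.snd⟩ ∧
      PathQuery.Consistent S ⟨h, m.map Prod.snd⟩) :
    PathQuery.IsAnchored ⟨h, m'.map Prod.snd⟩ ∧ PathQuery.Consistent S ⟨h, m'.map Prod.snd⟩ := by
  have hstar : ∀ (x : Axis) (k : ℕ) (b : Option α), starSteps x k b ≠ [] := by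
    intro x k b
    cases k <;> simp [starSteps]
  obtain ⟨l, b, r, k, rfl, -, ⟨hc, rfl⟩ | ⟨-, rfl⟩⟩ := hm
  · have hmap : ((starSteps Axis.child k b).map (Prod.mk false)).map Prod.snd =
        starSteps Axis.child k b := by simp [Function.comp_def]
    simp only [List.map_append, hmap]
    refine ⟨?_, hc⟩
    rw [isAnchored_iff] at hp ⊢
    refine ⟨by simp [hstar], ?_⟩
    refine AnchSteps.replace (s := [(Axis.desc, b)]) (by simp) ?_ _ True
      (by simpa using hp.1.2)
    intro ok h
    exact anchSteps_starSteps h.2 k ok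
  · simpa using hp

theorem queryMatch_universalQuery {w : List α} (hw : 2 ≤ w.length) :
    QueryMatch (universalQuery α) w := by
  match w with
  | c :: w =>
    rcases List.eq_nil_or_concat w with rfl | ⟨g, d, rfl⟩
    · simp at hw
    · exact ⟨c, _, rfl, labelOK_none _, g, d, [], by simp, by simp, labelOK_none _, rfl⟩

theorem universalQuery_isAnchored : (universalQuery α).IsAnchored := by
  rw [isAnchored_iff]
  exact ⟨by simp [universalQuery], by simp [universalQuery, AnchSteps]⟩

theorem universalQuery_consistent (S : Finset (DTree α)) : (universalQuery α).Consistent S :=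
  fun t _ => mem_lang_iff.2 (queryMatch_universalQuery (two_le_length_selWord t))

theorem markStep_snd (s : Axis × Option α) : (markStep s).2 = s := by
  rcases s with ⟨_ | _, b⟩ <;> rfl

theorem map_snd_map_markStep (s : List (Axis × Option α)) :
    (s.map markStep).map Prod.snd = s := by
  simp [Function.comp_def, markStep_snd]

theorem LearnerAnchPath.sound [LinearOrder α] {S : Finset (DTree α)} {p : PathQuery α}
    (h : LearnerAnchPath S p) : p.IsAnchored ∧ p.Consistent S := by
  obtain ⟨a₀, aₙ, inner, us, p₁, -, -, -, -, h₁, m, hm, -, rfl⟩ := h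
  have hp := stage2_isAnchored (a₀ := a₀) (aₙ := aₙ)
    (h₁.isAnchored ⟨universalQuery_isAnchored, universalQuery_consistent S⟩)
  generalize stage2 S a₀ aₙ p₁ = p at *
  induction hm with
  | refl =>
    rw [map_snd_map_markStep]
    exact hp
  | tail _ h ih => exact h.isAnchored ih

end TwigLearn

namespace TwigLearn

universe u

variable {α : Type u}

/-! ### Disjoint occurrences of factors -/

theorem eq_append_of_notMem {σ : Type*} {c rest l r : List σ} {x : σ}
    (h : c ++ rest = l ++ x :: r) (hx : x ∉ c) : ∃ l', l = c ++ l' ∧ rest = l' ++ x :: r := by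
  rcases List.append_eq_append_iff.1 h with ⟨a, rfl, ha⟩ | ⟨a, rfl, ha⟩
  · exact ⟨a, rfl, ha⟩
  · cases a with
    | nil => exact ⟨[], by simp, by simpa using ha.symm⟩
    | cons y a =>
      simp only [List.cons_append, List.cons.injEq] at ha
      exact absurd (by simp [ha.1]) hx

/-- The words of `F` occur in `w` as disjoint factors, in the given order. -/
def Occ : List (List α) → List α → Prop
  | [], _ => True
  | f :: F, w => ∃ g w', w = g ++ f ++ w' ∧ Occ F w'

theorem Occ.append_left {F : List (List α)} {w : List α} (h : Occ F w) (g : List α) :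
    Occ F (g ++ w) := by
  cases F with
  | nil => trivial
  | cons f F =>
    obtain ⟨g', w', rfl, h⟩ := h
    exact ⟨g ++ g', w', by simp, h⟩

theorem Occ.append_right : ∀ {F : List (List α)} {w : List α}, Occ F w → ∀ g : List α,
    Occ F (w ++ g)
  | [], _, _, _ => trivial
  | f :: F, _, ⟨g', w', hw, h⟩, g => ⟨g', w' ++ g, by simp [hw], h.append_right g⟩

theorem Occ.sublist {F F' : List (List α)} (hF : F.Sublist F') : ∀ {w : List α}, Occ F' w →
    Occ F w := by
  induction hF with
  | slnil => exact id
  | cons f _ ih =>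
    rintro w ⟨g, w', rfl, h⟩
    exact (ih h).append_left _
  | cons_cons f _ ih =>
    rintro w ⟨g, w', rfl, h⟩
    exact ⟨g, w', rfl, ih h⟩

/-- As `c` lies in no word of `F`, no occurrence can straddle it: each word falls entirely to its
left or to its right, and the order is kept. -/
theorem Occ.split {c : α} : ∀ {F : List (List α)} {X Y : List α}, (∀ f ∈ F, c ∉ f) →
    Occ F (X ++ c :: Y) → ∃ F₁ F₂, F = F₁ ++ F₂ ∧ Occ F₁ X ∧ Occ F₂ Y
  | [], _, _, _, _ => ⟨[], [], rfl, trivial, trivial⟩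
  | f :: F, X, Y, hF, ⟨g, w', hw, h⟩ => by
    rcases List.append_eq_append_iff.1 hw with ⟨a, ha, hb⟩ | ⟨a, rfl, rfl⟩
    · cases a with
      | nil =>
        simp only [List.nil_append] at hb
        simp only [List.append_nil] at ha
        subst hb ha
        obtain ⟨F₁, F₂, rfl, h₁, h₂⟩ := Occ.split (X := []) (fun f hf => hF f (by simp [hf])) h
        exact ⟨f :: F₁, F₂, rfl, ⟨g, [], by simp, h₁⟩, h₂⟩
      | cons y a =>
        simp only [List.cons_append, List.cons.injEq] at hb
        obtain ⟨rfl, rfl⟩ := hb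
        rcases List.append_eq_append_iff.1 ha with ⟨e, rfl, he⟩ | ⟨e, rfl, he⟩
        · exact absurd (by simp [he]) (hF f (by simp))
        · cases e with
          | nil => exact absurd (by simp at he; simp [← he]) (hF f (by simp))
          | cons z e =>
            simp only [List.cons_append, List.cons.injEq] at he
            obtain ⟨rfl, rfl⟩ := he
            exact ⟨[], f :: F, rfl, trivial, e, w', by simp, h⟩
    · obtain ⟨F₁, F₂, rfl, h₁, h₂⟩ := Occ.split (fun f hf => hF f (by simp [hf])) h
      exact ⟨f :: F₁, F₂, rfl, ⟨g, a, by simp, h₁⟩, h₂⟩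

theorem Occ.eq_nil {F : List (List α)} (hF : ∀ f ∈ F, f ≠ []) (h : Occ F []) : F = [] := by
  cases F with
  | nil => rfl
  | cons f F =>
    obtain ⟨g, w', hw, -⟩ := h
    simp at hw
    exact absurd hw.2.1 (hF f (by simp))

theorem Occ.of_append {F : List (List α)} {Y : List α} (hF : ∀ f ∈ F, f ≠ []) :
    ∀ {G : List α}, (∀ c ∈ G, ∀ f ∈ F, c ∉ f) → Occ F (G ++ Y) → Occ F Y
  | [], _, h => h
  | c :: G, hG, h => by
    obtain ⟨F₁, F₂, rfl, h₁, h₂⟩ := Occ.split (X := []) (hG c (by simp)) h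
    have := h₁.eq_nil fun f hf => hF f (by simp [hf])
    subst this
    exact Occ.of_append hF (fun c hc => hG c (by simp [hc])) h₂

theorem Occ.sum_le : ∀ {F : List (List α)} {w : List α}, Occ F w →
    (F.map List.length).sum ≤ w.length
  | [], _, _ => by simp
  | f :: F, _, ⟨g, w', hw, h⟩ => by
    have := h.sum_le
    subst hw
    simp
    omega

/-- The total length by which the words of `F` exceed the length `L`. -/
def excess (L : ℕ) (F : List (List α)) : ℕ := (F.map fun f => f.length - L).sum

theorem excess_append (L : ℕ) (F F' : List (List α)) :
    excess L (F ++ F') = excess L F + excess L F' := by simp [excess]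

theorem excess_le_sum (L : ℕ) : ∀ F : List (List α), excess L F ≤ (F.map List.length).sum
  | [] => by simp [excess]
  | f :: F => by
    have := excess_le_sum L F
    simp only [excess, List.map_cons, List.sum_cons] at *
    omega

/-- Two or more words of length at least `L` lose `L` at least twice, while `v` loses it only once,
so their excess is strictly smaller. A single word reaches the excess of `v` only by filling `v`.
The empty list reaches it when `v` has length at most `L`, and is then a sublist trivially. -/
theorem Occ.excess_le {L : ℕ} (hL : 1 ≤ L) {F : List (List α)} {v : List α}
    (hF : ∀ f ∈ F, L ≤ f.length) (h : Occ F v) :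
    excess L F ≤ excess L [v] ∧ (excess L F = excess L [v] → F.Sublist [v]) := by
  match F with
  | [] => simp [excess]
  | [f] =>
    obtain ⟨g, w', rfl, -⟩ := h
    have := hF f (by simp)
    simp only [excess, List.map_cons, List.map_nil, List.sum_cons, List.sum_nil,
      List.length_append]
    refine ⟨by omega, fun h => ?_⟩
    have h₁ : g = [] := List.eq_nil_of_length_eq_zero (by omega)
    have h₂ : w' = [] := List.eq_nil_of_length_eq_zero (by omega)
    simp [h₁, h₂]
  | f₁ :: f₂ :: F =>
    have := h.sum_le
    have h₁ := hF f₁ (by simp)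
    have h₂ := hF f₂ (by simp)
    have h₃ := excess_le_sum L F
    simp only [excess, List.map_cons, List.map_nil, List.sum_cons, List.sum_nil] at *
    exact ⟨by omega, fun h => by omega⟩

/-- Words of length at most `L` contribute nothing. On the longer ones a sublist with full counts is
the whole list. -/
theorem excess_eq_of_count [DecidableEq α] {L : ℕ} {F V : List (List α)} (h : F.Sublist V)
    (hc : ∀ x ∈ V, L < x.length → F.count x = V.count x) : excess L F = excess L V := by
  have key : ∀ W : List (List α), excess L W = excess L (W.filter fun x => L < x.length) := by
    intro W
    induction W with
    | nil => rfl
    | cons w W ih =>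
      by_cases hw : L < w.length
      · simp only [excess, hw, decide_true, List.filter_cons_of_pos, List.map_cons,
          List.sum_cons] at *
        omega
      · rw [List.filter_cons_of_neg (by simpa using hw), ← ih]
        simp only [excess, List.map_cons, List.sum_cons]
        omega
  rw [key F, key V]
  congr 1
  refine (h.filter _).eq_of_length (List.Perm.length_eq ?_)
  rw [List.perm_iff_count]
  intro x
  by_cases hx : L < x.length
  · rw [List.count_filter (by simpa using hx), List.count_filter (by simpa using hx)]
    by_cases hV : x ∈ V
    · exact hc x hV hx
    · rw [List.count_eq_zero_of_not_mem hV, List.count_eq_zero_of_not_mem fun h' => hV (h.subset h')]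
  · rw [List.count_eq_zero_of_not_mem (by simp [hx]), List.count_eq_zero_of_not_mem (by simp [hx])]

theorem exists_insert_of_count_lt [DecidableEq α] {u : List α} {F V : List (List α)}
    (h : F.Sublist V) : F.count u < V.count u →
    ∃ l r, F = l ++ r ∧ (l ++ u :: r).Sublist V := by
  induction h with
  | slnil => simp
  | @cons F V v h ih =>
    intro hc
    by_cases hv : v = u
    · subst hv
      exact ⟨[], F, rfl, h.cons_cons _⟩
    · rw [List.count_cons_of_ne hv] at hc
      obtain ⟨l, r, rfl, hs⟩ := ih hc
      exact ⟨l, r, rfl, hs.cons _⟩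
  | @cons_cons F V v h ih =>
    intro hc
    rw [List.count_cons, List.count_cons] at hc
    obtain ⟨l, r, rfl, hs⟩ := ih (by omega)
    exact ⟨v :: l, r, rfl, hs.cons_cons _⟩

/-! ### The first stage -/

/-- The query `h//u₁//…//uₖ//b`. -/
def factorQuery (h : Option α) (F : List (List α)) (b : Option α) : PathQuery α :=
  ⟨h, F.flatMap factorSteps ++ [(Axis.desc, b)]⟩

theorem stepsMatch_map_child (s : List (Axis × Option α)) : ∀ (u w : List α),
    StepsMatch (u.map (fun b => (Axis.child, some b)) ++ s) w ↔ ∃ w', w = u ++ w' ∧ StepsMatch s w'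
  | [], w => by simp
  | a :: u, w => by
    simp only [List.map_cons, List.cons_append, StepsMatch, forall_const, labelOK_some]
    constructor
    · rintro ⟨g, c, w', rfl, rfl, rfl, h⟩
      obtain ⟨w'', rfl, h'⟩ := (stepsMatch_map_child s u w').1 h
      exact ⟨w'', rfl, h'⟩
    · rintro ⟨w', rfl, h⟩
      exact ⟨[], a, u ++ w', rfl, rfl, rfl, (stepsMatch_map_child s u _).2 ⟨w', rfl, h⟩⟩

theorem stepsMatch_factorSteps (s : List (Axis × Option α)) {f : List α} (hf : f ≠ [])
    (w : List α) : StepsMatch (factorSteps f ++ s) w ↔ ∃ g w', w = g ++ f ++ w' ∧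
      StepsMatch s w' := by
  cases f with
  | nil => exact absurd rfl hf
  | cons a u =>
    simp only [factorSteps, List.cons_append, StepsMatch, labelOK_some, stepsMatch_map_child]
    constructor
    · rintro ⟨g, c, w', rfl, -, rfl, w'', rfl, h⟩
      exact ⟨g, w'', by simp, h⟩
    · rintro ⟨g, w', rfl, h⟩
      exact ⟨g, a, u ++ w', by simp, by simp, rfl, w', rfl, h⟩

theorem stepsMatch_factorQuery {b : Option α} : ∀ {F : List (List α)} (_ : ∀ f ∈ F, f ≠ [])
    {w : List α}, StepsMatch (F.flatMap factorSteps ++ [(Axis.desc, b)]) w ↔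
      ∃ X d, w = X ++ [d] ∧ LabelOK b d ∧ Occ F X
  | [], _, w => by
    simp only [List.flatMap_nil, List.nil_append, StepsMatch, Occ, and_true]
    constructor
    · rintro ⟨g, c, _, rfl, -, h, rfl⟩
      exact ⟨g, c, rfl, h⟩
    · rintro ⟨g, c, rfl, h⟩
      exact ⟨g, c, _, rfl, by simp, h, rfl⟩
  | f :: F, hF, w => by
    rw [List.flatMap_cons, List.append_assoc, stepsMatch_factorSteps _ (hF f (by simp))]
    constructor
    · rintro ⟨g, w', rfl, h⟩
      obtain ⟨X, d, rfl, hb, h⟩ := (stepsMatch_factorQuery fun f hf => hF f (by simp [hf])).1 h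
      exact ⟨g ++ f ++ X, d, by simp, hb, g, X, rfl, h⟩
    · rintro ⟨X, d, rfl, hb, g, X, rfl, h⟩
      exact ⟨g, X ++ [d], by simp,
        (stepsMatch_factorQuery fun f hf => hF f (by simp [hf])).2 ⟨X, d, rfl, hb, h⟩⟩

theorem queryMatch_factorQuery {h b : Option α} {F : List (List α)} (hF : ∀ f ∈ F, f ≠ [])
    {w : List α} : QueryMatch (factorQuery h F b) w ↔
      ∃ c X d, w = c :: (X ++ [d]) ∧ LabelOK h c ∧ LabelOK b d ∧ Occ F X := by
  simp only [QueryMatch, factorQuery, stepsMatch_factorQuery hF]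
  constructor
  · rintro ⟨c, _, rfl, hc, X, d, rfl, hd, ho⟩
    exact ⟨c, X, d, rfl, hc, hd, ho⟩
  · rintro ⟨c, X, d, rfl, hc, hd, ho⟩
    exact ⟨c, _, rfl, hc, X, d, rfl, hd, ho⟩

/-- The descendant edges of a factor query stand only in front of the factors and of the selecting
node. Replacing one of them is therefore the same as inserting a word into the list `F`. -/
theorem factorQuery_split {b b' : Option α} : ∀ {F : List (List α)}
    {l r : List (Axis × Option α)},
    F.flatMap factorSteps ++ [(Axis.desc, b)] = l ++ (Axis.desc, b') :: r →
    ∃ F₁ F₂, F = F₁ ++ F₂ ∧ l = F₁.flatMap factorSteps ∧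
      (Axis.desc, b') :: r = F₂.flatMap factorSteps ++ [(Axis.desc, b)]
  | [], l, r, h => by
    cases l with
    | nil => exact ⟨[], [], rfl, rfl, h.symm⟩
    | cons x l => simp at h
  | [] :: F, l, r, h => by
    obtain ⟨F₁, F₂, rfl, h₁, h₂⟩ := factorQuery_split (F := F) (by simpa [factorSteps] using h)
    exact ⟨[] :: F₁, F₂, rfl, by simpa [factorSteps] using h₁, h₂⟩
  | (a :: u) :: F, l, r, h => by
    cases l with
    | nil => exact ⟨[], (a :: u) :: F, rfl, rfl, h.symm⟩
    | cons x l =>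
      simp only [List.flatMap_cons, factorSteps, List.cons_append, List.append_assoc,
        List.cons.injEq] at h
      obtain ⟨rfl, h⟩ := h
      obtain ⟨l', rfl, h'⟩ := eq_append_of_notMem h (by simp)
      obtain ⟨F₁, F₂, rfl, h₁, h₂⟩ := factorQuery_split h'
      exact ⟨(a :: u) :: F₁, F₂, rfl, by simp [factorSteps, h₁], h₂⟩

theorem insertStep_factorQuery {S : Finset (DTree α)} {u : List α} {h b : Option α}
    {F : List (List α)} {p : PathQuery α} : InsertStep S u (factorQuery h F b) p ↔
      ∃ l r, F = l ++ r ∧ p = factorQuery h (l ++ u :: r) b ∧ p.Consistent S := by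
  constructor
  · rintro ⟨l, b', r, hs, rfl, hc⟩
    obtain ⟨F₁, F₂, rfl, rfl, h₂⟩ := factorQuery_split hs
    refine ⟨F₁, F₂, rfl, ?_, hc⟩
    simp [factorQuery, h₂]
  · rintro ⟨l, r, rfl, rfl, hc⟩
    obtain ⟨b', r', hr⟩ : ∃ b' r', r.flatMap factorSteps ++ [(Axis.desc, b)] =
        (Axis.desc, b') :: r' := by
      clear hc
      induction r with
      | nil => exact ⟨b, [], rfl⟩
      | cons f r ih =>
        cases f with
        | nil => simpa [factorSteps] using ih
        | cons a u => exact ⟨_, _, rfl⟩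
    exact ⟨l.flatMap factorSteps, b', r', by simp [factorQuery, hr], by simp [factorQuery, hr], hc⟩

/-- Here `V` is the list of runs to be found. The invariant is that `F` is a sublist of `V` and
contains, with full multiplicity, every run that is no longer on the agenda `us`. The hypothesis on
excess keeps wrong insertions out; the consistency of all sublists of `V` prevents the loop from
stopping too early. -/
theorem stage1_eq_factorQuery [DecidableEq α] {S : Finset (DTree α)} {inner : List α}
    {V : List (List α)}
    (h₁ : ∀ F, F.Sublist V → (factorQuery none F none).Consistent S)
    (h₂ : ∀ F L, 1 ≤ L → (∀ f ∈ F, L ≤ f.length ∧ f <:+: inner) →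
      (factorQuery none F none).Consistent S →
      excess L F ≤ excess L V ∧ (excess L F = excess L V → F.Sublist V))
    (h₃ : ∀ v ∈ V, v <:+: inner) : ∀ (us : List (List α)) (F : List (List α)) (p : PathQuery α),
    F.Sublist V → (∀ v ∈ V, v ∈ us ∨ F.count v = V.count v) →
    us.Pairwise (fun u v => v.length ≤ u.length) → (∀ u ∈ us, u ≠ [] ∧ u <:+: inner) →
    (∀ f ∈ F, ∀ u ∈ us, u.length ≤ f.length) →
    Stage1 S us (factorQuery none F none) p → p = factorQuery none V none
  | [], F, p, hF, hc, _, _, _, h => by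
    have : F = V := by
      refine hF.eq_of_length (List.Perm.length_eq ?_)
      rw [List.perm_iff_count]
      intro x
      by_cases hV : x ∈ V
      · simpa using hc x hV
      · rw [List.count_eq_zero_of_not_mem hV,
          List.count_eq_zero_of_not_mem fun h' => hV (hF.subset h')]
    rw [← this]
    exact h
  | u :: us, F, p, hF, hc, hp, hu, hl, ⟨m, ⟨hm, hmax⟩, h⟩ => by
    rw [List.pairwise_cons] at hp
    have inv : ∃ F', m = factorQuery none F' none ∧ F'.Sublist V ∧
        (∀ x, F.count x ≤ F'.count x) ∧ (∀ f ∈ F', f ∈ F ∨ f = u) := by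
      clear h hmax
      induction hm with
      | refl => exact ⟨F, rfl, hF, fun _ => le_rfl, fun f hf => Or.inl hf⟩
      | tail _ hs ih =>
        obtain ⟨F', rfl, hF', hcnt, hmem⟩ := ih
        obtain ⟨l, r, rfl, rfl, hcons⟩ := insertStep_factorQuery.1 hs
        -- A run longer than `u` cannot be on the agenda, which lists lengths in decreasing order,
        -- so it has been inserted completely.
        have hcount : ∀ x ∈ V, u.length < x.length → (l ++ r).count x = V.count x := by
          intro x hx hlen
          refine le_antisymm (hF'.count_le x) ?_
          rcases hc x hx with hx' | hx'
          · rcases List.mem_cons.1 hx' with rfl | hx'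
            · omega
            · have := hp.1 x hx'
              omega
          · rw [← hx']
            exact hcnt x
        -- The excess over `|u|` is already that of `V`, and inserting `u` adds zero; the equality
        -- case then returns a sublist of `V`.
        have hex := excess_eq_of_count hF' hcount
        refine ⟨l ++ u :: r, rfl, (h₂ _ u.length ?_ ?_ hcons).2 ?_, ?_, ?_⟩
        · exact List.length_pos_iff.2 (hu u (by simp)).1
        · intro f hf
          have hf' : f = u ∨ f ∈ l ++ r := by
            simp only [List.mem_append, List.mem_cons] at hf ⊢
            tauto
          rcases hf' with rfl | hf'
          · exact ⟨le_rfl, (hu f (by simp)).2⟩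
          · refine ⟨?_, h₃ f (hF'.subset hf')⟩
            rcases hmem f hf' with h | rfl
            · exact hl f h u (by simp)
            · exact le_rfl
        · rw [← hex]
          simp [excess]
        · intro x
          refine (hcnt x).trans (List.Sublist.count_le x ?_)
          exact (List.sublist_cons_self u r).append_left l
        · intro f hf
          simp only [List.mem_append, List.mem_cons] at hf
          rcases hf with hf | rfl | hf
          · exact hmem f (by simp [hf])
          · exact Or.inr rfl
          · exact hmem f (by simp [hf])
    obtain ⟨F', rfl, hF', hcnt, hmem⟩ := inv
    refine stage1_eq_factorQuery h₁ h₂ h₃ us F' p hF' ?_ hp.2 (fun v hv => hu v (by simp [hv]))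
      ?_ h
    · intro v hv
      have hle := hF'.count_le v
      rcases hc v hv with hv' | hv'
      · rcases List.mem_cons.1 hv' with rfl | hv'
        · right
          -- A copy of `u` still missing from the sublist could be inserted consistently, against
          -- the maximality of the loop.
          by_contra hne
          obtain ⟨l, r, rfl, hs⟩ := exists_insert_of_count_lt hF' (u := v) (by omega)
          exact hmax _ (insertStep_factorQuery.2 ⟨l, r, rfl, rfl, h₁ _ hs⟩)
        · exact Or.inl hv'
      · have := hcnt v
        right
        omega
    · intro f hf v hv
      rcases hmem f hf with h | rfl
      · exact hl f h v (by simp [hv])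
      · exact hp.1 v hv

end TwigLearn

namespace TwigLearn

universe u

variable {α : Type u}

/-! ### Blocks of a query -/

/-- A maximal path of labelled nodes joined by child edges (`some a` followed by the remaining
labels), with the kind of the edge and the number of wildcards that separate it from the preceding
node. The selecting node of a query is a block whose label may be missing. -/
abbrev Block (α : Type u) : Type u := (Axis × ℕ) × Option α × List α

/-- The steps of a block. -/
def blockSteps (κ : Block α) : List (Axis × Option α) :=
  starSteps κ.1.1 κ.1.2 κ.2.1 ++ κ.2.2.map fun b => (Axis.child, some b)

/-- The numbers of letters that a separator may skip. -/
def GapOK : Axis × ℕ → ℕ → Prop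
  | (Axis.child, k), n => n = k
  | (Axis.desc, k), n => k ≤ n

/-- A list of blocks matches a word. -/
def BlocksMatch : List (Block α) → List α → Prop
  | [], w => w = []
  | κ :: K, w => ∃ g c w', w = g ++ c :: (κ.2.2 ++ w') ∧ GapOK κ.1 g.length ∧ LabelOK κ.2.1 c ∧
      BlocksMatch K w'

theorem stepsMatch_starSteps (b : Option α) (s : List (Axis × Option α)) :
    ∀ (k : ℕ) (x : Axis) (w : List α), StepsMatch (starSteps x k b ++ s) w ↔
      ∃ g c w', w = g ++ c :: w' ∧ GapOK (x, k) g.length ∧ LabelOK b c ∧ StepsMatch s w'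
  | 0, x, w => by
    cases x <;> simp [starSteps, StepsMatch, GapOK]
  | k + 1, x, w => by
    simp only [starSteps, List.cons_append, StepsMatch, labelOK_none, true_and]
    constructor
    · rintro ⟨g, c, w', rfl, hx, h⟩
      obtain ⟨g', c', w'', rfl, hg, hb, hs⟩ := (stepsMatch_starSteps b s k _ w').1 h
      refine ⟨g ++ c :: g', c', w'', by simp, ?_, hb, hs⟩
      simp only [GapOK] at hg
      cases x with
      | child => simp [hx rfl, GapOK, hg]
      | desc =>
        simp only [GapOK, List.length_append, List.length_cons, hg]
        omega
    · rintro ⟨g, c, w', rfl, hg, hb, hs⟩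
      have hlen : k + 1 ≤ g.length := by
        cases x with
        | child => exact hg.ge
        | desc => exact hg
      -- The wildcards reached by child edges take the last `k` letters of the gap and the first
      -- wildcard takes the letter before them. Surplus letters `g₁` are left to the first edge, the
      -- only one that may be a descendant edge.
      obtain ⟨g₁, c₁, g₂, rfl, hk⟩ : ∃ g₁ c₁ g₂, g = g₁ ++ c₁ :: g₂ ∧ g₂.length = k := by
        have h₁ : (g.drop (g.length - (k + 1))).length = k + 1 := by
          rw [List.length_drop]
          omega
        obtain ⟨c₁, g₂, h₂⟩ := List.exists_cons_of_length_eq_add_one h₁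
        refine ⟨g.take (g.length - (k + 1)), c₁, g₂, ?_, ?_⟩
        · rw [← h₂, List.take_append_drop]
        · rw [h₂] at h₁
          simpa using h₁
      refine ⟨g₁, c₁, g₂ ++ c :: w', by simp, ?_,
        (stepsMatch_starSteps b s k _ _).2 ⟨g₂, c, w', rfl, hk, hb, hs⟩⟩
      rintro rfl
      simp only [GapOK, List.length_append, List.length_cons] at hg
      exact List.eq_nil_of_length_eq_zero (by omega)

theorem stepsMatch_blocks : ∀ (K : List (Block α)) (w : List α),
    StepsMatch (K.flatMap blockSteps) w ↔ BlocksMatch K w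
  | [], w => Iff.rfl
  | κ :: K, w => by
    rw [List.flatMap_cons, blockSteps, List.append_assoc, stepsMatch_starSteps]
    simp only [stepsMatch_map_child, BlocksMatch]
    constructor
    · rintro ⟨g, c, _, rfl, hg, hb, w', rfl, h⟩
      exact ⟨g, c, w', rfl, hg, hb, (stepsMatch_blocks K w').1 h⟩
    · rintro ⟨g, c, w', rfl, hg, hb, h⟩
      exact ⟨g, c, _, rfl, hg, hb, w', rfl, (stepsMatch_blocks K w').2 h⟩

theorem blocksMatch_concat {κ : Block α} : ∀ {K : List (Block α)} {w : List α},
    BlocksMatch (K ++ [κ]) w ↔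
      ∃ X g c, w = X ++ (g ++ c :: κ.2.2) ∧ BlocksMatch K X ∧ GapOK κ.1 g.length ∧ LabelOK κ.2.1 c
  | [], w => by
    simp only [List.nil_append, BlocksMatch]
    constructor
    · rintro ⟨g, c, _, rfl, hg, hb, rfl⟩
      exact ⟨[], g, c, by simp, rfl, hg, hb⟩
    · rintro ⟨_, g, c, rfl, rfl, hg, hb⟩
      exact ⟨g, c, [], by simp, hg, hb, rfl⟩
  | κ' :: K, w => by
    simp only [List.cons_append, BlocksMatch]
    constructor
    · rintro ⟨g, c, w', rfl, hg, hb, h⟩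
      obtain ⟨X, g', c', rfl, hX, h'⟩ := blocksMatch_concat.1 h
      exact ⟨_, g', c', by simp, ⟨g, c, X, rfl, hg, hb, hX⟩, h'⟩
    · rintro ⟨_, g', c', rfl, ⟨g, c, X, rfl, hg, hb, hX⟩, h'⟩
      exact ⟨g, c, _, by simp, hg, hb, blocksMatch_concat.2 ⟨X, g', c', rfl, hX, h'⟩⟩

/-- Blocks with other separators. -/
def regap (z : (Axis × ℕ) × Block α) : Block α := (z.1, z.2.2)

theorem BlocksMatch.regap : ∀ {Z : List ((Axis × ℕ) × Block α)} {w : List α},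
    (∀ z ∈ Z, ∀ n, GapOK z.2.1 n → GapOK z.1 n) → BlocksMatch (Z.map Prod.snd) w →
    BlocksMatch (Z.map TwigLearn.regap) w
  | [], _, _, h => h
  | z :: Z, _, hZ, ⟨g, c, w', hw, hg, hb, h⟩ =>
    ⟨g, c, w', hw, hZ z (by simp) _ hg, hb, h.regap fun z hz => hZ z (by simp [hz])⟩

/-- The word obtained from blocks by filling the separators and replacing wildcards by `d`. -/
def fillWord (fill : Axis × ℕ → List α) (d : α) (K : List (Block α)) : List α :=
  K.flatMap fun κ => fill κ.1 ++ κ.2.1.getD d :: κ.2.2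

/-! ### Letters that cannot occur in separators: placing the runs -/

section forced

variable {ns : α → Bool}

theorem sum_le_countP : ∀ {Z : List ((Axis × ℕ) × Block α)} {X : List α},
    (∀ z ∈ Z, ∃ a, z.2.2.1 = some a ∧ ns a ∧ ∀ c ∈ z.2.2.2, ns c) →
    BlocksMatch (Z.map regap) X → (Z.map fun z => z.2.2.2.length + 1).sum ≤ X.countP ns
  | [], _, _, _ => by simp
  | z :: Z, _, hZ, ⟨g, c, w', hw, hg, hb, h⟩ => by
    have := sum_le_countP (fun z hz => hZ z (by simp [hz])) h
    obtain ⟨a, ha, hna, hu⟩ := hZ z (by simp)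
    have hc : c = a := hb a ha
    have hu' : z.2.2.2.countP ns = z.2.2.2.length := List.countP_eq_length.2 hu
    subst hw hc
    simp only [regap, List.map_cons, List.sum_cons, List.countP_append, List.countP_cons, hna,
      if_true, hu'] at *
    omega

theorem countP_fillWord {fill : Axis × ℕ → List α} (hfill : ∀ γ, ∀ c ∈ fill γ, ns c = false)
    (d : α) : ∀ {Z : List ((Axis × ℕ) × Block α)},
    (∀ z ∈ Z, ∃ a, z.2.2.1 = some a ∧ ns a ∧ ∀ c ∈ z.2.2.2, ns c) →
    (fillWord fill d (Z.map Prod.snd)).countP ns = (Z.map fun z => z.2.2.2.length + 1).sum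
  | [], _ => by simp [fillWord]
  | z :: Z, hZ => by
    have := countP_fillWord hfill d (fun z hz => hZ z (List.mem_cons_of_mem _ hz))
    obtain ⟨a, ha, hna, hu⟩ := hZ z (by simp)
    have hu' : z.2.2.2.countP ns = z.2.2.2.length := List.countP_eq_length.2 hu
    have hf : (fill z.2.1).countP ns = 0 := List.countP_eq_zero.2 fun c hc => by
      simp [hfill _ c hc]
    simp only [fillWord, List.map_cons, List.flatMap_cons, List.countP_append, List.countP_cons,
      ha, Option.getD_some, hna, hu', hf, List.sum_cons, if_true] at *
    omega

/-- All letters of the runs satisfy `ns` and no letter of a filling does. The word has exactly as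
many `ns` letters as the runs need, so no gap of the matching may swallow one. Hence each gap ends
where the filling ends, at the first `ns` letter. -/
theorem gaps_forced {fill : Axis × ℕ → List α} (hfill : ∀ γ, ∀ c ∈ fill γ, ns c = false)
    (d : α) : ∀ {Z : List ((Axis × ℕ) × Block α)} {X g G : List α},
    (∀ z ∈ Z, ∃ a, z.2.2.1 = some a ∧ ns a ∧ ∀ c ∈ z.2.2.2, ns c) →
    BlocksMatch (Z.map regap) X → X ++ g = fillWord fill d (Z.map Prod.snd) ++ G →
    (∀ c ∈ G, ns c = false) → (∀ z ∈ Z, GapOK z.1 (fill z.2.1).length) ∧ g = G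
  | [], X, g, G, _, h, hX, _ => by
    have : X = [] := h
    subst this
    simpa [fillWord] using hX
  | z :: Z, X, g, G, hZ, ⟨g₁, c, X', hw, hg, hb, h⟩, hX, hG => by
    have hZ' := fun z hz => hZ z (List.mem_cons_of_mem _ hz)
    have h₁ := sum_le_countP hZ' h
    have h₂ := countP_fillWord hfill d hZ'
    have h₃ : G.countP ns = 0 := List.countP_eq_zero.2 fun c hc => by simp [hG c hc]
    have hf : (fill z.2.1).countP ns = 0 := List.countP_eq_zero.2 fun c hc => by
      simp [hfill _ c hc]
    obtain ⟨a, ha, hna, hu⟩ := hZ z (by simp)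
    have hc : c = a := hb a ha
    subst hw hc
    have h₄ := congrArg (List.countP ns) hX
    simp only [fillWord, regap, List.map_cons, List.flatMap_cons, List.countP_append,
      List.countP_cons, ha, Option.getD_some, hna, if_true] at h₂ h₄
    -- The remaining blocks already use up every remaining `ns` letter, which leaves none for the
    -- first gap.
    have h₅ : g₁.countP ns = 0 := by omega
    have hX' : g₁ ++ c :: (z.2.2.2 ++ (X' ++ g)) =
        fill z.2.1 ++ c :: (z.2.2.2 ++ (fillWord fill d (Z.map Prod.snd) ++ G)) := by
      simpa [fillWord, regap, ha] using hX
    -- The letter that ends the gap does not lie inside it, so the gap is a prefix of the filling.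
    -- It is all of the filling because the filling contains no `ns` letter either.
    obtain ⟨l, hl, hl'⟩ := eq_append_of_notMem hX'
      fun hm => absurd hna (List.countP_eq_zero.1 h₅ _ hm)
    have hl₀ : l = [] := by
      rcases l with _ | ⟨e, l⟩
      · rfl
      · simp only [List.cons_append, List.cons.injEq] at hl'
        refine absurd hna (List.countP_eq_zero.1 hf _ ?_)
        rw [hl, hl'.1]
        simp
    subst hl₀
    simp only [List.append_nil, List.nil_append, List.cons.injEq, true_and] at hl hl'
    obtain ⟨h₇, h₈⟩ := gaps_forced hfill d hZ' h (List.append_cancel_left hl') hG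
    refine ⟨fun y hy => ?_, h₈⟩
    rcases List.mem_cons.1 hy with rfl | hy
    · rw [hl]
      exact hg
    · exact h₇ y hy

/-- The labels of a block, as a word. -/
def blockRun (κ : Block α) : List α := κ.2.1.toList ++ κ.2.2

theorem Occ.of_blocksMatch : ∀ {K : List (Block α)} {X : List α},
    (∀ κ ∈ K, κ.2.1 ≠ none) → BlocksMatch K X → Occ (K.map blockRun) X
  | [], _, _, _ => trivial
  | κ :: K, _, hK, ⟨g, c, w', hw, hg, hb, h⟩ => by
    obtain ⟨a, ha⟩ := Option.ne_none_iff_exists'.1 (hK κ (by simp))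
    refine ⟨g, w', ?_, Occ.of_blocksMatch (fun κ hκ => hK κ (by simp [hκ])) h⟩
    have : c = a := hb a ha
    simp [hw, blockRun, ha, this]

/-- The nonempty fillings between runs contain no letter of a word of `F`, so `F` splits into one
sublist per run and `Occ.excess_le` is summed. The first filling separates no two runs, which is why
only `I.tail` must have nonempty ones. -/
theorem Occ.excess_blocks {fill : Axis × ℕ → List α} (hfill : ∀ γ, ∀ c ∈ fill γ, ns c = false)
    (d : α) {L : ℕ} (hL : 1 ≤ L) : ∀ {I : List (Block α)} {G : List α} {F : List (List α)},
    (∀ κ ∈ I, κ.2.1 ≠ none) → (∀ κ ∈ I.tail, fill κ.1 ≠ []) → (∀ c ∈ G, ns c = false) →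
    (∀ f ∈ F, L ≤ f.length ∧ ∀ c ∈ f, ns c) → Occ F (fillWord fill d I ++ G) →
    excess L F ≤ excess L (I.map blockRun) ∧
      (excess L F = excess L (I.map blockRun) → F.Sublist (I.map blockRun))
  | [], G, F, _, _, hG, hF, h => by
    have hne : ∀ f ∈ F, f ≠ [] := by
      rintro f hf rfl
      have := (hF _ hf).1
      simp at this
      omega
    have : F = [] := by
      refine Occ.eq_nil hne (Occ.of_append hne (G := G) ?_ (by simpa [fillWord] using h))
      intro c hc f hf hcf
      exact absurd ((hF f hf).2 c hcf) (by simp [hG c hc])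
    simp [this]
  | κ :: I, G, F, hI, hs, hG, hF, h => by
    have hne : ∀ f ∈ F, f ≠ [] := by
      rintro f hf rfl
      have := (hF _ hf).1
      simp at this
      omega
    obtain ⟨a, ha⟩ := Option.ne_none_iff_exists'.1 (hI κ (by simp))
    have hcanon : fillWord fill d (κ :: I) ++ G =
        fill κ.1 ++ (blockRun κ ++ (fillWord fill d I ++ G)) := by
      simp [fillWord, blockRun, ha]
    rw [hcanon] at h
    have hsp : ∀ c, ns c = false → ∀ f ∈ F, c ∉ f := by
      intro c hc f hf hcf
      exact absurd ((hF f hf).2 c hcf) (by simp [hc])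
    replace h := Occ.of_append hne (fun c hc => hsp c (hfill _ c hc)) h
    obtain ⟨F₁, F₂, rfl, h₁, h₂⟩ : ∃ F₁ F₂, F = F₁ ++ F₂ ∧ Occ F₁ (blockRun κ) ∧
        Occ F₂ (fillWord fill d I ++ G) := by
      -- What follows the run is empty or starts with a foreign letter, taken from the next filling
      -- or from `G`. `Occ.split` cuts at that letter.
      rcases hY : fillWord fill d I ++ G with _ | ⟨c, Y⟩
      · rw [hY, List.append_nil] at h
        exact ⟨F, [], by simp, h, trivial⟩
      · rw [hY] at h
        have hc : ns c = false := by
          cases I with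
          | nil =>
            refine hG c ?_
            simp only [fillWord, List.flatMap_nil, List.nil_append] at hY
            simp [hY]
          | cons κ' I =>
            have := hs κ' (by simp)
            rcases hf : fill κ'.1 with _ | ⟨e, l⟩
            · exact absurd hf this
            · simp only [fillWord, List.flatMap_cons, hf, List.cons_append, List.cons.injEq] at hY
              refine hfill κ'.1 c ?_
              simp [hf, hY.1]
        obtain ⟨F₁, F₂, rfl, h₁, h₂⟩ := Occ.split (hsp c hc) h
        exact ⟨F₁, F₂, rfl, h₁, h₂.append_left [c]⟩
    obtain ⟨h₃, h₄⟩ := Occ.excess_le hL (fun f hf => (hF f (by simp [hf])).1) h₁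
    obtain ⟨h₅, h₆⟩ := Occ.excess_blocks hfill d hL (fun κ hκ => hI κ (by simp [hκ]))
      (fun κ hκ => hs κ (by simpa using List.mem_of_mem_tail hκ)) hG
      (fun f hf => hF f (by simp [hf])) h₂
    have hsplit : excess L ((κ :: I).map blockRun) =
        excess L [blockRun κ] + excess L (I.map blockRun) := by
      simp [excess]
    rw [excess_append, hsplit]
    refine ⟨by omega, fun h => ?_⟩
    rw [List.map_cons]
    exact (h₄ (by omega)).append (h₆ (by omega))

end forced

/-- Anchoredness forces the edges around an interior wildcard to be child edges, so wildcards gather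
into separators that begin with a child edge. The selecting node is kept as a block of its own, even
when a child edge joins it to the preceding run, because stages 1 and 2 treat it separately. -/
theorem exists_blocks : ∀ (s : List (Axis × Option α)) (ok : Prop), s ≠ [] → AnchSteps ok s →
    ∃ (I : List (Block α)) (γ : Axis × ℕ) (b : Option α),
      s = (I ++ [(γ, b, [])]).flatMap blockSteps ∧ (∀ κ ∈ I, κ.2.1 ≠ none) ∧
      (∀ κ ∈ I ++ [(γ, b, [])], κ.1.1 = Axis.desc → κ.1.2 = 0) ∧
      (∀ κ ∈ I.tail, κ.1 ≠ (Axis.child, 0))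
  | [], _, h, _ => absurd rfl h
  | [(x, b)], _, _, _ => ⟨[], (x, 0), b, by simp [blockSteps, starSteps], by simp, by simp, by simp⟩
  | (x, none) :: (y, b) :: s, ok, _, h => by
    obtain ⟨I, γ, b', hs, h₁, h₂, h₃⟩ := exists_blocks ((y, b) :: s) _ (by simp) h.2
    -- The wildcard is neither the root nor the last node, so both edges at it are child edges, and
    -- it extends the separator of the next block.
    have hx : x = Axis.child := by
      cases x with
      | child => rfl
      | desc => simpa using (h.1 rfl).2
    have hy : y = Axis.child := by
      cases y with
      | child => rfl
      | desc => exact absurd rfl (h.2.1 rfl).1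
    subst hx hy
    have hfirst : ∀ (x : Axis) (k : ℕ) (c : Option α) (r r' : List (Axis × Option α)),
        (Axis.child, b) :: r = starSteps x k c ++ r' → x = Axis.child := by
      intro x k c r r' h
      cases k <;> simp [starSteps] at h <;> exact h.1.1.symm
    match I, hs, h₁, h₂, h₃ with
    | [], hs, h₁, h₂, h₃ =>
      obtain ⟨x, k⟩ := γ
      have : x = Axis.child := hfirst x k b' s [] (by simpa [blockSteps] using hs)
      subst this
      refine ⟨[], (Axis.child, k + 1), b', ?_, by simp, by simp, by simp⟩
      rw [hs]
      simp [blockSteps, starSteps]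
    | ((x, k), c, u) :: I, hs, h₁, h₂, h₃ =>
      have : x = Axis.child := by
        refine hfirst x k c s
          (u.map (fun b => (Axis.child, some b)) ++ (I ++ [(γ, b', [])]).flatMap blockSteps) ?_
        rw [hs]
        simp [blockSteps]
      subst this
      refine ⟨((Axis.child, k + 1), c, u) :: I, γ, b', ?_, ?_, ?_, h₃⟩
      · rw [hs]
        simp [blockSteps, starSteps]
      · simpa using h₁
      · simpa using h₂
  | (x, some a) :: (y, b) :: s, ok, _, h => by
    obtain ⟨I, γ, b', hs, h₁, h₂, h₃⟩ := exists_blocks ((y, b) :: s) _ (by simp) h.2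
    -- Only an interior block is fused with the new node. When `I` is empty, what follows is the
    -- block of the selecting node and a new run is opened.
    by_cases hI : ∃ κ ∈ I.head?, κ.1 = (Axis.child, 0)
    · obtain ⟨κ, hκ, hκ'⟩ := hI
      match I, hs, h₁, h₂, h₃, hκ with
      | ((x', k), c, u) :: I, hs, h₁, h₂, h₃, hκ =>
        simp only [List.head?_cons, Option.mem_some_iff] at hκ
        subst hκ
        simp only [Prod.mk.injEq] at hκ'
        obtain ⟨rfl, rfl⟩ := hκ'
        obtain ⟨c, rfl⟩ := Option.ne_none_iff_exists'.1 (h₁ ((Axis.child, 0), c, u) (by simp))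
        refine ⟨((x, 0), some a, c :: u) :: I, γ, b', ?_, ?_, ?_, h₃⟩
        · rw [hs]
          simp [blockSteps, starSteps]
        · simpa using h₁
        · simpa using h₂
    · refine ⟨((x, 0), some a, []) :: I, γ, b', ?_, ?_, ?_, ?_⟩
      · rw [hs]
        simp [blockSteps, starSteps]
      · simpa using h₁
      · simpa using h₂
      · intro κ hκ hκ'
        simp only [List.tail_cons] at hκ
        cases I with
        | nil => simp at hκ
        | cons κ₀ I =>
          rcases List.mem_cons.1 hκ with rfl | hκ
          · exact hI ⟨_, by simp, hκ'⟩
          · exact h₃ κ hκ hκ'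

end TwigLearn

namespace TwigLearn

universe u

variable {α : Type u}

/-! ### The third stage -/

/-- The block of the current query: an untreated separator is a descendant edge. -/
def curBlock (z : Bool × Block α) : Block α := if z.1 then ((Axis.desc, 0), z.2.2) else z.2

/-- The marked steps of a block. -/
def markBlock (z : Bool × Block α) : List (Bool × (Axis × Option α)) :=
  if z.1 then (true, (Axis.desc, z.2.2.1)) :: z.2.2.2.map fun b => (false, (Axis.child, some b))
  else (blockSteps z.2).map (Prod.mk false)

theorem map_snd_markBlock (z : Bool × Block α) :
    (markBlock z).map Prod.snd = blockSteps (curBlock z) := by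
  obtain ⟨_ | _, κ⟩ := z <;> simp [markBlock, curBlock, blockSteps, starSteps, Function.comp_def]

theorem map_snd_markBlocks (J : List (Bool × Block α)) :
    (J.flatMap markBlock).map Prod.snd = (J.map curBlock).flatMap blockSteps := by
  rw [List.map_flatMap, List.flatMap_map]
  simp only [map_snd_markBlock]

theorem markBlock_split : ∀ {J : List (Bool × Block α)} {l r : List (Bool × (Axis × Option α))}
    {b : Option α}, J.flatMap markBlock = l ++ (true, (Axis.desc, b)) :: r →
    ∃ J₁ γ u J₂, J = J₁ ++ (true, (γ, b, u)) :: J₂ ∧ l = J₁.flatMap markBlock ∧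
      r = u.map (fun b => (false, (Axis.child, some b))) ++ J₂.flatMap markBlock
  | [], l, r, b, h => by simp at h
  | (true, (γ, c, u)) :: J, l, r, b, h => by
    cases l with
    | nil =>
      simp only [List.flatMap_cons, markBlock, if_true, List.cons_append, List.nil_append,
        List.cons.injEq, Prod.mk.injEq, true_and] at h
      obtain ⟨rfl, rfl⟩ := h
      exact ⟨[], γ, u, J, rfl, rfl, rfl⟩
    | cons x l =>
      simp only [List.flatMap_cons, markBlock, if_true, List.cons_append, List.cons.injEq] at h
      obtain ⟨rfl, h⟩ := h
      obtain ⟨l', rfl, h'⟩ := eq_append_of_notMem h (by simp)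
      obtain ⟨J₁, γ', u', J₂, rfl, rfl, rfl⟩ := markBlock_split h'
      exact ⟨(true, (γ, c, u)) :: J₁, γ', u', J₂, rfl, by simp [markBlock], rfl⟩
  | (false, κ) :: J, l, r, b, h => by
    obtain ⟨l', rfl, h'⟩ := eq_append_of_notMem (c := markBlock (false, κ)) h
      (by simp [markBlock])
    obtain ⟨J₁, γ', u', J₂, rfl, rfl, rfl⟩ := markBlock_split h'
    exact ⟨(false, κ) :: J₁, γ', u', J₂, rfl, by simp, rfl⟩

/-- The invariant of the third stage: treated separators are those of `q`, untreated ones are plain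
descendant edges. Every such query weakens `q` and is consistent by `hmono`, while `hforced` bounds
the strengthening that is tried. Treating an edge merely flips one mark. -/
theorem resolveStep_markBlock {S : Finset (DTree α)} {h : Option α} {B : List (Block α)}
    {fill : Axis × ℕ → List α} {N : ℕ} (hfc : ∀ k, (fill (Axis.child, k)).length = k)
    (hfd : (fill (Axis.desc, 0)).length = N)
    (hB : ∀ κ ∈ B, κ.1.1 = Axis.desc → κ.1.2 = 0)
    (hmono : ∀ Z : List ((Axis × ℕ) × Block α), Z.map Prod.snd = B →
      (∀ z ∈ Z, ∀ n, GapOK z.2.1 n → GapOK z.1 n) →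
      PathQuery.Consistent S ⟨h, (Z.map regap).flatMap blockSteps⟩)
    (hforced : ∀ Z : List ((Axis × ℕ) × Block α), Z.map Prod.snd = B →
      PathQuery.Consistent S ⟨h, (Z.map regap).flatMap blockSteps⟩ →
      ∀ z ∈ Z, GapOK z.1 (fill z.2.1).length ∧ z.1.2 < N)
    {J : List (Bool × Block α)} (hJ : J.map Prod.snd = B) {m : List (Bool × (Axis × Option α))}
    (hm : ResolveStep S h (J.flatMap markBlock) m) :
    ∃ J' : List (Bool × Block α), J'.map Prod.snd = B ∧ m = J'.flatMap markBlock := by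
  obtain ⟨l, b, r, k, hJm, hk, hm⟩ := hm
  obtain ⟨J₁, γ, u, J₂, rfl, rfl, rfl⟩ := markBlock_split hJm
  -- The second components are the blocks of `q`, the first ones the separators of the query under
  -- test: `γ'` at the treated edge and the current ones elsewhere.
  let Z : Axis × ℕ → List ((Axis × ℕ) × Block α) := fun γ' =>
    J₁.map (fun z => ((curBlock z).1, z.2)) ++ (γ', (γ, b, u)) ::
      J₂.map (fun z => ((curBlock z).1, z.2))
  have hregap : ∀ J : List (Bool × Block α),
      (J.map (fun z => ((curBlock z).1, z.2))).map regap = J.map curBlock := by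
    intro J
    rw [List.map_map]
    refine List.map_congr_left fun z _ => ?_
    obtain ⟨_ | _, κ⟩ := z <;> rfl
  have hsnd : ∀ J : List (Bool × Block α),
      (J.map (fun z => ((curBlock z).1, z.2))).map Prod.snd = J.map Prod.snd := by
    intro J
    rw [List.map_map]
    rfl
  have hZsnd : ∀ γ', (Z γ').map Prod.snd = B := by
    intro γ'
    rw [← hJ]
    simp only [Z, List.map_append, List.map_cons, hsnd]
  have hZ : ∀ x j, (J₁.flatMap markBlock).map Prod.snd ++ starSteps x j b ++
      (u.map (fun b => (false, (Axis.child, some b))) ++ J₂.flatMap markBlock).map Prod.snd =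
      ((Z (x, j)).map regap).flatMap blockSteps := by
    intro x j
    simp only [Z, List.map_append, List.map_cons, hregap, map_snd_markBlocks, List.flatMap_append,
      List.flatMap_cons]
    simp [regap, blockSteps, Function.comp_def]
  have hmonoZ : ∀ γ', (∀ n, GapOK γ n → GapOK γ' n) →
      PathQuery.Consistent S ⟨h, ((Z γ').map regap).flatMap blockSteps⟩ := by
    intro γ' hγ'
    have hcur : ∀ z : Bool × Block α, ∀ n, GapOK z.2.1 n → GapOK (curBlock z).1 n := by
      rintro ⟨_ | _, κ⟩ n hn
      · exact hn
      · exact Nat.zero_le n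
    refine hmono (Z γ') (hZsnd γ') ?_
    intro z hz
    simp only [Z, List.mem_append, List.mem_map, List.mem_cons] at hz
    rcases hz with ⟨z, -, rfl⟩ | rfl | ⟨z, -, rfl⟩
    · exact hcur z
    · exact hγ'
    · exact hcur z
  have hforcedZ : ∀ γ', PathQuery.Consistent S ⟨h, ((Z γ').map regap).flatMap blockSteps⟩ →
      GapOK γ' (fill γ).length ∧ γ'.2 < N := fun γ' hc =>
    hforced (Z γ') (hZsnd γ') hc (γ', (γ, b, u)) (by simp [Z])
  simp only [hZ] at hk hm
  have hγ : γ.1 = Axis.desc → γ.2 = 0 := by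
    refine hB (γ, b, u) ?_
    rw [← hJ]
    simp
  refine ⟨J₁ ++ (false, (γ, b, u)) :: J₂, by rw [← hJ]; simp, ?_⟩
  obtain ⟨_ | _, k'⟩ := γ
  -- For `k'` wildcards the forced gap is `k'`, so `k ≤ k'`; consistency with `k'` holds because
  -- that query is still weaker than `q`. The child version with `k'` wildcards is consistent for
  -- the same reason.
  · have hkk : k = k' := by
      refine le_antisymm ?_ (hk.2 (hmonoZ _ ?_))
      · have := (hforcedZ _ hk.1).1
        rw [hfc] at this
        exact this
      · intro n hn
        exact le_of_eq hn.symm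
    subst hkk
    rcases hm with ⟨-, rfl⟩ | ⟨hm, -⟩
    · simp [markBlock, blockSteps]
    · exact absurd (hmonoZ _ fun n hn => hn) hm
  · have hk' : k' = 0 := hγ rfl
    subst hk'
    rcases hm with ⟨hm, -⟩ | ⟨-, rfl⟩
    -- The child version would have to bridge exactly `N` letters, that is `k = N`, but consistency
    -- of the version with `//` already gives `k < N`. So the descendant edge stays.
    · have h₁ := (hforcedZ _ hm).1
      have h₂ := (hforcedZ _ hk.1).2
      rw [hfd] at h₁
      simp only [GapOK] at h₁ h₂
      omega
    · simp [markBlock, blockSteps, starSteps]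

/-! ### The match words -/

theorem matchWord₀_blocks (a₀ : α) (K : List (Block α)) :
    (K.flatMap blockSteps).map (fun s => s.2.getD a₀) =
      fillWord (fun γ => List.replicate γ.2 a₀) a₀ K := by
  have hstar : ∀ (k : ℕ) (x : Axis) (b : Option α), (starSteps x k b).map (fun s => s.2.getD a₀) =
      List.replicate k a₀ ++ [b.getD a₀] := by
    intro k
    induction k with
    | zero => intro x b; rfl
    | succ k ih =>
      intro x b
      simp [starSteps, ih, List.replicate_succ]
  rw [fillWord, List.map_flatMap]
  refine List.flatMap_congr fun κ _ => ?_
  simp [blockSteps, hstar, Function.comp_def]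

/-- The letters put in place of a separator by `matchWord₁`. -/
def gapFill (N : ℕ) (a₁ a₂ : α) : Axis × ℕ → List α
  | (Axis.child, k) => List.replicate k a₁
  | (Axis.desc, _) => List.replicate N a₂

theorem matchWord₁_blocks (N : ℕ) (a₁ a₂ : α) (K : List (Block α))
    (hK : ∀ κ ∈ K, κ.1.1 = Axis.desc → κ.1.2 = 0) :
    ((K.flatMap blockSteps).flatMap fun s => edgeFill N a₂ s.1 ++ [s.2.getD a₁]) =
      fillWord (gapFill N a₁ a₂) a₁ K := by
  have hstar : ∀ (k : ℕ) (b : Option α),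
      ((starSteps Axis.child k b).flatMap fun s => edgeFill N a₂ s.1 ++ [s.2.getD a₁]) =
      List.replicate k a₁ ++ [b.getD a₁] := by
    intro k
    induction k with
    | zero => intro b; simp [starSteps, edgeFill]
    | succ k ih =>
      intro b
      simp only [starSteps, List.flatMap_cons, ih]
      simp [edgeFill, List.replicate_succ]
  rw [fillWord, List.flatMap_assoc]
  refine List.flatMap_congr fun κ hκ => ?_
  have hu : ((κ.2.2.map fun b => (Axis.child, some b)).flatMap
      fun s => edgeFill N a₂ s.1 ++ [s.2.getD a₁]) = κ.2.2 := by
    rw [List.flatMap_map]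
    simp [edgeFill]
  obtain ⟨⟨_ | _, k⟩, b, u⟩ := κ
  · simp only [blockSteps, List.flatMap_append, hstar] at hu ⊢
    rw [hu]
    simp [gapFill]
  · have : k = 0 := hK _ hκ rfl
    subst this
    simp only [blockSteps, List.flatMap_append] at hu ⊢
    rw [hu]
    simp [starSteps, gapFill, edgeFill]

theorem labelOK_getD (b : Option α) (d : α) : LabelOK b (b.getD d) := by
  cases b <;> simp

theorem stepsMatch_fill (f : Axis → List α) (hf : f Axis.child = []) (d : α) :
    ∀ s : List (Axis × Option α), StepsMatch s (s.flatMap fun s => f s.1 ++ [s.2.getD d])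
  | [] => rfl
  | (x, b) :: s => ⟨f x, b.getD d, _, by simp, fun hx => hx ▸ hf, labelOK_getD b d,
      stepsMatch_fill f hf d s⟩

theorem queryMatch_matchWord₀ (a₀ : α) (q : PathQuery α) : QueryMatch q (matchWord₀ a₀ q) := by
  refine ⟨_, _, rfl, labelOK_getD _ _, ?_⟩
  have := stepsMatch_fill (fun _ => []) rfl a₀ q.steps
  simpa [List.map_eq_flatMap] using this

theorem queryMatch_matchWord₁ (a₁ a₂ : α) (q : PathQuery α) : QueryMatch q (matchWord₁ a₁ a₂ q) :=
  ⟨_, _, rfl, labelOK_getD _ _, stepsMatch_fill (edgeFill q.size a₂) rfl a₁ q.steps⟩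

theorem matchSet_subset_lang [LinearOrder α] [OrderBot α] (a₁ a₂ : α) (q : AnchPath α) :
    (matchSet a₁ a₂ q : Set (DTree α)) ⊆ q.1.lang := by
  intro t ht
  rw [mem_lang_iff]
  simp only [matchSet, Finset.coe_insert, Finset.coe_singleton, Set.mem_insert_iff,
    Set.mem_singleton_iff] at ht
  rcases ht with rfl | rfl
  · rw [selWord_chainTree]
    exact queryMatch_matchWord₀ _ _
  · rw [selWord_chainTree]
    exact queryMatch_matchWord₁ _ _ _

theorem uses_of_mem {q : PathQuery α} {s : Axis × Option α} (hs : s ∈ q.steps) {a : α}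
    (ha : s.2 = some a) : q.Uses a := by
  obtain ⟨i, rfl⟩ := List.mem_iff_get.1 hs
  exact ⟨i.succ, by simpa [PathQuery.label] using ha⟩

theorem mem_matchWord₀ {a₀ c : α} {q : PathQuery α} (hc : c ∈ matchWord₀ a₀ q) :
    c = a₀ ∨ q.Uses c := by
  simp only [matchWord₀, List.mem_cons, List.mem_map] at hc
  rcases hc with rfl | ⟨s, hs, rfl⟩
  · rcases hh : q.head with _ | a
    · simp
    · exact Or.inr ⟨0, by simp [PathQuery.label, hh]⟩
  · rcases hh : s.2 with _ | a
    · simp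
    · exact Or.inr (uses_of_mem hs (by simpa using hh))

theorem StepsMatch.length_le : ∀ {s : List (Axis × Option α)} {w : List α}, StepsMatch s w →
    s.length ≤ w.length
  | [], _, _ => by simp
  | (x, b) :: s, _, ⟨g, c, w', hw, _, _, h⟩ => by
    have := h.length_le
    simp [hw]
    omega

/-- With equal lengths no letter is skipped, so step and letter correspond; a label equals its
letter and a wildcard contributes `⊥`. -/
theorem StepsMatch.forall₂_le [LinearOrder α] [OrderBot α] :
    ∀ {s : List (Axis × Option α)} {w : List α}, StepsMatch s w → w.length = s.length →
    List.Forall₂ (· ≤ ·) (s.map fun s => s.2.getD ⊥) w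
  | [], w, h, _ => by
    have : w = [] := h
    subst this
    exact .nil
  | (x, b) :: s, _, ⟨g, c, w', hw, _, hb, h⟩, hlen => by
    have := h.length_le
    have hg : g = [] := by
      refine List.eq_nil_of_length_eq_zero ?_
      simp [hw] at hlen
      omega
    subst hg hw
    refine .cons ?_ (h.forall₂_le (by simpa using hlen))
    cases b with
    | none => exact bot_le
    | some a => exact (hb a rfl).ge

theorem not_lex_of_forall₂_le [LinearOrder α] {v w : List α} (h : List.Forall₂ (· ≤ ·) v w) :
    ¬ List.Lex (· < ·) w v := by
  induction h with
  | nil => intro h; cases h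
  | cons h _ ih =>
    intro h'
    cases h' with
    | cons h' => exact ih h'
    | rel h' => exact absurd h' h.not_gt

/-- A word matched by `q` is at least as long as `q`, and at equal length it dominates `matchWord₀ ⊥
q` letterwise, so it cannot be strictly smaller. -/
theorem eq_matchWord₀_of_canLE [LinearOrder α] [OrderBot α] {q : PathQuery α} {w : List α}
    (h : QueryMatch q w) (hle : CanLE w (matchWord₀ ⊥ q)) : w = matchWord₀ ⊥ q := by
  obtain ⟨c, w', rfl, hb, hs⟩ := h
  have hlen := hs.length_le
  rcases hle with h | h
  · exact h
  · rw [List.shortlex_def] at h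
    simp only [matchWord₀, List.length_cons, List.length_map] at h
    rcases h with h | ⟨h₁, h₂⟩
    · omega
    · refine absurd h₂ (not_lex_of_forall₂_le (.cons ?_ (hs.forall₂_le (by omega))))
      rcases hq : q.head with _ | a
      · exact bot_le
      · exact (hb a hq).ge

end TwigLearn

namespace TwigLearn

universe u

variable {α : Type u}

/-! ### Characteristic samples -/

-- At an end where `q` has a label, specialization gives back that label and stays consistent. Where
-- `q` has a wildcard, the least word proposes `⊥`, which the word `hw₁` refutes by showing `a₁ ≠
-- ⊥`.
open Classical in
theorem stage2_factorQuery [LinearOrder α] [OrderBot α] {S : Finset (DTree α)} {h b : Option α}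
    {V : List (List α)} (hV : ∀ v ∈ V, v ≠ []) {a₁ : α} (ha₁ : a₁ ≠ ⊥)
    (hS : ∀ w ∈ selPaths S, ∃ c X d, w = c :: (X ++ [d]) ∧ LabelOK h c ∧ LabelOK b d ∧ Occ V X)
    {X₁ : List α} (hw₁ : h.getD a₁ :: (X₁ ++ [b.getD a₁]) ∈ selPaths S) :
    stage2 S (h.getD ⊥) (b.getD ⊥) (factorQuery none V none) = factorQuery h V b := by
  have hhead : ∀ a, setHead (factorQuery none V none) a = factorQuery (some a) V none :=
    fun _ => rfl
  have hlast : ∀ h a, setLast (factorQuery h V none) a = factorQuery h V (some a) := by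
    intro h a
    simp only [setLast, factorQuery, modifyLast_steps]
  have hcons : ∀ h' b', (factorQuery h' V b').Consistent S ↔
      ∀ w ∈ selPaths S, ∃ c X d, w = c :: (X ++ [d]) ∧ LabelOK h' c ∧ LabelOK b' d ∧ Occ V X := by
    intro h' b'
    simp only [consistent_iff, queryMatch_factorQuery hV]
  have hfirst : (if (factorQuery (some (h.getD ⊥)) V none).Consistent S
      then factorQuery (some (h.getD ⊥)) V none else factorQuery none V none) =
      factorQuery h V none := by
    cases h with
    | none =>
      rw [if_neg]
      intro hc
      obtain ⟨c, X, d, hw, hh, -⟩ := (hcons _ _).1 hc _ hw₁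
      simp only [List.cons.injEq, Option.getD_none, labelOK_some] at hw hh
      exact ha₁ (hw.1.trans hh)
    | some a =>
      rw [if_pos]
      · rfl
      · refine (hcons _ _).2 fun w hw => ?_
        obtain ⟨c, X, d, hw, hh, -, ho⟩ := hS w hw
        exact ⟨c, X, d, hw, hh, labelOK_none _, ho⟩
  simp only [stage2, hhead, hfirst, hlast]
  cases b with
  | none =>
    rw [if_neg]
    intro hc
    obtain ⟨c, X, d, hw, -, hb, -⟩ := (hcons _ _).1 hc _ hw₁
    simp only [List.cons.injEq, Option.getD_none, labelOK_some] at hw hb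
    have := congrArg List.getLast? hw.2
    simp only [List.getLast?_append, List.getLast?_singleton, Option.some_or,
      Option.some.injEq] at this
    exact ha₁ (this.trans hb)
  | some a =>
    rw [if_pos]
    · rfl
    · exact (hcons _ _).2 hS

theorem LearnerAnchPath.eq_of_matchWords [LinearOrder α] [OrderBot α] {S : Finset (DTree α)}
    {q p : PathQuery α} (hq : q.IsAnchored) {a₁ a₂ : α} (hu₁ : ¬ q.Uses a₁) (hu₂ : ¬ q.Uses a₂)
    (hb₁ : a₁ ≠ ⊥) (hb₂ : a₂ ≠ ⊥) (hS : q.Consistent S) (hw₀ : matchWord₀ ⊥ q ∈ selPaths S)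
    (hw₁ : matchWord₁ a₁ a₂ q ∈ selPaths S) (hp : LearnerAnchPath S p) : p = q := by
  classical
  rw [consistent_iff] at hS
  obtain ⟨a₀, aₙ, inner, us, p₁, hmem, hmin, hus, hpw, hst₁, m, hm, hmf, rfl⟩ := hp
  have hw := eq_matchWord₀_of_canLE (hS _ hmem) (hmin _ hw₀)
  rw [isAnchored_iff] at hq
  obtain ⟨h, s⟩ := q
  obtain ⟨I, γ, b, rfl, hI, hgap, hsep⟩ := exists_blocks s True hq.1 hq.2
  set N := PathQuery.size ⟨h, (I ++ [(γ, b, [])]).flatMap blockSteps⟩ with hN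
  set fill₀ : Axis × ℕ → List α := fun γ => List.replicate γ.2 ⊥ with hfill₀
  set fill₁ := gapFill N a₁ a₂ with hfill₁
  -- This predicate holds for all letters of the least word, hence for the runs and all factors
  -- considered, and fails on all separators of the second word.
  let ns : α → Bool := fun c => decide (c ≠ a₁ ∧ c ≠ a₂)
  have hns₁ : ∀ γ, ∀ c ∈ fill₁ γ, ns c = false := by
    rintro ⟨_ | _, k⟩ c hc
    · have := List.eq_of_mem_replicate hc
      simp [ns, this]
    · have := List.eq_of_mem_replicate hc
      simp [ns, this]
  have hword₀ : matchWord₀ ⊥ ⟨h, (I ++ [(γ, b, [])]).flatMap blockSteps⟩ =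
      h.getD ⊥ :: ((fillWord fill₀ ⊥ I ++ fill₀ γ) ++ [b.getD ⊥]) := by
    rw [matchWord₀, matchWord₀_blocks]
    simp [fillWord, fill₀]
  have hword₁ : matchWord₁ a₁ a₂ ⟨h, (I ++ [(γ, b, [])]).flatMap blockSteps⟩ =
      h.getD a₁ :: ((fillWord fill₁ a₁ I ++ fill₁ γ) ++ [b.getD a₁]) := by
    rw [matchWord₁, matchWord₁_blocks _ _ _ _ hgap]
    simp [fillWord, fill₁, hN]
  have hnsw : ∀ c ∈ matchWord₀ ⊥ ⟨h, (I ++ [(γ, b, [])]).flatMap blockSteps⟩, ns c := by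
    intro c hc
    rcases mem_matchWord₀ hc with rfl | hc
    · simp [ns, hb₁.symm, hb₂.symm]
    · have h₁ : c ≠ a₁ := fun h => hu₁ (h ▸ hc)
      have h₂ : c ≠ a₂ := fun h => hu₂ (h ▸ hc)
      simp [ns, h₁, h₂]
  rw [hword₀] at hw hw₀ hnsw
  rw [hword₁] at hw₁
  obtain ⟨rfl, hw'⟩ := List.cons.inj hw
  obtain ⟨rfl, hw''⟩ := List.append_inj' hw' rfl
  obtain rfl : aₙ = b.getD ⊥ := by simpa using hw''
  have hnsi : ∀ c ∈ fillWord fill₀ ⊥ I ++ fill₀ γ, ns c := by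
    intro c hc
    refine hnsw c ?_
    simp only [List.mem_cons, List.mem_append] at hc ⊢
    tauto
  have hrun : ∀ v ∈ I.map blockRun, v ≠ [] ∧ v <:+: fillWord fill₀ ⊥ I ++ fill₀ γ := by
    intro v hv
    obtain ⟨κ, hκ, rfl⟩ := List.mem_map.1 hv
    obtain ⟨a, ha⟩ := Option.ne_none_iff_exists'.1 (hI κ hκ)
    refine ⟨by simp [blockRun, ha], ?_⟩
    obtain ⟨I₁, I₂, rfl⟩ := List.append_of_mem hκ
    exact ⟨fillWord fill₀ ⊥ I₁ ++ fill₀ κ.1, fillWord fill₀ ⊥ I₂ ++ fill₀ γ, by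
      simp [fillWord, blockRun, ha]⟩
  -- Any word of the sample matches `q`, so it contains the runs disjointly and in order between its
  -- first and last letters.
  have hshape : ∀ w ∈ selPaths S, ∃ c X d, w = c :: (X ++ [d]) ∧ LabelOK h c ∧ LabelOK b d ∧
      Occ (I.map blockRun) X := by
    intro w hw
    obtain ⟨c, w', rfl, hc, hm⟩ := hS w hw
    rw [stepsMatch_blocks, blocksMatch_concat] at hm
    obtain ⟨X, g, d, rfl, hX, -, hd⟩ := hm
    exact ⟨c, X ++ g, d, by simp, hc, hd, (Occ.of_blocksMatch hI hX).append_right g⟩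
  have hp₁ : p₁ = factorQuery none (I.map blockRun) none := by
    refine stage1_eq_factorQuery (inner := fillWord fill₀ ⊥ I ++ fill₀ γ) ?_ ?_
      (fun v hv => (hrun v hv).2) us [] p₁ (List.nil_sublist _)
      (fun v hv => Or.inl ((hus v).2 (hrun v hv))) hpw (fun u hu => (hus u).1 hu) (by simp) hst₁
    · intro F hF
      rw [consistent_iff]
      intro w hw
      obtain ⟨c, X, d, rfl, -, -, ho⟩ := hshape w hw
      exact (queryMatch_factorQuery fun f hf => (hrun f (hF.subset hf)).1).2
        ⟨c, X, d, rfl, labelOK_none _, labelOK_none _, ho.sublist hF⟩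
    · intro F L hL hF hc
      rw [consistent_iff] at hc
      obtain ⟨c, X, d, hX, -, -, ho⟩ := (queryMatch_factorQuery (by
        rintro f hf rfl
        have := (hF _ hf).1
        simp at this
        omega)).1 (hc _ hw₁)
      obtain ⟨rfl, -⟩ := List.append_inj' (List.cons.inj hX).2 rfl
      refine Occ.excess_blocks hns₁ a₁ hL hI ?_ (hns₁ γ) ?_ ho
      -- Two runs are never joined by a bare child edge, since they would form one run. So the
      -- filling is a positive number of letters `a₁`, or `N ≥ 1` letters `a₂`.
      · intro κ hκ
        have h₁ := hsep κ hκ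
        obtain ⟨⟨_ | _, k⟩, b', u'⟩ := κ
        · cases k with
          | zero => exact absurd rfl h₁
          | succ k => simp [fill₁, gapFill, List.replicate_succ]
        · simp [fill₁, gapFill, hN, PathQuery.size, List.replicate_succ]
      · intro f hf
        exact ⟨(hF f hf).1, fun c hc => hnsi c ((hF f hf).2.subset hc)⟩
  subst hp₁
  rw [stage2_factorQuery (fun v hv => (hrun v hv).1) hb₁ hshape hw₁] at hm ⊢
  set B := I ++ [(γ, b, [])] with hBdef
  have hstart : (factorQuery h (I.map blockRun) b).steps.map markStep =
      (B.map (Prod.mk true)).flatMap markBlock := by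
    rw [factorQuery, List.flatMap_map, List.map_append, hBdef, List.map_append, List.flatMap_append,
      List.map_flatMap, List.flatMap_map]
    congr 1
    refine List.flatMap_congr fun κ hκ => ?_
    obtain ⟨a, ha⟩ := Option.ne_none_iff_exists'.1 (hI κ hκ)
    simp [blockRun, ha, factorSteps, markBlock, markStep]
  have hforced : ∀ Z : List ((Axis × ℕ) × Block α), Z.map Prod.snd = B →
      PathQuery.Consistent S ⟨h, (Z.map regap).flatMap blockSteps⟩ →
      ∀ z ∈ Z, GapOK z.1 (fill₁ z.2.1).length ∧ z.1.2 < N := by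
    intro Z hZ hc
    rw [consistent_iff] at hc
    -- A separator with `j` wildcards contributes `j + 1` steps, and a query consistent with the
    -- least word has at most `N - 1` steps.
    have hlen : ∀ z ∈ Z, z.1.2 < N := by
      obtain ⟨c, w', hw', -, hm⟩ := hc _ hw₀
      have h₁ := hm.length_le
      have h₂ : N = w'.length + 1 := by
        have := congrArg List.length hw'
        rw [← hword₀] at this
        simpa [matchWord₀, hN, PathQuery.size] using this
      have hstar : ∀ (k : ℕ) (x : Axis) (b : Option α), (starSteps x k b).length = k + 1 := by
        intro k
        induction k with
        | zero => intro x b; rfl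
        | succ k ih => intro x b; simp [starSteps, ih]
      intro z hz
      obtain ⟨Z₁, Z₂, rfl⟩ := List.append_of_mem hz
      simp only [List.map_append, List.map_cons, List.flatMap_append, List.flatMap_cons, blockSteps,
        regap, List.length_append, hstar] at h₁
      omega
    refine fun z hz => ⟨?_, hlen z hz⟩
    obtain ⟨Z', z', rfl, hZ', hz'⟩ : ∃ Z' z', Z = Z' ++ [z'] ∧ Z'.map Prod.snd = I ∧
        z'.2 = (γ, b, []) := by
      rw [hBdef, List.map_eq_append_iff] at hZ
      obtain ⟨Z', Z'', rfl, h₁, h₂⟩ := hZ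
      obtain ⟨z', rfl, h₂'⟩ := List.map_eq_singleton_iff.1 h₂
      exact ⟨Z', z', rfl, h₁, h₂'⟩
    obtain ⟨c, w', hw', -, hm⟩ := hc _ hw₁
    rw [stepsMatch_blocks, List.map_append, List.map_singleton, blocksMatch_concat] at hm
    obtain ⟨X, g, d, rfl, hX, hg, -⟩ := hm
    have hXg : X ++ g = fillWord fill₁ a₁ (Z'.map Prod.snd) ++ fill₁ γ := by
      have := (List.cons.inj hw').2
      rw [regap, hz', ← List.append_assoc] at this
      rw [hZ']
      exact (List.append_inj' this rfl).1.symm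
    -- The blocks in front of the selecting node are placed by counting. What is left over, `g`,
    -- must then be the filling of the last separator.
    obtain ⟨h₁, h₂⟩ := gaps_forced (ns := ns) hns₁ a₁ (by
      intro z hz
      have hzI : z.2 ∈ I := hZ' ▸ List.mem_map_of_mem hz
      obtain ⟨a, ha⟩ := Option.ne_none_iff_exists'.1 (hI _ hzI)
      have hr := (hrun _ (List.mem_map_of_mem hzI)).2
      simp only [blockRun, ha, Option.toList_some, List.singleton_append] at hr
      exact ⟨a, ha, hnsi a (hr.subset (by simp)), fun c hc => hnsi c (hr.subset (by simp [hc]))⟩)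
      hX hXg (hns₁ γ)
    rcases List.mem_append.1 hz with hz | hz
    · exact h₁ z hz
    · rw [List.mem_singleton.1 hz, hz', ← h₂]
      exact hg
  have hmono : ∀ Z : List ((Axis × ℕ) × Block α), Z.map Prod.snd = B →
      (∀ z ∈ Z, ∀ n, GapOK z.2.1 n → GapOK z.1 n) →
      PathQuery.Consistent S ⟨h, (Z.map regap).flatMap blockSteps⟩ := by
    intro Z hZ hgapZ
    rw [consistent_iff]
    intro w hw
    obtain ⟨c, w', rfl, hc, hm⟩ := hS w hw
    refine ⟨c, w', rfl, hc, ?_⟩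
    rw [stepsMatch_blocks] at hm ⊢
    exact BlocksMatch.regap hgapZ (by rw [hZ]; exact hm)
  obtain ⟨J, hJ, rfl⟩ : ∃ J : List (Bool × Block α), J.map Prod.snd = B ∧
      m = J.flatMap markBlock := by
    rw [hstart] at hm
    clear hmf
    induction hm with
    | refl => exact ⟨_, by simp [Function.comp_def], rfl⟩
    | tail _ hs ih =>
      obtain ⟨J, hJ, rfl⟩ := ih
      exact resolveStep_markBlock (fill := fill₁) (N := N) (fun k => by simp [fill₁, gapFill])
        (by simp [fill₁, gapFill]) hgap hmono hforced hJ hs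
  rw [map_snd_markBlocks]
  -- No mark `true` is left, so every separator is the one of `q`.
  have hcur : J.map curBlock = B := by
    rw [← hJ]
    refine List.map_congr_left fun z hz => ?_
    obtain ⟨_ | _, κ⟩ := z
    · rfl
    · have := hmf (true, (Axis.desc, κ.2.1)) (List.mem_flatMap.2 ⟨_, hz, by simp [markBlock]⟩)
      simp at this
  rw [hcur]
  rfl

theorem eq_of_matchSet_subset [LinearOrder α] [OrderBot α] {q : AnchPath α} {a₁ a₂ : α}
    (hu₁ : ¬ q.1.Uses a₁) (hu₂ : ¬ q.1.Uses a₂) (hb₁ : a₁ ≠ ⊥) (hb₂ : a₂ ≠ ⊥)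
    {S : Finset (DTree α)} {p : PathQuery α} (hsub : matchSet a₁ a₂ q ⊆ S)
    (hS : (S : Set (DTree α)) ⊆ q.1.lang) (hp : LearnerAnchPath S p) : p = q.1 := by
  refine hp.eq_of_matchWords q.2 hu₁ hu₂ hb₁ hb₂ hS ?_ ?_
  · exact mem_selPaths.2 ⟨chainTree _ (two_le_matchWord₀ ⊥ q.1 q.2),
      hsub (by simp [matchSet]), (selWord_chainTree _ _).symm⟩
  · exact mem_selPaths.2 ⟨chainTree _ (two_le_matchWord₁ a₁ a₂ q.1 q.2),
      hsub (by simp [matchSet]), (selWord_chainTree _ _).symm⟩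

/-! ### Size of the match set -/

theorem length_matchWord₁_le (a₁ a₂ : α) (q : PathQuery α) :
    (matchWord₁ a₁ a₂ q).length ≤ 1 + q.size * (q.size + 1) := by
  have key : ∀ (N : ℕ) (s : List (Axis × Option α)),
      (s.flatMap fun s => edgeFill N a₂ s.1 ++ [s.2.getD a₁]).length ≤ s.length * (N + 1) := by
    intro N s
    induction s with
    | nil => simp
    | cons x s ih =>
      obtain ⟨_ | _, b⟩ := x <;>
        simp only [List.flatMap_cons, edgeFill, List.length_append, List.length_replicate,
          List.length_cons, List.length_nil, add_mul] at * <;> omega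
  have := key q.size q.steps
  have h₂ : q.steps.length * (q.size + 1) ≤ q.size * (q.size + 1) :=
    Nat.mul_le_mul_right _ (by simp [PathQuery.size])
  simp only [matchWord₁, List.length_cons]
  omega

theorem sampleSize_matchSet_le [LinearOrder α] [OrderBot α] (a₁ a₂ : α) (q : AnchPath α) :
    (anchPathSetting α).sampleSize (matchSet a₁ a₂ q) ≤
      q.1.size + (1 + q.1.size * (q.1.size + 1)) := by
  classical
  have h₀ : (matchWord₀ ⊥ q.1).length = q.1.size := by simp [matchWord₀, PathQuery.size]
  have h₁ := length_matchWord₁_le a₁ a₂ q.1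
  change ∑ t ∈ matchSet a₁ a₂ q, DTree.size t ≤ _
  rw [matchSet]
  by_cases heq : chainTree (matchWord₀ ⊥ q.1) (two_le_matchWord₀ ⊥ q.1 q.2) =
      chainTree (matchWord₁ a₁ a₂ q.1) (two_le_matchWord₁ a₁ a₂ q.1 q.2)
  · rw [heq, Finset.pair_eq_singleton, Finset.sum_singleton]
    exact h₁.trans (Nat.le_add_left _ _)
  · rw [Finset.sum_pair heq]
    exact add_le_add h₀.le h₁

end TwigLearn

namespace TwigLearn

universe u v

/-! ### Polynomial-time functions between encoded types -/

/-- Types whose elements are represented as data with labels in `α`. -/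
class Enc (α : Type u) (β : Type v) where
  enc : β → Data α

namespace Data

variable {α : Type u}

/-- The number of nodes of a datum. -/
def size : Data α → ℕ
  | nil => 1
  | atom _ => 1
  | cons x y => x.size + y.size + 1

theorem one_le_size (x : Data α) : 1 ≤ x.size := by
  cases x <;> simp [size]

end Data

section instances

variable (α : Type u)

instance Enc.self : Enc α α := ⟨Data.atom⟩
instance Enc.label : Enc α (Option α) := ⟨encodeLabel⟩
instance Enc.bool : Enc α Bool := ⟨fun b => if b then .yes else .nil⟩
instance Enc.unit : Enc α Unit := ⟨fun _ => .nil⟩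
instance Enc.nat : Enc α ℕ := ⟨Data.num⟩
instance Enc.axis : Enc α Axis := ⟨encodeAxis⟩
instance Enc.prod {β γ : Type*} [Enc α β] [Enc α γ] : Enc α (β × γ) :=
  ⟨fun x => .cons (Enc.enc x.1) (Enc.enc x.2)⟩
instance Enc.list {β : Type*} [Enc α β] : Enc α (List β) := ⟨fun l => .list (l.map Enc.enc)⟩

end instances

section

variable (α : Type u) {β : Type*} [Enc α β]

/-- The size of the representation of an element. -/
def esz (x : β) : ℕ := (Enc.enc x : Data α).size

theorem one_le_esz (x : β) : 1 ≤ esz α x := Data.one_le_size _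

theorem esz_prod {γ : Type*} [Enc α γ] (x : β × γ) : esz α x = esz α x.1 + esz α x.2 + 1 := rfl

theorem esz_nil : esz α ([] : List β) = 1 := rfl

theorem esz_cons (a : β) (l : List β) : esz α (a :: l) = esz α a + esz α l + 1 := rfl

theorem esz_atom (a : α) : esz α a = 1 := rfl

theorem esz_label (a : Option α) : esz α a = 1 := by cases a <;> rfl

theorem esz_bool_le (b : Bool) : esz α b ≤ 3 := by cases b <;> simp [esz, Enc.enc, Data.size, Data.yes]

theorem esz_axis_le (b : Axis) : esz α b ≤ 3 := by
  cases b <;> simp [esz, Enc.enc, Data.size, Data.yes, encodeAxis]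

theorem esz_nat (n : ℕ) : esz α n = 2 * n + 1 := by
  induction n with
  | zero => rfl
  | succ n ih =>
    have : esz α (n + 1) = 1 + esz α n + 1 := rfl
    omega

theorem esz_append (l l' : List β) : esz α (l ++ l') + 1 = esz α l + esz α l' := by
  induction l with
  | nil => simp [esz_nil, add_comm]
  | cons a l ih =>
    simp only [List.cons_append, esz_cons]
    omega

theorem esz_le_of_mem {a : β} {l : List β} (h : a ∈ l) : esz α a ≤ esz α l := by
  induction l with
  | nil => simp at h
  | cons b l ih =>
    rw [esz_cons]
    rcases List.mem_cons.1 h with rfl | h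
    · omega
    · have := ih h
      omega

theorem length_lt_esz (l : List β) : l.length < esz α l := by
  induction l with
  | nil => simp [esz_nil]
  | cons b l ih =>
    rw [esz_cons, List.length_cons]
    omega

theorem esz_list_le {l : List β} {M : ℕ} (h : ∀ a ∈ l, esz α a ≤ M) :
    esz α l ≤ 1 + l.length * (M + 1) := by
  induction l with
  | nil => simp [esz_nil]
  | cons b l ih =>
    have h₁ := ih fun a ha => h a (by simp [ha])
    have h₂ := h b (by simp)
    rw [esz_cons, List.length_cons, add_mul]
    omega

theorem esz_le_of_sublist {l l' : List β} (h : l.Sublist l') : esz α l ≤ esz α l' := by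
  induction h with
  | slnil => exact le_rfl
  | cons a _ ih =>
    rw [esz_cons]
    omega
  | cons_cons a _ ih =>
    rw [esz_cons, esz_cons]
    omega

/-- A numerical function is bounded by a polynomial in the size of the representation. -/
def PB (g : β → ℕ) : Prop := ∃ p : Polynomial ℕ, ∀ x, g x ≤ p.eval (esz α x)

variable {α}

/-- The coefficients are natural numbers. Monotonicity allows size bounds to be substituted into
time bounds. -/
theorem eval_mono (p : Polynomial ℕ) {m n : ℕ} (h : m ≤ n) : p.eval m ≤ p.eval n := by
  rw [Polynomial.eval_eq_sum_range, Polynomial.eval_eq_sum_range]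
  exact Finset.sum_le_sum fun i _ => Nat.mul_le_mul_left _ (Nat.pow_le_pow_left h i)

namespace PB

theorem const (n : ℕ) : PB α (fun _ : β => n) := ⟨Polynomial.C n, by simp⟩

theorem self : PB α (fun x : β => esz α x) := ⟨Polynomial.X, by simp⟩

theorem add {g h : β → ℕ} (hg : PB α g) (hh : PB α h) : PB α (fun x => g x + h x) := by
  obtain ⟨p, hp⟩ := hg
  obtain ⟨q, hq⟩ := hh
  refine ⟨p + q, fun x => ?_⟩
  rw [Polynomial.eval_add]
  exact add_le_add (hp x) (hq x)

theorem mul {g h : β → ℕ} (hg : PB α g) (hh : PB α h) : PB α (fun x => g x * h x) := by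
  obtain ⟨p, hp⟩ := hg
  obtain ⟨q, hq⟩ := hh
  refine ⟨p * q, fun x => ?_⟩
  rw [Polynomial.eval_mul]
  exact Nat.mul_le_mul (hp x) (hq x)

theorem mono {g h : β → ℕ} (hg : PB α g) (hh : ∀ x, h x ≤ g x) : PB α h := by
  obtain ⟨p, hp⟩ := hg
  exact ⟨p, fun x => (hh x).trans (hp x)⟩

theorem eval {g : β → ℕ} (hg : PB α g) (p : Polynomial ℕ) : PB α (fun x => p.eval (g x)) := by
  obtain ⟨q, hq⟩ := hg
  refine ⟨p.comp q, fun x => ?_⟩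
  rw [Polynomial.eval_comp]
  exact eval_mono p (hq x)

theorem comp {γ : Type*} [Enc α γ] {g : γ → ℕ} (hg : PB α g) {f : β → γ}
    (hf : PB α (fun x => esz α (f x))) : PB α (fun x => g (f x)) := by
  obtain ⟨p, hp⟩ := hg
  exact (hf.eval p).mono fun x => hp (f x)

end PB

end

/-- Functions between encoded types that some program computes in polynomial time. -/
def PT (α : Type u) [LinearOrder α] [OrderBot α] {β γ : Type*} [Enc α β] [Enc α γ]
    (f : β → γ) : Prop :=
  ∃ (c : Code) (T : β → ℕ), PB α T ∧ PB α (fun x => esz α (f x)) ∧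
    ∀ x, ∃ k ≤ T x, c.Eval (Enc.enc x : Data α) (Enc.enc (f x)) k

namespace PT

variable {α : Type u} [LinearOrder α] [OrderBot α]
variable {β γ δ σ : Type*} [Enc α β] [Enc α γ] [Enc α δ] [Enc α σ]

theorem pb {f : β → γ} (hf : PT α f) : PB α (fun x => esz α (f x)) := hf.choose_spec.choose_spec.2.1

/-- Only representations matter to a program, so a change of type that leaves the datum unchanged
costs nothing. -/
theorem of_enc_eq {f : β → γ} {g : β → δ} (hf : PT α f)
    (h : ∀ x, (Enc.enc (f x) : Data α) = Enc.enc (g x)) : PT α g := by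
  obtain ⟨c, T, hT, hb, he⟩ := hf
  refine ⟨c, T, hT, hb.mono fun x => ?_, fun x => ?_⟩
  · rw [esz, esz, h]
  · rw [← h]
    exact he x

theorem congr {f g : β → γ} (h : ∀ x, f x = g x) (hf : PT α f) : PT α g :=
  of_enc_eq hf fun x => by rw [h]

theorem id : PT α (fun x : β => x) := ⟨.id, fun _ => 1, .const 1, .self, fun _ => ⟨1, le_rfl, .id _⟩⟩

/-- The bound on the output size that is part of `PT` is used here: the second program runs in time
polynomial in the size of the intermediate result. -/
theorem comp {g : γ → δ} {f : β → γ} (hg : PT α g) (hf : PT α f) : PT α (fun x => g (f x)) := by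
  obtain ⟨c, T, hT, hb, he⟩ := hf
  obtain ⟨c', T', hT', hb', he'⟩ := hg
  refine ⟨.comp c' c, fun x => T x + T' (f x) + 1, (hT.add (hT'.comp hb)).add (.const 1),
    hb'.comp hb, fun x => ?_⟩
  obtain ⟨k, hk, h⟩ := he x
  obtain ⟨k', hk', h'⟩ := he' (f x)
  exact ⟨_, by beta_reduce; omega, .comp h h'⟩

theorem pair {f : β → γ} {g : β → δ} (hf : PT α f) (hg : PT α g) :
    PT α (fun x => (f x, g x)) := by
  obtain ⟨c, T, hT, hb, he⟩ := hf
  obtain ⟨c', T', hT', hb', he'⟩ := hg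
  refine ⟨.pair c c', fun x => T x + T' x + 1, (hT.add hT').add (.const 1),
    (hb.add hb').add (.const 1), fun x => ?_⟩
  obtain ⟨k, hk, h⟩ := he x
  obtain ⟨k', hk', h'⟩ := he' x
  exact ⟨_, by beta_reduce; omega, .pair h h'⟩

theorem fst {f : β → γ × δ} (hf : PT α f) : PT α (fun x => (f x).1) := by
  refine PT.comp (g := fun z : γ × δ => z.1) ?_ hf
  refine ⟨.hd, fun _ => 1, .const 1, PB.self.mono fun x => ?_, fun x => ⟨1, le_rfl, .hd _⟩⟩
  rw [esz_prod]
  beta_reduce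
  omega

theorem snd {f : β → γ × δ} (hf : PT α f) : PT α (fun x => (f x).2) := by
  refine PT.comp (g := fun z : γ × δ => z.2) ?_ hf
  refine ⟨.tl, fun _ => 1, .const 1, PB.self.mono fun x => ?_, fun x => ⟨1, le_rfl, .tl _⟩⟩
  rw [esz_prod]
  beta_reduce
  omega

theorem of_nil {y : β} (hy : (Enc.enc y : Data α) = .nil) : PT α (fun _ : γ => y) :=
  ⟨.nil, fun _ => 1, .const 1, .const _, fun _ => ⟨1, le_rfl, hy ▸ .nil _⟩⟩

theorem false : PT α (fun _ : β => false) := of_nil rfl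
theorem listNil : PT α (fun _ : β => ([] : List γ)) := of_nil rfl
theorem noneLabel : PT α (fun _ : β => (none : Option α)) := of_nil rfl
theorem axisChild : PT α (fun _ : β => Axis.child) := of_nil rfl
theorem unit : PT α (fun _ : β => ()) := of_nil rfl

theorem true : PT α (fun _ : β => true) :=
  of_enc_eq (f := fun _ : β => ((), ())) (pair unit unit) fun _ => rfl

theorem axisDesc : PT α (fun _ : β => Axis.desc) :=
  of_enc_eq (f := fun _ : β => ((), ())) (pair unit unit) fun _ => rfl

theorem bot : PT α (fun _ : β => (⊥ : α)) :=
  ⟨.bot, fun _ => 1, .const 1, .const _, fun _ => ⟨1, le_rfl, .bot _⟩⟩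

theorem cons {f : β → γ} {g : β → List γ} (hf : PT α f) (hg : PT α g) :
    PT α (fun x => f x :: g x) :=
  of_enc_eq (pair hf hg) fun _ => rfl

theorem some {f : β → α} (hf : PT α f) : PT α (fun x => Option.some (f x)) :=
  of_enc_eq hf fun _ => rfl

theorem ite {c : β → Bool} {f g : β → γ} (hc : PT α c) (hf : PT α f) (hg : PT α g) :
    PT α (fun x => if c x then f x else g x) := by
  obtain ⟨c', Tc, hTc, -, hec⟩ := hc
  obtain ⟨cf, Tf, hTf, hbf, hef⟩ := hf
  obtain ⟨cg, Tg, hTg, hbg, heg⟩ := hg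
  refine ⟨.cond c' cf cg, fun x => Tc x + (Tf x + Tg x) + 1, (hTc.add (hTf.add hTg)).add (.const 1),
    (hbf.add hbg).mono fun x => ?_, fun x => ?_⟩
  · beta_reduce
    split_ifs <;> omega
  · obtain ⟨k, hk, h⟩ := hec x
    obtain ⟨kf, hkf, h₁⟩ := hef x
    obtain ⟨kg, hkg, h₂⟩ := heg x
    beta_reduce
    cases hcx : c x with
    | false =>
      rw [hcx] at h
      exact ⟨_, by omega, .cond_false h h₂⟩
    | true =>
      rw [hcx] at h
      exact ⟨_, by omega, .cond_true h (by simp [Enc.enc, Data.yes]) h₁⟩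

theorem not {c : β → Bool} (hc : PT α c) : PT α (fun x => !c x) := by
  refine congr (f := (fun x => if c x then Bool.false else Bool.true)) (fun x => ?_) <|
    ite hc false true
  cases c x <;> rfl

theorem and {c d : β → Bool} (hc : PT α c) (hd : PT α d) : PT α (fun x => c x && d x) := by
  refine congr (f := (fun x => if c x then d x else Bool.false)) (fun x => ?_) <| ite hc hd false
  cases c x <;> rfl

theorem or {c d : β → Bool} (hc : PT α c) (hd : PT α d) : PT α (fun x => c x || d x) := by
  refine congr (f := (fun x => if c x then Bool.true else d x)) (fun x => ?_) <| ite hc true hd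
  cases c x <;> rfl

theorem isDesc {f : β → Axis} (hf : PT α f) :
    PT α (fun x => match f x with | .child => Bool.false | .desc => Bool.true) :=
  of_enc_eq hf fun x => by cases f x <;> rfl

theorem le {f g : β → α} (hf : PT α f) (hg : PT α g) : PT α (fun x => decide (f x ≤ g x)) := by
  refine PT.comp (g := fun z : α × α => decide (z.1 ≤ z.2)) ?_ (pair hf hg)
  refine ⟨.le, fun _ => 1, .const 1, (PB.const 3).mono fun x => esz_bool_le α _,
    fun x => ⟨1, le_rfl, ?_⟩⟩
  convert Code.Eval.le (Enc.enc x : Data α) using 1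
  simp [Enc.enc, Data.cmp]

theorem eqLabel {f g : β → α} (hf : PT α f) (hg : PT α g) : PT α (fun x => decide (f x = g x)) := by
  refine congr (f := (fun x => decide (f x ≤ g x) && decide (g x ≤ f x))) (fun x => ?_) <|
    (le hf hg).and (le hg hf)
  rw [← Bool.decide_and]
  exact decide_eq_decide.2 le_antisymm_iff.symm

end PT

/-- Case distinction on a list. -/
def listCases {γ : Type*} {δ : Type*} (l : List γ) (d : δ) (g : γ → List γ → δ) : δ :=
  match l with
  | [] => d
  | a :: t => g a t

/-! ### Case distinctions and bounded loops over lists -/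

namespace PT

variable {α : Type u} [LinearOrder α] [OrderBot α]
variable {β γ δ σ : Type*} [Enc α β] [Enc α γ] [Enc α δ] [Enc α σ]

theorem condNil {c : β → γ} {f : β → δ} {g : β × γ → δ} (hc : PT α c) (hf : PT α f) (hg : PT α g)
    {h : β → δ} (hh : ∀ x, ((Enc.enc (c x) : Data α) = .nil → h x = f x) ∧
      ((Enc.enc (c x) : Data α) ≠ .nil → h x = g (x, c x))) : PT α h := by
  have hg' : PT α (fun x => g (x, c x)) := hg.comp (pair id hc)
  obtain ⟨c', Tc, hTc, -, hec⟩ := hc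
  obtain ⟨cf, Tf, hTf, hbf, hef⟩ := hf
  obtain ⟨cg, Tg, hTg, hbg, heg⟩ := hg'
  refine ⟨.cond c' cg cf, fun x => Tc x + (Tf x + Tg x) + 1, (hTc.add (hTf.add hTg)).add (.const 1),
    (hbf.add hbg).mono fun x => ?_, fun x => ?_⟩
  · by_cases hx : (Enc.enc (c x) : Data α) = .nil
    · rw [(hh x).1 hx]
      omega
    · rw [(hh x).2 hx]
      beta_reduce
      omega
  · obtain ⟨k, hk, h⟩ := hec x
    obtain ⟨kf, hkf, h₁⟩ := hef x
    obtain ⟨kg, hkg, h₂⟩ := heg x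
    by_cases hx : (Enc.enc (c x) : Data α) = .nil
    · rw [(hh x).1 hx]
      rw [hx] at h
      exact ⟨_, by beta_reduce; omega, .cond_false h h₁⟩
    · rw [(hh x).2 hx]
      exact ⟨_, by beta_reduce; omega, .cond_true h hx h₂⟩

theorem isNone {o : β → Option α} (ho : PT α o) : PT α (fun x => (o x).isNone) :=
  condNil (g := fun _ => Bool.false) ho true false fun x => by
    cases hx : o x <;> simp [Enc.enc, encodeLabel]

theorem getD {o : β → Option α} (ho : PT α o) : PT α (fun x => (o x).getD ⊥) := by
  obtain ⟨c, T, hT, hb, he⟩ := ho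
  -- The datum of `some a` is the atom itself, so returning the tested datum unwraps the option.
  refine ⟨.cond c c .bot, fun x => T x + T x + 2, (hT.add hT).add (.const 2), .const 1,
    fun x => ?_⟩
  obtain ⟨k, hk, h⟩ := he x
  beta_reduce
  cases hx : o x with
  | none =>
    rw [hx] at h
    exact ⟨k + 1 + 1, by omega, .cond_false h (.bot _)⟩
  | some a =>
    rw [hx] at h
    exact ⟨_, by omega, .cond_true h (by simp [Enc.enc, encodeLabel]) h⟩

theorem listCases {l : β → List γ} {f : β → δ} {g : β → γ → List γ → δ} (hl : PT α l)
    (hf : PT α f) (hg : PT α (fun z : β × γ × List γ => g z.1 z.2.1 z.2.2)) :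
    PT α (fun x => TwigLearn.listCases (l x) (f x) (g x)) := by
  obtain ⟨c', Tc, hTc, hbc, hec⟩ := hl
  obtain ⟨cf, Tf, hTf, hbf, hef⟩ := hf
  obtain ⟨cg, Tg, hTg, hbg, heg⟩ := hg
  obtain ⟨p, hp⟩ := hTg
  obtain ⟨q, hq⟩ := hbg
  have hsz : ∀ x a t, l x = a :: t → esz α (x, a, t) ≤ esz α x + esz α (l x) + 1 := by
    intro x a t h
    rw [h, esz_prod, esz_prod, esz_cons]
  have hsum : PB α (fun x => esz α x + esz α (l x) + 1) := (PB.self.add hbc).add (.const 1)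
  -- The list is computed a second time to form the input of the branch: the pair of `x` and `a ::
  -- t` has the same representation as `(x, a, t)`.
  refine ⟨.cond c' (.comp cg (.pair .id c')) cf,
    fun x => Tc x + (Tf x + (p.eval (esz α x + esz α (l x) + 1) + Tc x + 3)) + 1, ?_, ?_,
    fun x => ?_⟩
  · exact (hTc.add (hTf.add (((hsum.eval p).add hTc).add (.const 3)))).add (.const 1)
  · refine (hbf.add (hsum.eval q)).mono fun x => ?_
    beta_reduce
    cases hx : l x with
    | nil => exact Nat.le_add_right _ _
    | cons a t =>
      refine le_trans ?_ (Nat.le_add_left _ _)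
      refine (hq (x, a, t)).trans (eval_mono q ?_)
      rw [← hx]
      exact hsz x a t hx
  · obtain ⟨k, hk, h⟩ := hec x
    obtain ⟨kf, hkf, h₁⟩ := hef x
    beta_reduce
    cases hx : l x with
    | nil =>
      rw [hx] at h
      exact ⟨_, by omega, .cond_false h h₁⟩
    | cons a t =>
      obtain ⟨kg, hkg, h₂⟩ := heg (x, a, t)
      have h₃ := (hp (x, a, t)).trans (eval_mono p (hsz x a t hx))
      rw [hx] at h h₃
      exact ⟨k + (1 + k + 1 + kg + 1) + 1, by omega,
        .cond_true h (by simp [Enc.enc, Data.list]) (.comp (.pair (.id _) h) h₂)⟩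

theorem headD {l : β → List γ} {f : β → γ} (hl : PT α l) (hf : PT α f) :
    PT α (fun x => (l x).headD (f x)) := by
  refine congr (f := (fun x => TwigLearn.listCases (l x) (f x) fun a _ => a)) (fun x => ?_) <|
    listCases (g := fun _ a _ => a) hl hf (fst (snd id))
  cases l x <;> rfl

theorem tail {l : β → List γ} (hl : PT α l) : PT α (fun x => (l x).tail) := by
  refine congr (f := (fun x => TwigLearn.listCases (l x) [] fun _ t => t)) (fun x => ?_) <|
    listCases (g := fun _ _ t => t) hl listNil (snd (snd id))
  cases l x <;> rfl

theorem isEmpty {l : β → List γ} (hl : PT α l) : PT α (fun x => (l x).isEmpty) := by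
  refine congr (f := (fun x => TwigLearn.listCases (l x) Bool.true
    fun _ _ => Bool.false)) (fun x => ?_) <| listCases (g := fun _ _ _ => Bool.false) hl true false
  cases l x <;> rfl

/-- The program that runs through a list, given as `(x, s, l)`, and updates the state `s`. -/
def foldCode (cs : Code) : Code :=
  .loop (.comp .tl .tl) (.pair .hd (.pair
    (.comp cs (.pair .hd (.pair (.comp .hd .tl) (.comp .hd (.comp .tl .tl)))))
    (.comp .tl (.comp .tl .tl))))

/-- The cost of `cs` is assumed only for states reached after a prefix of `l`, since a uniform bound
is available only for those. The constant 30 covers the overhead of one iteration. -/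
theorem foldCode_eval {cs : Code} {x : β} {step : σ → γ → σ} {T : ℕ} :
    ∀ (l : List γ) (s : σ),
    (∀ l' a, l' ++ [a] <+: l → ∃ k ≤ T, cs.Eval (Enc.enc (x, l'.foldl step s, a) : Data α)
      (Enc.enc (step (l'.foldl step s) a)) k) →
    ∃ k ≤ (l.length + 1) * (T + 30), (foldCode cs).Eval (Enc.enc (x, s, l) : Data α)
      (Enc.enc (x, l.foldl step s, ([] : List γ))) k
  | [], s, _ => by
    refine ⟨3 + 1, by simp, .loop_done ?_⟩
    exact .comp (.tl _) (.tl _)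
  | a :: l, s, h => by
    obtain ⟨k, hk, he⟩ := h [] a (by simp)
    obtain ⟨k', hk', he'⟩ := foldCode_eval l (step s a) fun l' b hl' => by
      obtain ⟨k, hk, he⟩ := h (a :: l') b (by simpa using hl')
      exact ⟨k, hk, he⟩
    refine ⟨_, ?_, .loop_step (.comp (.tl _) (.tl _)) (by simp [Enc.enc, Data.list, Data.tl])
      (.pair (.hd _) (.pair (.comp (.pair (.hd _) (.pair (.comp (.tl _) (.hd _))
        (.comp (.comp (.tl _) (.tl _)) (.hd _)))) he)
        (.comp (.comp (.tl _) (.tl _)) (.tl _)))) he'⟩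
    rw [List.length_cons, add_mul (l.length + 1)]
    omega

/-- Iterating a polynomial-time step may inflate the state exponentially, so a polynomial bound `B`
on all intermediate states is a hypothesis. -/
theorem foldl {l : β → List γ} {init : β → σ} {step : β → σ → γ → σ} (hl : PT α l)
    (hi : PT α init) (hs : PT α (fun z : β × σ × γ => step z.1 z.2.1 z.2.2)) {B : β → ℕ}
    (hB : PB α B) (hb : ∀ x l', l' <+: l x → esz α (l'.foldl (step x) (init x)) ≤ B x) :
    PT α (fun x => (l x).foldl (step x) (init x)) := by
  obtain ⟨cl, Tl, hTl, hbl, hel⟩ := hl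
  obtain ⟨ci, Ti, hTi, hbi, hei⟩ := hi
  obtain ⟨cs, Ts, ⟨p, hp⟩, -, hes⟩ := hs
  have hsum : PB α (fun x => esz α x + B x + esz α (l x) + 2) :=
    ((PB.self.add hB).add hbl).add (.const 2)
  refine ⟨.comp (.comp .hd .tl) (.comp (foldCode cs) (.pair .id (.pair ci cl))),
    fun x => Ti x + Tl x + (esz α (l x) + 1) * (p.eval (esz α x + B x + esz α (l x) + 2) + 30) + 10,
    ?_, hB.mono fun x => hb x _ (List.prefix_refl _), fun x => ?_⟩
  · exact ((hTi.add hTl).add ((hbl.add (.const 1)).mul ((hsum.eval p).add (.const 30)))).add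
      (.const 10)
  · obtain ⟨kl, hkl, h₁⟩ := hel x
    obtain ⟨ki, hki, h₂⟩ := hei x
    obtain ⟨k, hk, h₃⟩ := foldCode_eval (α := α) (cs := cs) (x := x) (step := step x)
      (T := p.eval (esz α x + B x + esz α (l x) + 2)) (l x) (init x) fun l' a hl' => by
        obtain ⟨k, hk, h⟩ := hes (x, l'.foldl (step x) (init x), a)
        refine ⟨k, hk.trans ((hp _).trans (eval_mono p ?_)), h⟩
        have h₄ := hb x l' ((List.prefix_append _ _).trans hl')
        have h₅ := esz_le_of_mem α (hl'.subset (show a ∈ l' ++ [a] by simp))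
        rw [esz_prod, esz_prod]
        simp only
        omega
    refine ⟨_, ?_, .comp (.comp (.pair (.id _) (.pair h₂ h₁)) h₃) (.comp (.tl _) (.hd _))⟩
    have h₆ : ((l x).length + 1) * (p.eval (esz α x + B x + esz α (l x) + 2) + 30) ≤
        (esz α (l x) + 1) * (p.eval (esz α x + B x + esz α (l x) + 2) + 30) :=
      Nat.mul_le_mul_right _ (by have := length_lt_esz α (l x); omega)
    beta_reduce
    omega

/-- When each step adds at most `G x` to the size, the states stay below the initial size plus the
number of steps times `G x`. -/
theorem foldl_add {l : β → List γ} {init : β → σ} {step : β → σ → γ → σ} (hl : PT α l)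
    (hi : PT α init) (hs : PT α (fun z : β × σ × γ => step z.1 z.2.1 z.2.2)) {G : β → ℕ}
    (hG : PB α G) (hb : ∀ x s, ∀ a ∈ l x, esz α (step x s a) ≤ esz α s + G x) :
    PT α (fun x => (l x).foldl (step x) (init x)) := by
  refine foldl hl hi hs (hi.pb.add (hl.pb.mul hG)) fun x l' hl' => ?_
  have key : ∀ (l' : List γ) (s : σ), (∀ a ∈ l', a ∈ l x) →
      esz α (l'.foldl (step x) s) ≤ esz α s + l'.length * G x := by
    intro l'
    induction l' with
    | nil => intro s _; simp
    | cons a l' ih =>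
      intro s h
      have h₁ := ih (step x s a) fun a ha => h a (by simp [ha])
      have h₂ := hb x s a (h a (by simp))
      rw [List.foldl_cons, List.length_cons, add_mul]
      omega
  refine (key l' _ fun a ha => hl'.subset ha).trans (Nat.add_le_add_left ?_ _)
  refine Nat.mul_le_mul_right _ ?_
  have h₁ := hl'.length_le
  have h₂ := length_lt_esz α (l x)
  omega

theorem reverse {l : β → List γ} (hl : PT α l) : PT α (fun x => (l x).reverse) := by
  refine congr (f := (fun x => (l x).foldl (fun s a => a :: s) [])) (fun x => ?_) <|
    foldl_add (step := fun _ s a => a :: s) hl listNil (cons (snd (snd id)) (fst (snd id)))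
      (hl.pb.add (.const 1)) ?_
  · simp [List.foldl_flip_cons_eq_append]
  · intro x s a ha
    have := esz_le_of_mem α ha
    rw [esz_cons]
    omega

theorem foldr {l : β → List γ} {init : β → σ} {step : β → γ → σ → σ} (hl : PT α l)
    (hi : PT α init) (hs : PT α (fun z : β × σ × γ => step z.1 z.2.2 z.2.1)) {B : β → ℕ}
    (hB : PB α B) (hb : ∀ x l', l' <:+ l x → esz α (l'.foldr (step x) (init x)) ≤ B x) :
    PT α (fun x => (l x).foldr (step x) (init x)) := by
  refine congr (f := (fun x => (l x).reverse.foldl (fun s a => step x a s) (init x))) (fun x => ?_) <|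
    foldl (step := fun x s a => step x a s) hl.reverse hi hs hB ?_
  · rw [List.foldl_reverse]
  · intro x l' hl'
    have := hb x l'.reverse (by rw [← List.reverse_reverse (l x)]; exact List.reverse_suffix.2 hl')
    rwa [List.foldr_reverse] at this

theorem foldr_add {l : β → List γ} {init : β → σ} {step : β → γ → σ → σ} (hl : PT α l)
    (hi : PT α init) (hs : PT α (fun z : β × σ × γ => step z.1 z.2.2 z.2.1)) {G : β → ℕ}
    (hG : PB α G) (hb : ∀ x s, ∀ a ∈ l x, esz α (step x a s) ≤ esz α s + G x) :
    PT α (fun x => (l x).foldr (step x) (init x)) := by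
  refine congr (f := (fun x => (l x).reverse.foldl (fun s a => step x a s) (init x))) (fun x => ?_) <|
    foldl_add (step := fun x s a => step x a s) hl.reverse hi hs hG ?_
  · rw [List.foldl_reverse]
  · intro x s a ha
    exact hb x s a (List.mem_reverse.1 ha)

theorem append {l l' : β → List γ} (hl : PT α l) (hl' : PT α l') : PT α (fun x => l x ++ l' x) := by
  refine congr (f := (fun x => (l x).foldr (fun a s => a :: s) (l' x))) (fun x => ?_) <|
    foldr_add (step := fun _ a s => a :: s) hl hl' (cons (snd (snd id)) (fst (snd id)))
      (hl.pb.add (.const 1)) ?_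
  · simp
  · intro x s a ha
    have := esz_le_of_mem α ha
    rw [esz_cons]
    omega

theorem map {l : β → List γ} {g : β → γ → δ} (hl : PT α l)
    (hg : PT α (fun z : β × γ => g z.1 z.2)) : PT α (fun x => (l x).map (g x)) := by
  obtain ⟨p, hp⟩ := hg.pb
  refine congr (f := (fun x => (l x).foldr (fun a s => g x a :: s) [])) (fun x => ?_) <|
    foldr_add (step := fun x a s => g x a :: s) hl listNil
      (cons (hg.comp (pair (fst id) (snd (snd id)))) (fst (snd id)))
      (((((PB.self.add hl.pb).add (.const 1)).eval p)).add (.const 1)) ?_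
  · induction l x with
    | nil => rfl
    | cons a l ih => simp [ih]
  · intro x s a ha
    have h₁ := esz_le_of_mem α ha
    have h₂ := (hp (x, a)).trans (eval_mono p (n := esz α x + esz α (l x) + 1) (by
      rw [esz_prod]
      simp only
      omega))
    rw [esz_cons]
    simp only at *
    omega

theorem flatten {l : β → List (List γ)} (hl : PT α l) : PT α (fun x => (l x).flatten) := by
  refine congr (f := (fun x => (l x).foldr (fun a s => a ++ s) [])) (fun x => ?_) <|
    foldr_add (step := fun _ a s => a ++ s) hl listNil (append (snd (snd id)) (fst (snd id)))
      hl.pb ?_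
  · induction l x with
    | nil => rfl
    | cons a l ih => simp [ih]
  · intro x s a ha
    have h₁ := esz_le_of_mem α ha
    have h₂ := esz_append α a s
    omega

theorem flatMap {l : β → List γ} {g : β → γ → List δ} (hl : PT α l)
    (hg : PT α (fun z : β × γ => g z.1 z.2)) : PT α (fun x => (l x).flatMap (g x)) := by
  simp only [List.flatMap_def]
  exact flatten (map hl hg)

theorem filter {l : β → List γ} {g : β → γ → Bool} (hl : PT α l)
    (hg : PT α (fun z : β × γ => g z.1 z.2)) : PT α (fun x => (l x).filter (g x)) := by
  refine congr (f := (fun x => (l x).flatMap (fun a => if g x a then [a] else []))) (fun x => ?_) <|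
    flatMap (g := fun x a => if g x a then [a] else []) hl
      (ite hg (cons (snd id) listNil) listNil)
  induction l x with
  | nil => rfl
  | cons a l ih => by_cases h : g x a <;> simp [ih, h]

theorem all {l : β → List γ} {g : β → γ → Bool} (hl : PT α l)
    (hg : PT α (fun z : β × γ => g z.1 z.2)) : PT α (fun x => (l x).all (g x)) := by
  refine congr (f := (fun x => ((l x).filter (fun a => !g x a)).isEmpty)) (fun x => ?_) <|
    isEmpty (filter (g := fun x a => !g x a) hl hg.not)
  induction l x with
  | nil => rfl
  | cons a l ih => cases h : g x a <;> simp [← ih, h]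

/-- A unary number and a list of units are the same datum, so counters can be handled by the list
operations. -/
theorem units {f : β → ℕ} (hf : PT α f) : PT α (fun x => List.replicate (f x) ()) := by
  refine of_enc_eq hf fun x => ?_
  induction f x with
  | zero => rfl
  | succ n ih =>
    rw [List.replicate_succ]
    change Data.cons .nil (Enc.enc n) = Data.cons .nil (Enc.enc (List.replicate n ()))
    rw [ih]

theorem drop {l : β → List γ} {n : β → List δ} (hl : PT α l) (hn : PT α n) :
    PT α (fun x => (l x).drop (n x).length) := by
  refine congr (f := (fun x => (n x).foldl (fun s _ => s.tail) (l x))) (fun x => ?_) <|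
    foldl_add (step := fun _ s _ => s.tail) hn hl (tail (fst (snd id))) (.const 0) ?_
  · generalize l x = l'
    induction n x generalizing l' with
    | nil => rfl
    | cons a l ih => simp [ih]
  · intro x s a _
    exact esz_le_of_sublist α (List.tail_sublist s)

theorem tails {l : β → List γ} (hl : PT α l) : PT α (fun x => (l x).tails) := by
  refine congr (f :=
    (fun x => (l x).foldr (fun a s => (a :: s.headD []) :: s) [[]])) (fun x => ?_) <|
    foldr (step := fun _ a s => (a :: s.headD []) :: s) hl (cons listNil listNil)
      (cons (cons (snd (snd id)) (headD (fst (snd id)) listNil)) (fst (snd id)))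
      ((PB.const 1).add ((hl.pb.add (.const 1)).mul (hl.pb.add (.const 1)))) ?_
  all_goals
    have key : ∀ l : List γ, l.foldr (fun a s => (a :: s.headD []) :: s) [[]] = l.tails := by
      intro l
      induction l with
      | nil => rfl
      | cons a l ih =>
        rw [List.foldr_cons, ih]
        cases l <;> rfl
  · exact key _
  · intro x l' hl'
    rw [key]
    have h₁ : ∀ a ∈ l'.tails, esz α a ≤ esz α (l x) := fun a ha =>
      esz_le_of_sublist α (((List.mem_tails _ _).1 ha).trans hl').sublist
    refine (esz_list_le α h₁).trans (Nat.add_le_add_left (Nat.mul_le_mul_right _ ?_) _)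
    have h₂ := hl'.length_le
    have h₃ := length_lt_esz α (l x)
    rw [List.length_tails]
    omega

end PT

end TwigLearn

namespace TwigLearn

universe u

/-! ### An implementation of the learning algorithm on words -/

section impl

variable {α : Type u} [LinearOrder α] [OrderBot α]

/-- Is the edge a descendant edge? -/
def Axis.isDesc : Axis → Bool
  | .child => false
  | .desc => true

/-- Test of the label condition. -/
def labelB (b : Option α) (c : α) : Bool := b.isNone || decide (c = b.getD ⊥)

/-- One entry of the table that records which suffixes of a word are matched. -/
def rowCell (s : Axis × Option α) (e : α × Bool) (acc : List (α × Bool) × Bool) :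
    List (α × Bool) × Bool :=
  ((e.1, acc.2) :: acc.1, (labelB s.2 e.1 && e.2) || (s.1.isDesc && acc.2))

/-- One row of the table. -/
def rowStep (s : Axis × Option α) (st : List (α × Bool) × Bool) : List (α × Bool) × Bool :=
  st.1.foldr (rowCell s) ([], false)

/-- The first row of the table. -/
def initRow (w : List α) : List (α × Bool) × Bool :=
  w.foldr (fun c acc => ((c, acc.2) :: acc.1, false)) ([], true)

/-- Test whether steps match a word. -/
def stepsB (s : List (Axis × Option α)) (w : List α) : Bool := (s.foldr rowStep (initRow w)).2

/-- Test whether a query, given by the label of its root and its steps, matches a word. -/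
def queryB (q : Option α × List (Axis × Option α)) (w : List α) : Bool :=
  listCases w false fun c w' => labelB q.1 c && stepsB q.2 w'

/-- Test whether a query matches all words of a list. -/
def consB (W : List (List α)) (q : Option α × List (Axis × Option α)) : Bool :=
  W.all fun w => queryB q w

/-- The label of a node. -/
def labAt (l : List α) (i : ℕ) : α := (l.drop i).headD ⊥

/-- The parent of a node. -/
def parentOf (es : List (ℕ × ℕ)) (v : ℕ) : ℕ :=
  ((es.filter fun e => decide (e.2 = v)).headD (0, 0)).1

/-- One step towards the root. -/
def climb (T : ℕ × ℕ × List α × List (ℕ × ℕ)) (st : ℕ × List α) : ℕ × List α :=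
  if decide (st.1 = T.1) then st
  else (parentOf T.2.2.2 st.1, labAt T.2.2.1 (parentOf T.2.2.2 st.1) :: st.2)

/-- The selecting word of a tree that is given by its root, its selected node, its labels and
its edges. -/
def rawWord (T : ℕ × ℕ × List α × List (ℕ × ℕ)) : List α :=
  (T.2.2.1.foldl (fun st _ => climb T st) (T.2.1, [labAt T.2.2.1 T.2.1])).2

/-- The lexicographic order on words of the same length. -/
def lexB (w w' : List α) : Bool :=
  (w.foldr (fun a (st : List α × Bool) => (st.1.tail,
    !decide (st.1.headD ⊥ ≤ a) || (decide (a = st.1.headD ⊥) && st.2))) (w'.reverse, true)).2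

/-- The canonical order on words. -/
def shortB (w w' : List α) : Bool :=
  (w.drop w'.length).isEmpty && (!(w'.drop w.length).isEmpty || lexB w w')

/-- The least word of a list. -/
def minWord (W : List (List α)) : List α := (W.filter fun w => W.all fun w' => shortB w w').headD []

/-- The initial segment of `s` that is left when a final segment of the length of `r` is removed. -/
def takeTo {γ δ : Type*} (s : List γ) (r : List δ) : List γ := (s.reverse.drop r.length).reverse

/-- The nonempty factors of a word by decreasing lengths. -/
def factors (w : List α) : List (List α) :=
  w.tails.flatMap fun t => if t.isEmpty then [] else
    (w.tails.filter fun s => (t.drop s.length).isEmpty).map fun s => takeTo s (s.drop t.length)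

/-- `factorSteps` by case distinction. -/
def factorStepsB (u : List α) : List (Axis × Option α) :=
  listCases u [] fun a u => (Axis.desc, some a) :: u.map fun b => (Axis.child, some b)

/-- The candidates for the insertion of a factor. -/
def insertCands (u : List α) (q : Option α × List (Axis × Option α)) :
    List (Option α × List (Axis × Option α)) :=
  (q.2.tails.filter fun r => listCases r false fun s _ => s.1.isDesc).map fun r =>
    (q.1, takeTo q.2 r ++ (factorStepsB u ++ r))

/-- Insert a factor once, if possible. -/
def insertOnce (W : List (List α)) (u : List α) (q : Option α × List (Axis × Option α)) :
    Option α × List (Axis × Option α) :=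
  ((insertCands u q).filter fun q' => consB W q').headD q

/-- Insert a factor repeatedly. -/
def insertMany (W : List (List α)) (v u : List α) (q : Option α × List (Axis × Option α)) :
    Option α × List (Axis × Option α) :=
  v.foldl (fun q _ => insertOnce W u q) q

/-- The first stage. -/
def stage1B (W : List (List α)) (v : List α) (us : List (List α)) :
    Option α × List (Axis × Option α) :=
  us.foldl (fun q u => insertMany W v u q) (none, [(Axis.desc, none)])

/-- Replace the label of the selecting node. -/
def setLastB (q : Option α × List (Axis × Option α)) (a : α) : Option α × List (Axis × Option α) :=
  (q.1, (listCases q.2.reverse [] fun s r => (s.1, some a) :: r).reverse)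

/-- Specialize the label of the root. -/
def stage2HeadB (W : List (List α)) (v : List α) (q : Option α × List (Axis × Option α)) :
    Option α × List (Axis × Option α) :=
  if consB W (some (v.headD ⊥), q.2) then (some (v.headD ⊥), q.2) else q

/-- Specialize the label of the selecting node. -/
def stage2LastB (W : List (List α)) (v : List α) (q : Option α × List (Axis × Option α)) :
    Option α × List (Axis × Option α) :=
  if consB W (setLastB q (v.reverse.headD ⊥)) then setLastB q (v.reverse.headD ⊥) else q

/-- `starSteps` with the number of wildcards given by the length of a list. -/
def starStepsB (x : Axis) (t : List α) (b : Option α) : List (Axis × Option α) :=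
  listCases t [(x, b)] fun _ t => (x, none) :: (t.map (fun _ => (Axis.child, none)) ++
    [(Axis.child, b)])

/-- The greatest number of wildcards, as the length of a suffix of `v`. -/
def bestStar (W : List (List α)) (v : List α) (h : Option α) (l : List (Axis × Option α))
    (b : Option α) (r : List (Axis × Option α)) : List α :=
  (v.tails.filter fun t => consB W (h, l ++ (starStepsB Axis.desc t b ++ r))).headD []

/-- Treatment of one step in the third stage; the state consists of the steps that are already
treated and of the given step followed by the remaining ones. -/
def resolveB (W : List (List α)) (v : List α) (h : Option α)
    (st : List (Axis × Option α) × List (Axis × Option α)) (s : Axis × Option α) :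
    List (Axis × Option α) × List (Axis × Option α) :=
  (if s.1.isDesc && consB W (h, st.1 ++
      (starStepsB Axis.child (bestStar W v h st.1 s.2 st.2.tail) s.2 ++ st.2.tail)) then
    st.1 ++ starStepsB Axis.child (bestStar W v h st.1 s.2 st.2.tail) s.2
  else st.1 ++ [s], st.2.tail)

/-- The third stage. -/
def stage3B (W : List (List α)) (v : List α) (q : Option α × List (Axis × Option α)) :
    Option α × List (Axis × Option α) :=
  (q.1, (q.2.foldl (resolveB W v q.1) ([], q.2)).1)

/-- The learning algorithm on words. -/
def learnWords (W : List (List α)) : Option α × List (Axis × Option α) :=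
  stage3B W (minWord W) (stage2LastB W (minWord W) (stage2HeadB W (minWord W)
    (stage1B W (minWord W) (factors (minWord W).tail.reverse.tail.reverse))))

/-- The learning algorithm. -/
def learnTrees (Ts : List (ℕ × ℕ × List α × List (ℕ × ℕ))) :
    Bool × Option α × List (Axis × Option α) :=
  (true, learnWords (Ts.map fun T => rawWord T))

end impl

/-! ### Time bounds for the implementation -/

namespace PT

section sizes

variable {α : Type u}

theorem length_initRow (w : List α) : (TwigLearn.initRow w).1.length = w.length := by
  rw [TwigLearn.initRow]
  induction w with
  | nil => rfl
  | cons a l ih => simp [ih]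

theorem esz_parentOf_le (es : List (ℕ × ℕ)) (v : ℕ) : esz α (TwigLearn.parentOf es v) ≤ esz α es := by
  rw [TwigLearn.parentOf]
  generalize h : es.filter (fun e => decide (e.2 = v)) = l
  rcases l with _ | ⟨e, l⟩
  · exact one_le_esz α es
  · have : e ∈ es := List.mem_of_mem_filter (h ▸ List.mem_cons_self)
    refine le_trans ?_ (esz_le_of_mem α this)
    rw [esz_prod]
    simp only [List.headD_cons]
    omega

theorem esz_step_le (s : Axis × Option α) : esz α s ≤ 5 := by
  have := esz_axis_le α s.1
  rw [esz_prod, esz_label]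
  omega

theorem esz_factorStepsB_le (u : List α) : esz α (TwigLearn.factorStepsB u) ≤ 1 + u.length * 6 := by
  refine (esz_list_le α fun s _ => esz_step_le s).trans ?_
  cases u <;> simp [TwigLearn.factorStepsB, TwigLearn.listCases]

theorem esz_starStepsB_le (x : Axis) (t : List α) (b : Option α) :
    esz α (TwigLearn.starStepsB x t b) ≤ 1 + (t.length + 1) * 6 := by
  refine (esz_list_le α fun s _ => esz_step_le s).trans ?_
  cases t <;> simp [TwigLearn.starStepsB, TwigLearn.listCases]

end sizes

variable {α : Type u} [LinearOrder α] [OrderBot α]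
variable {β γ δ σ : Type*} [Enc α β] [Enc α γ] [Enc α δ] [Enc α σ]

theorem axisIsDesc {f : β → Axis} (hf : PT α f) : PT α (fun x => (f x).isDesc) :=
  congr (fun x => by cases f x <;> rfl) (isDesc hf)

theorem labelB {b : β → Option α} {c : β → α} (hb : PT α b) (hc : PT α c) :
    PT α (fun x => labelB (b x) (c x)) := by
  unfold TwigLearn.labelB
  apply_rules [PT.or, PT.isNone, PT.eqLabel, PT.getD]

theorem rowCell {s : β → Axis × Option α} {e : β → α × Bool} {acc : β → List (α × Bool) × Bool}
    (hs : PT α s) (he : PT α e) (ha : PT α acc) : PT α (fun x => rowCell (s x) (e x) (acc x)) := by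
  unfold TwigLearn.rowCell
  apply_rules [PT.labelB, PT.axisIsDesc, PT.cons, PT.or, PT.and, PT.fst, PT.snd, PT.pair]

theorem esz_rowCell_le (s : Axis × Option α) (e : α × Bool) (acc : List (α × Bool) × Bool) :
    esz α (TwigLearn.rowCell s e acc) ≤ esz α acc + 10 := by
  have h₁ := esz_bool_le α acc.2
  have h₂ := one_le_esz α acc.2
  have h₃ := esz_bool_le α (TwigLearn.rowCell s e acc).2
  have h₄ : esz α (TwigLearn.rowCell s e acc).1 = esz α e.1 + esz α acc.2 + 1 + esz α acc.1 + 1 := rfl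
  rw [esz_prod, esz_prod α acc]
  rw [esz_atom] at h₄
  omega

theorem rowStep {s : β → Axis × Option α} {st : β → List (α × Bool) × Bool}
    (hs : PT α s) (ha : PT α st) : PT α (fun x => rowStep (s x) (st x)) := by
  unfold TwigLearn.rowStep
  refine foldr_add (step := fun x => TwigLearn.rowCell (s x)) (fst ha) (pair listNil false) ?_
    (.const 10) fun x acc e _ => esz_rowCell_le _ _ _
  exact rowCell (hs.comp (fst id)) (snd (snd id)) (fst (snd id))

theorem initRow {w : β → List α} (hw : PT α w) : PT α (fun x => initRow (w x)) := by
  unfold TwigLearn.initRow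
  refine foldr_add (step := fun _ c (acc : List (α × Bool) × Bool) => ((c, acc.2) :: acc.1, Bool.false))
    hw (pair listNil true) ?_ (.const 10) fun x acc e _ => ?_
  · exact pair (cons (pair (snd (snd id)) (snd (fst (snd id)))) (fst (fst (snd id)))) false
  · have h₁ := esz_bool_le α acc.2
    have h₂ := one_le_esz α acc.2
    have h₃ := esz_bool_le α Bool.false
    rw [esz_prod, esz_prod α acc]
    simp only [esz_cons, esz_prod, esz_atom]
    omega

theorem length_rowStep (s : Axis × Option α) (st : List (α × Bool) × Bool) :
    (TwigLearn.rowStep s st).1.length = st.1.length := by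
  rw [TwigLearn.rowStep]
  induction st.1 with
  | nil => rfl
  | cons a l ih => simp [TwigLearn.rowCell, ih]

theorem stepsB {s : β → List (Axis × Option α)} {w : β → List α} (hs : PT α s) (hw : PT α w) :
    PT α (fun x => stepsB (s x) (w x)) := by
  unfold TwigLearn.stepsB
  refine snd (foldr (step := fun _ => TwigLearn.rowStep) hs (initRow hw) ?_
    ((PB.const 10).add (hw.pb.mul (.const 6))) fun x l' _ => ?_)
  · exact rowStep (snd (snd id)) (fst (snd id))
  -- Every row has one entry per letter of the word, so the table state does not grow with the
  -- number of steps.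
  · have hlen : (l'.foldr TwigLearn.rowStep (TwigLearn.initRow (w x))).1.length = (w x).length := by
      clear * -
      induction l' with
      | nil => exact length_initRow _
      | cons a l ih => rw [List.foldr_cons, length_rowStep, ih]
    have h₁ := esz_list_le α (l := (l'.foldr TwigLearn.rowStep (TwigLearn.initRow (w x))).1) (M := 5)
      fun a _ => by
        have := esz_bool_le α a.2
        rw [esz_prod, esz_atom]
        omega
    have h₂ := esz_bool_le α (l'.foldr TwigLearn.rowStep (TwigLearn.initRow (w x))).2
    have h₃ := length_lt_esz α (w x)
    rw [esz_prod]
    omega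

theorem queryB {q : β → Option α × List (Axis × Option α)} {w : β → List α} (hq : PT α q)
    (hw : PT α w) : PT α (fun x => queryB (q x) (w x)) := by
  unfold TwigLearn.queryB
  refine listCases (g := fun x c w' => TwigLearn.labelB (q x).1 c && TwigLearn.stepsB (q x).2 w')
    hw false (and (labelB ?_ (fst (snd id))) (stepsB ?_ (snd (snd id))))
  · exact fst (hq.comp (fst id))
  · exact snd (hq.comp (fst id))

theorem consB {W : β → List (List α)} {q : β → Option α × List (Axis × Option α)} (hW : PT α W)
    (hq : PT α q) : PT α (fun x => consB (W x) (q x)) := by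
  unfold TwigLearn.consB
  exact all (g := fun x w => TwigLearn.queryB (q x) w) hW (queryB (hq.comp (fst id)) (snd id))

theorem eqNat {m n : β → ℕ} (hm : PT α m) (hn : PT α n) : PT α (fun x => decide (m x = n x)) := by
  refine congr (f := fun x =>
    ((List.replicate (m x) ()).drop (List.replicate (n x) ()).length).isEmpty &&
    ((List.replicate (n x) ()).drop (List.replicate (m x) ()).length).isEmpty) (fun x => ?_)
    (and (isEmpty (drop (units hm) (units hn))) (isEmpty (drop (units hn) (units hm))))
  rw [Bool.eq_iff_iff]
  simp only [Bool.and_eq_true, List.isEmpty_iff, List.drop_eq_nil_iff, List.length_replicate,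
    decide_eq_true_eq]
  omega

theorem labAt {l : β → List α} {i : β → ℕ} (hl : PT α l) (hi : PT α i) :
    PT α (fun x => labAt (l x) (i x)) := by
  refine congr (f := fun x => ((l x).drop (List.replicate (i x) ()).length).headD ⊥) (fun x => ?_)
    (headD (drop hl (units hi)) bot)
  rw [List.length_replicate, TwigLearn.labAt]

theorem zero : PT α (fun _ : β => (0 : ℕ)) := of_nil rfl

theorem parentOf {es : β → List (ℕ × ℕ)} {v : β → ℕ} (he : PT α es) (hv : PT α v) :
    PT α (fun x => parentOf (es x) (v x)) := by
  unfold TwigLearn.parentOf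
  exact fst (headD (filter (g := fun x (e : ℕ × ℕ) => decide (e.2 = v x)) he
    (eqNat (snd (snd id)) (hv.comp (fst id)))) (pair zero zero))

theorem climb {T : β → ℕ × ℕ × List α × List (ℕ × ℕ)} {st : β → ℕ × List α} (hT : PT α T)
    (hs : PT α st) : PT α (fun x => climb (T x) (st x)) := by
  unfold TwigLearn.climb
  apply_rules [PT.ite, PT.eqNat, PT.parentOf, PT.labAt, PT.cons, PT.fst, PT.snd, PT.pair]

theorem rawWord {T : β → ℕ × ℕ × List α × List (ℕ × ℕ)} (hT : PT α T) :
    PT α (fun x => rawWord (T x)) := by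
  unfold TwigLearn.rawWord
  refine snd (foldl_add (step := fun x st (_ : α) => TwigLearn.climb (T x) st) (fst (snd (snd hT)))
    ?_ (climb (hT.comp (fst id)) (fst (snd id)))
    (G := fun x => esz α (T x).2.2.2 + 10) ((snd (snd (snd hT))).pb.add (.const 10))
    fun x st _ _ => ?_)
  · apply_rules [PT.labAt, PT.listNil, PT.cons, PT.fst, PT.snd, PT.pair]
  · have := esz_parentOf_le (α := α) (T x).2.2.2 st.1
    rw [TwigLearn.climb]
    split_ifs
    · omega
    · rw [esz_prod, esz_cons, esz_atom, esz_prod α st]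
      have := one_le_esz α st.1
      simp only
      omega

theorem lexB {w w' : β → List α} (hw : PT α w) (hw' : PT α w') :
    PT α (fun x => lexB (w x) (w' x)) := by
  unfold TwigLearn.lexB
  refine snd (foldr_add (step := fun _ a (st : List α × Bool) => (st.1.tail,
    !decide (st.1.headD ⊥ ≤ a) || (decide (a = st.1.headD ⊥) && st.2))) hw
    (pair (reverse hw') true) ?_ (.const 10) fun x st a _ => ?_)
  · have h := fst (fst (snd (id (α := α) (β := β × (List α × Bool) × α))))
    exact pair (tail h) (or (not (le (headD h bot) (snd (snd id))))
      (and (eqLabel (snd (snd id)) (headD h bot)) (snd (fst (snd id)))))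
  · have h₁ := esz_le_of_sublist α (List.tail_sublist st.1)
    have h₂ := esz_bool_le α (!decide (st.1.headD ⊥ ≤ a) || (decide (a = st.1.headD ⊥) && st.2))
    rw [esz_prod, esz_prod α st]
    simp only
    omega

theorem shortB {w w' : β → List α} (hw : PT α w) (hw' : PT α w') :
    PT α (fun x => shortB (w x) (w' x)) := by
  unfold TwigLearn.shortB
  apply_rules [PT.lexB, PT.and, PT.or, PT.not, PT.isEmpty, PT.drop]

theorem minWord {W : β → List (List α)} (hW : PT α W) : PT α (fun x => minWord (W x)) := by
  unfold TwigLearn.minWord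
  refine headD (filter (g := fun x w => (W x).all fun w' => TwigLearn.shortB w w') hW ?_) listNil
  exact all (g := fun (z : β × List α) w' => TwigLearn.shortB z.2 w') (hW.comp (fst id))
    (shortB (snd (fst id)) (snd id))

theorem takeTo {l : β → List γ} {r : β → List δ} (hl : PT α l) (hr : PT α r) :
    PT α (fun x => takeTo (l x) (r x)) := by
  unfold TwigLearn.takeTo
  apply_rules [PT.reverse, PT.drop]

theorem factors {w : β → List α} (hw : PT α w) : PT α (fun x => factors (w x)) := by
  unfold TwigLearn.factors
  refine flatMap (g := fun x (t : List α) => if t.isEmpty then [] else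
    ((w x).tails.filter fun s => (t.drop s.length).isEmpty).map
      fun s => TwigLearn.takeTo s (s.drop t.length)) (tails hw) (ite (isEmpty (snd id)) listNil ?_)
  refine map (g := fun (z : β × List α) s => TwigLearn.takeTo s (s.drop z.2.length))
    (filter (g := fun (z : β × List α) s => (z.2.drop s.length).isEmpty)
      (tails (hw.comp (fst id))) ?_) ?_
  · exact isEmpty (drop (snd (fst id)) (snd id))
  · exact takeTo (snd id) (drop (snd id) (snd (fst id)))

theorem factorStepsB {u : β → List α} (hu : PT α u) : PT α (fun x => factorStepsB (u x)) := by
  unfold TwigLearn.factorStepsB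
  refine listCases (g := fun _ a u => (Axis.desc, Option.some a) ::
    u.map fun b => (Axis.child, Option.some b)) hu listNil
    (cons (pair axisDesc (some (fst (snd id)))) ?_)
  exact map (g := fun _ b => (Axis.child, Option.some b)) (snd (snd id))
    (pair axisChild (some (snd id)))

theorem insertCands {u : β → List α} {q : β → Option α × List (Axis × Option α)} (hu : PT α u)
    (hq : PT α q) : PT α (fun x => insertCands (u x) (q x)) := by
  unfold TwigLearn.insertCands
  refine map (g := fun x r => ((q x).1,
    TwigLearn.takeTo (q x).2 r ++ (TwigLearn.factorStepsB (u x) ++ r)))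
    (filter (g := fun _ (r : List (Axis × Option α)) =>
      TwigLearn.listCases r Bool.false fun s _ => s.1.isDesc) (tails (snd hq)) ?_) ?_
  · exact listCases (g := fun _ (s : Axis × Option α) _ => s.1.isDesc) (snd id) false
      (axisIsDesc (fst (fst (snd id))))
  · have h₁ := hq.comp (fst (id (β := β × List (Axis × Option α)) (α := α)))
    have h₂ := hu.comp (fst (id (β := β × List (Axis × Option α)) (α := α)))
    exact pair (fst h₁) (append (takeTo (snd h₁) (snd id)) (append (factorStepsB h₂) (snd id)))

theorem insertOnce {W : β → List (List α)} {u : β → List α}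
    {q : β → Option α × List (Axis × Option α)} (hW : PT α W) (hu : PT α u) (hq : PT α q) :
    PT α (fun x => insertOnce (W x) (u x) (q x)) := by
  unfold TwigLearn.insertOnce
  exact headD (filter (g := fun x q' => TwigLearn.consB (W x) q') (insertCands hu hq)
    (consB (hW.comp (fst id)) (snd id))) hq

theorem esz_insertOnce_le (W : List (List α)) (u : List α)
    (q : Option α × List (Axis × Option α)) :
    esz α (TwigLearn.insertOnce W u q) ≤ esz α q + esz α (TwigLearn.factorStepsB u) := by
  rw [TwigLearn.insertOnce]
  rcases h : (TwigLearn.insertCands u q).filter fun q' => TwigLearn.consB W q' with _ | ⟨q', l⟩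
  · exact Nat.le_add_right _ _
  · have : q' ∈ TwigLearn.insertCands u q := List.mem_of_mem_filter (h ▸ List.mem_cons_self)
    simp only [TwigLearn.insertCands, List.mem_map, List.mem_filter, List.mem_tails] at this
    obtain ⟨r, ⟨⟨l, hr⟩, -⟩, rfl⟩ := this
    have hl : TwigLearn.takeTo q.2 r = l := by simp [TwigLearn.takeTo, ← hr]
    simp only [List.headD_cons, hl]
    rw [esz_prod, esz_prod α q, ← hr]
    have h₁ := esz_append α l r
    have h₂ := esz_append α l (TwigLearn.factorStepsB u ++ r)
    have h₃ := esz_append α (TwigLearn.factorStepsB u) r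
    simp only
    omega

theorem insertMany {W : β → List (List α)} {v u : β → List α}
    {q : β → Option α × List (Axis × Option α)} (hW : PT α W) (hv : PT α v) (hu : PT α u)
    (hq : PT α q) : PT α (fun x => insertMany (W x) (v x) (u x) (q x)) := by
  unfold TwigLearn.insertMany
  exact foldl_add (step := fun x q (_ : α) => TwigLearn.insertOnce (W x) (u x) q) hv hq
    (insertOnce (hW.comp (fst id)) (hu.comp (fst id)) (fst (snd id)))
    (factorStepsB hu).pb fun x q _ _ => esz_insertOnce_le _ _ _

theorem esz_insertMany_le (W : List (List α)) (v u : List α)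
    (q : Option α × List (Axis × Option α)) :
    esz α (TwigLearn.insertMany W v u q) ≤ esz α q + v.length * esz α (TwigLearn.factorStepsB u) := by
  rw [TwigLearn.insertMany]
  induction v generalizing q with
  | nil => simp
  | cons a v ih =>
    have h₁ := ih (TwigLearn.insertOnce W u q)
    have h₂ := esz_insertOnce_le W u q
    rw [List.foldl_cons, List.length_cons, add_mul]
    omega

theorem stage1B {W : β → List (List α)} {v : β → List α} {us : β → List (List α)} (hW : PT α W)
    (hv : PT α v) (hus : PT α us) : PT α (fun x => stage1B (W x) (v x) (us x)) := by
  unfold TwigLearn.stage1B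
  refine foldl_add (step := fun x q u => TwigLearn.insertMany (W x) (v x) u q) hus
    (pair noneLabel (cons (pair axisDesc noneLabel) listNil))
    (insertMany (hW.comp (fst id)) (hv.comp (fst id)) (snd (snd id)) (fst (snd id)))
    -- One factor is tried `|v|` times, and each insertion adds at most `1 + 6 * |u|` to the size.
    (G := fun x => esz α (v x) * (1 + esz α (us x) * 6))
    (hv.pb.mul ((PB.const 1).add (hus.pb.mul (.const 6)))) fun x q u hu => ?_
  refine (esz_insertMany_le _ _ _ _).trans (Nat.add_le_add_left (Nat.mul_le_mul ?_ ?_) _)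
  · exact (length_lt_esz α _).le
  · refine (esz_factorStepsB_le u).trans ?_
    have h₁ := length_lt_esz α u
    have h₂ := esz_le_of_mem α hu
    omega

theorem setLastB {q : β → Option α × List (Axis × Option α)} {a : β → α} (hq : PT α q)
    (ha : PT α a) : PT α (fun x => setLastB (q x) (a x)) := by
  unfold TwigLearn.setLastB
  refine pair (fst hq) (reverse ?_)
  exact listCases (g := fun x (s : Axis × Option α) r => (s.1, Option.some (a x)) :: r)
    (reverse (snd hq)) listNil
    (cons (pair (fst (fst (snd id))) (some (ha.comp (fst id)))) (snd (snd id)))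

theorem stage2HeadB {W : β → List (List α)} {v : β → List α}
    {q : β → Option α × List (Axis × Option α)} (hW : PT α W) (hv : PT α v) (hq : PT α q) :
    PT α (fun x => stage2HeadB (W x) (v x) (q x)) := by
  have h : PT α (fun x => (Option.some ((v x).headD ⊥), (q x).2)) :=
    pair (some (headD hv bot)) (snd hq)
  exact ite (consB hW h) h hq

theorem stage2LastB {W : β → List (List α)} {v : β → List α}
    {q : β → Option α × List (Axis × Option α)} (hW : PT α W) (hv : PT α v) (hq : PT α q) :
    PT α (fun x => stage2LastB (W x) (v x) (q x)) := by
  have h : PT α (fun x => TwigLearn.setLastB (q x) ((v x).reverse.headD ⊥)) :=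
    setLastB hq (headD (reverse hv) bot)
  exact ite (consB hW h) h hq

theorem starStepsB {a : β → Axis} {t : β → List α} {b : β → Option α} (ha : PT α a) (ht : PT α t)
    (hb : PT α b) : PT α (fun x => starStepsB (a x) (t x) (b x)) := by
  unfold TwigLearn.starStepsB
  refine listCases (g := fun x _ (t : List α) => (a x, (none : Option α)) ::
    (t.map (fun _ => (Axis.child, none)) ++ [(Axis.child, b x)])) ht
    (cons (pair ha hb) listNil) (cons (pair (ha.comp (fst id)) noneLabel) (append ?_ ?_))
  · exact map (g := fun _ _ => (Axis.child, (none : Option α))) (snd (snd id))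
      (pair axisChild noneLabel)
  · exact cons (pair axisChild (hb.comp (fst id))) listNil

theorem bestStar {W : β → List (List α)} {v : β → List α} {h : β → Option α}
    {l r : β → List (Axis × Option α)} {b : β → Option α} (hW : PT α W) (hv : PT α v) (hh : PT α h)
    (hl : PT α l) (hb : PT α b) (hr : PT α r) :
    PT α (fun x => bestStar (W x) (v x) (h x) (l x) (b x) (r x)) := by
  unfold TwigLearn.bestStar
  refine headD (filter (g := fun x t => TwigLearn.consB (W x)
    (h x, l x ++ (TwigLearn.starStepsB Axis.desc t (b x) ++ r x))) (tails hv) ?_) listNil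
  exact consB (hW.comp (fst id)) (pair (hh.comp (fst id)) (append (hl.comp (fst id))
    (append (starStepsB axisDesc (snd id) (hb.comp (fst id))) (hr.comp (fst id)))))

theorem length_bestStar_le (W : List (List α)) (v : List α) (h : Option α)
    (l : List (Axis × Option α)) (b : Option α) (r : List (Axis × Option α)) :
    (TwigLearn.bestStar W v h l b r).length ≤ v.length := by
  rw [TwigLearn.bestStar]
  rcases hf : v.tails.filter fun t => TwigLearn.consB W
    (h, l ++ (TwigLearn.starStepsB Axis.desc t b ++ r)) with _ | ⟨t, l⟩
  · simp
  · have : t ∈ v.tails := List.mem_of_mem_filter (hf ▸ List.mem_cons_self)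
    exact ((List.mem_tails _ _).1 this).length_le

theorem resolveB {W : β → List (List α)} {v : β → List α} {h : β → Option α}
    {st : β → List (Axis × Option α) × List (Axis × Option α)} {s : β → Axis × Option α}
    (hW : PT α W) (hv : PT α v) (hh : PT α h) (hst : PT α st) (hs : PT α s) :
    PT α (fun x => resolveB (W x) (v x) (h x) (st x) (s x)) := by
  unfold TwigLearn.resolveB
  have h₁ := bestStar hW hv hh (fst hst) (snd hs) (tail (snd hst))
  have h₂ := starStepsB axisChild h₁ (snd hs)
  exact pair (ite (and (axisIsDesc (fst hs)) (consB hW (pair hh (append (fst hst)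
    (append h₂ (tail (snd hst))))))) (append (fst hst) h₂) (append (fst hst) (cons hs listNil)))
    (tail (snd hst))

theorem esz_resolveB_le (W : List (List α)) (v : List α) (h : Option α)
    (st : List (Axis × Option α) × List (Axis × Option α)) (s : Axis × Option α) :
    esz α (TwigLearn.resolveB W v h st s) ≤ esz α st + (10 + v.length * 6) := by
  have h₁ := esz_starStepsB_le Axis.child (TwigLearn.bestStar W v h st.1 s.2 st.2.tail) s.2
  have h₂ := length_bestStar_le W v h st.1 s.2 st.2.tail
  have h₃ := esz_append α st.1
    (TwigLearn.starStepsB Axis.child (TwigLearn.bestStar W v h st.1 s.2 st.2.tail) s.2)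
  have h₄ := esz_append α st.1 [s]
  have h₅ := esz_step_le s
  have h₆ := esz_le_of_sublist α (List.tail_sublist st.2)
  rw [esz_cons, esz_nil] at h₄
  rw [TwigLearn.resolveB, esz_prod, esz_prod α st]
  split_ifs
  · simp only
    omega
  · simp only
    omega

theorem stage3B {W : β → List (List α)} {v : β → List α}
    {q : β → Option α × List (Axis × Option α)} (hW : PT α W) (hv : PT α v) (hq : PT α q) :
    PT α (fun x => stage3B (W x) (v x) (q x)) := by
  unfold TwigLearn.stage3B
  refine pair (fst hq) (fst (foldl_add (step := fun x => TwigLearn.resolveB (W x) (v x) (q x).1)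
    (snd hq) (pair listNil (snd hq)) ?_ (G := fun x => 10 + esz α (v x) * 6)
    ((PB.const 10).add (hv.pb.mul (.const 6))) fun x st s _ => ?_))
  · exact resolveB (hW.comp (fst id)) (hv.comp (fst id)) (fst (hq.comp (fst id))) (fst (snd id))
      (snd (snd id))
  · have h₁ := esz_resolveB_le (W x) (v x) (q x).1 st s
    have h₂ := length_lt_esz α (v x)
    omega

theorem learnWords {W : β → List (List α)} (hW : PT α W) : PT α (fun x => learnWords (W x)) := by
  have hv := minWord hW
  exact stage3B hW hv (stage2LastB hW hv (stage2HeadB hW hv (stage1B hW hv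
    (factors (reverse (tail (reverse (tail hv))))))))

theorem learnTrees {Ts : β → List (ℕ × ℕ × List α × List (ℕ × ℕ))} (hT : PT α Ts) :
    PT α (fun x => learnTrees (Ts x)) :=
  pair true (learnWords (map (g := fun _ T => TwigLearn.rawWord T) hT (rawWord (snd id))))

end PT

end TwigLearn

namespace TwigLearn

universe u

section correct

variable {α : Type u}

/-! ### Correctness of the implementation -/

theorem stepsMatch_cons_nil (x : Axis) (b : Option α) (s : List (Axis × Option α)) :
    ¬ StepsMatch ((x, b) :: s) [] := by
  rintro ⟨g, c, w', h, -⟩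
  simp at h

/-- The recurrence behind the table: the first letter is either taken by the first step or skipped
by its descendant edge. -/
theorem stepsMatch_cons_cons (x : Axis) (b : Option α) (s : List (Axis × Option α)) (c : α)
    (w : List α) : StepsMatch ((x, b) :: s) (c :: w) ↔
      (LabelOK b c ∧ StepsMatch s w) ∨ (x = Axis.desc ∧ StepsMatch ((x, b) :: s) w) := by
  constructor
  · rintro ⟨g, d, w', h, hx, hb, hs⟩
    cases g with
    | nil =>
      simp only [List.nil_append, List.cons.injEq] at h
      obtain ⟨rfl, rfl⟩ := h
      exact Or.inl ⟨hb, hs⟩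
    | cons e g =>
      simp only [List.cons_append, List.cons.injEq] at h
      obtain ⟨rfl, rfl⟩ := h
      refine Or.inr ⟨?_, g, d, w', rfl, fun h => ?_, hb, hs⟩
      · cases x with
        | child => simp at hx
        | desc => rfl
      · simp [h] at hx
  · rintro (⟨hb, hs⟩ | ⟨rfl, g, d, w', rfl, -, hb, hs⟩)
    · exact ⟨[], c, w, rfl, fun _ => rfl, hb, hs⟩
    · exact ⟨c :: g, d, w', rfl, by simp, hb, hs⟩

/-- The table row that belongs to a predicate on suffixes. -/
def rowOf (P : List α → Bool) : List α → List (α × Bool)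
  | [] => []
  | c :: w => (c, P w) :: rowOf P w

theorem starSteps_child_eq (b : Option α) : ∀ k : ℕ, starSteps Axis.child k b =
    List.replicate k (Axis.child, none) ++ [(Axis.child, b)]
  | 0 => rfl
  | k + 1 => by rw [starSteps, starSteps_child_eq b k, List.replicate_succ, List.cons_append]

theorem starStepsB_eq (x : Axis) (t : List α) (b : Option α) :
    starStepsB x t b = starSteps x t.length b := by
  cases t with
  | nil => rfl
  | cons a t => simp [starStepsB, listCases, starSteps, starSteps_child_eq]

theorem factorStepsB_eq (u : List α) : factorStepsB u = factorSteps u := by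
  cases u <;> rfl

theorem takeTo_append {γ : Type*} (l r : List γ) : takeTo (l ++ r) r = l := by simp [takeTo]

theorem takeTo_drop {γ : Type*} (s : List γ) (n : ℕ) : takeTo s (s.drop n) = s.take n := by
  have := takeTo_append (s.take n) (s.drop n)
  rwa [List.take_append_drop] at this

theorem mem_factors {w u : List α} : u ∈ factors w ↔ u ≠ [] ∧ u <:+: w := by
  simp only [factors, List.mem_flatMap, List.mem_tails]
  constructor
  · rintro ⟨t, ht, hu⟩
    split_ifs at hu with he
    · simp at hu
    · simp only [List.mem_map, List.mem_filter, List.mem_tails, List.isEmpty_iff,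
        List.drop_eq_nil_iff] at hu he
      obtain ⟨s, ⟨hs, hlen⟩, rfl⟩ := hu
      rw [takeTo_drop]
      refine ⟨?_, (List.take_prefix _ _).isInfix.trans hs.isInfix⟩
      intro h
      have h₁ := congrArg List.length h
      have h₂ := List.length_pos_iff.2 he
      rw [List.length_take, List.length_nil] at h₁
      omega
  · rintro ⟨hu, l, r, rfl⟩
    -- In `factors` the outer suffix serves only to fix a length; here it is the suffix as long as
    -- `u`. The factor itself is a prefix of the inner suffix `u ++ r`.
    refine ⟨(l ++ u ++ r).drop ((l ++ u ++ r).length - u.length), List.drop_suffix _ _, ?_⟩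
    have hlen : ((l ++ u ++ r).drop ((l ++ u ++ r).length - u.length)).length = u.length := by
      simp
      omega
    rw [if_neg]
    · simp only [List.mem_map, List.mem_filter, List.mem_tails, List.isEmpty_iff,
        List.drop_eq_nil_iff, hlen]
      refine ⟨u ++ r, ⟨⟨l, by simp⟩, by simp⟩, ?_⟩
      simp [takeTo]
    · rw [List.isEmpty_iff]
      intro h
      rw [h] at hlen
      exact hu (List.eq_nil_of_length_eq_zero hlen.symm)

theorem pairwise_tails (w : List α) : w.tails.Pairwise fun u v => v.length ≤ u.length := by
  induction w with
  | nil => simp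
  | cons a w ih =>
    rw [List.tails_cons, List.pairwise_cons]
    refine ⟨fun t ht => ?_, ih⟩
    have := ((List.mem_tails _ _).1 ht).length_le
    rw [List.length_cons]
    omega

theorem pairwise_factors (w : List α) : (factors w).Pairwise fun u v => v.length ≤ u.length := by
  have key : ∀ t u : List α, u ∈ (if t.isEmpty then [] else
      (w.tails.filter fun s => (t.drop s.length).isEmpty).map fun s => takeTo s (s.drop t.length)) →
      u.length = t.length := by
    intro t u hu
    split_ifs at hu with he
    · simp at hu
    · simp only [List.mem_map, List.mem_filter, List.mem_tails, List.isEmpty_iff,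
        List.drop_eq_nil_iff] at hu
      obtain ⟨s, ⟨hs, hlen⟩, rfl⟩ := hu
      simp [takeTo]
      omega
  rw [factors, List.pairwise_flatMap]
  refine ⟨fun t _ => ?_, ?_⟩
  · refine List.pairwise_of_forall_mem_list fun u hu v hv => ?_
    rw [key t u hu, key t v hv]
  · refine (pairwise_tails w).imp fun {t t'} h u hu v hv => ?_
    rw [key t u hu, key t' v hv]
    exact h

theorem mem_insertCands {u : List α} {q q' : Option α × List (Axis × Option α)} :
    q' ∈ insertCands u q ↔ ∃ l b r, q.2 = l ++ (Axis.desc, b) :: r ∧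
      q' = (q.1, l ++ factorSteps u ++ (Axis.desc, b) :: r) := by
  simp only [insertCands, List.mem_map, List.mem_filter, List.mem_tails, factorStepsB_eq]
  constructor
  · rintro ⟨r, ⟨⟨l, hl⟩, hr⟩, rfl⟩
    match r, hl, hr with
    | (Axis.desc, b) :: r, hl, _ =>
      refine ⟨l, b, r, hl.symm, ?_⟩
      rw [← hl, takeTo_append]
      simp
  · rintro ⟨l, b, r, hl, rfl⟩
    refine ⟨(Axis.desc, b) :: r, ⟨⟨l, hl.symm⟩, rfl⟩, ?_⟩
    rw [hl, takeTo_append]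
    simp

theorem InsertStep.length_lt {S : Finset (DTree α)} {u : List α} (hu : u ≠ []) {p p' : PathQuery α}
    (h : InsertStep S u p p') : p.steps.length < p'.steps.length := by
  obtain ⟨l, b, r, h₁, rfl, -⟩ := h
  cases u with
  | nil => exact absurd rfl hu
  | cons a u =>
    simp [h₁, factorSteps]

/-- This bounds both the number of insertions in stage 1 and the number of wildcards in stage 3 by
the length of any word of the sample. -/
theorem PathQuery.Consistent.length_lt {S : Finset (DTree α)} {p : PathQuery α} (hp : p.Consistent S) {w : List α}
    (hw : w ∈ selPaths S) : p.steps.length < w.length := by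
  obtain ⟨c, w', rfl, -, h⟩ := consistent_iff.1 hp w hw
  exact Nat.lt_succ_of_le h.length_le

theorem setLastB_eq (q : Option α × List (Axis × Option α)) (a : α) :
    (⟨(setLastB q a).1, (setLastB q a).2⟩ : PathQuery α) = setLast ⟨q.1, q.2⟩ a := by
  obtain ⟨h, s⟩ := q
  rcases List.eq_nil_or_concat s with rfl | ⟨l, ⟨x, b⟩, rfl⟩
  · rfl
  · rw [setLast]
    simp only [List.concat_eq_append, modifyLast_steps]
    simp [setLastB, listCases]

theorem length_starSteps (b : Option α) : ∀ (k : ℕ) (x : Axis), (starSteps x k b).length = k + 1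
  | 0, _ => rfl
  | k + 1, x => by rw [starSteps, List.length_cons, length_starSteps b k]

variable [LinearOrder α] [OrderBot α]

theorem labelB_iff (b : Option α) (c : α) : labelB b c = true ↔ LabelOK b c := by
  cases b <;> simp [labelB]

open Classical in
theorem foldr_rowStep (w : List α) : ∀ s : List (Axis × Option α),
    s.foldr rowStep (initRow w) =
      (rowOf (fun v => decide (StepsMatch s v)) w, decide (StepsMatch s w))
  | [] => by
    rw [List.foldr_nil, initRow]
    induction w with
    | nil => simp [rowOf, StepsMatch]
    | cons c w ih => simp [rowOf, ih, StepsMatch]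
  | (x, b) :: s => by
    rw [List.foldr_cons, foldr_rowStep w s, rowStep]
    simp only
    induction w with
    | nil => simp [rowOf, stepsMatch_cons_nil]
    | cons c w ih =>
      rw [rowOf, List.foldr_cons, ih, rowCell, rowOf]
      refine Prod.ext rfl ?_
      rw [Bool.eq_iff_iff]
      simp only [decide_eq_true_eq, stepsMatch_cons_cons, Bool.or_eq_true,
        Bool.and_eq_true, labelB_iff]
      refine or_congr Iff.rfl (and_congr_left fun _ => ?_)
      cases x <;> simp [Axis.isDesc]

theorem stepsB_iff (s : List (Axis × Option α)) (w : List α) :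
    stepsB s w = true ↔ StepsMatch s w := by
  rw [stepsB, foldr_rowStep]
  simp

theorem queryB_iff (h : Option α) (s : List (Axis × Option α)) (w : List α) :
    queryB (h, s) w = true ↔ QueryMatch ⟨h, s⟩ w := by
  cases w with
  | nil => simp [queryB, listCases, QueryMatch]
  | cons c w => simp [queryB, listCases, QueryMatch, labelB_iff, stepsB_iff]

theorem consB_iff {S : Finset (DTree α)} {W : List (List α)} (hW : ∀ w, w ∈ W ↔ w ∈ selPaths S)
    (q : Option α × List (Axis × Option α)) :
    consB W q = true ↔ PathQuery.Consistent S ⟨q.1, q.2⟩ := by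
  obtain ⟨h, s⟩ := q
  simp [consB, consistent_iff, queryB_iff, hW]

/-- The fold reads `w` from its last letter, while the reversed `w'` is consumed from the front, so
the letters meet in step. The rest `r` makes the induction possible. -/
theorem foldr_lexB : ∀ (w w' r : List α), w.length = w'.length →
    ∃ b : Bool, (w.foldr (fun a (st : List α × Bool) => (st.1.tail,
      !decide (st.1.headD ⊥ ≤ a) || (decide (a = st.1.headD ⊥) && st.2))) (w'.reverse ++ r, true)) =
      (r, b) ∧ (b = true ↔ w = w' ∨ List.Lex (· < ·) w w')
  | [], w', r, h => by
    have : w' = [] := List.eq_nil_of_length_eq_zero h.symm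
    subst this
    exact ⟨true, rfl, by simp⟩
  | a :: w, [], r, h => by simp at h
  | a :: w, a' :: w', r, h => by
    obtain ⟨b, h₁, h₂⟩ := foldr_lexB w w' (a' :: r) (by simpa using h)
    refine ⟨!decide (a' ≤ a) || (decide (a = a') && b), ?_, ?_⟩
    · rw [List.foldr_cons, List.reverse_cons, List.append_assoc, List.singleton_append, h₁]
      rfl
    · rw [List.cons_lex_cons_iff]
      simp only [Bool.or_eq_true, Bool.not_eq_true', decide_eq_false_iff_not, not_le,
        Bool.and_eq_true, decide_eq_true_eq, h₂, List.cons.injEq]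
      tauto

theorem shortB_iff (w w' : List α) : shortB w w' = true ↔ CanLE w w' := by
  rw [CanLE, List.shortlex_def]
  simp only [shortB, Bool.and_eq_true, List.isEmpty_iff, List.drop_eq_nil_iff, Bool.or_eq_true,
    Bool.not_eq_true', List.isEmpty_eq_false_iff, ne_eq, not_le]
  by_cases h : w.length = w'.length
  · obtain ⟨b, h₁, h₂⟩ := foldr_lexB w w' [] h
    have : lexB w w' = b := by
      rw [lexB]
      simpa using congrArg Prod.snd h₁
    simp only [this, h₂, h, lt_irrefl, le_refl, true_and, false_or]
  · have h₁ : w ≠ w' := fun h' => h (congrArg _ h')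
    simp only [h, h₁, false_and, or_false, false_or]
    omega

theorem minWord_spec {W : List (List α)} (hW : W ≠ []) :
    minWord W ∈ W ∧ ∀ w ∈ W, CanLE (minWord W) w := by
  classical
  -- The canonical order is the lexicographic order on pairs of length and word, so a minimum exists
  -- in a finite set.
  obtain ⟨m, hm, hmin⟩ := Finset.exists_min_image W.toFinset
    (fun w => (toLex (w.length, w) : ℕ ×ₗ List α)) (by simpa using hW)
  have hmem : m ∈ W.filter fun w => W.all fun w' => shortB w w' := by
    simp only [List.mem_filter, List.all_eq_true, shortB_iff]
    refine ⟨by simpa using hm, fun w hw => ?_⟩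
    rcases (hmin w (by simpa using hw)).eq_or_lt with h | h
    · left
      exact congrArg (fun x => (ofLex x).2) h
    · right
      rw [List.shortlex_def]
      rw [Prod.Lex.toLex_lt_toLex] at h
      exact h
  rw [minWord]
  rcases hf : W.filter fun w => W.all fun w' => shortB w w' with _ | ⟨w, l⟩
  · rw [hf] at hmem
    simp at hmem
  · have : w ∈ W.filter fun w => W.all fun w' => shortB w w' := by
      rw [hf]
      simp
    simp only [List.mem_filter, List.all_eq_true, shortB_iff] at this
    exact this

/-! ### The stages -/

variable {S : Finset (DTree α)} {W : List (List α)}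

theorem insertStep_iff (hW : ∀ w, w ∈ W ↔ w ∈ selPaths S) {u : List α}
    {q q' : Option α × List (Axis × Option α)} :
    InsertStep S u ⟨q.1, q.2⟩ ⟨q'.1, q'.2⟩ ↔ q' ∈ (insertCands u q).filter fun q => consB W q := by
  obtain ⟨h', s'⟩ := q'
  simp only [List.mem_filter, consB_iff hW, mem_insertCands, InsertStep, PathQuery.mk.injEq,
    Prod.mk.injEq]
  constructor
  · rintro ⟨l, b, r, h₁, h₂, h₃⟩
    exact ⟨⟨l, b, r, h₁, h₂⟩, h₃⟩
  · rintro ⟨⟨l, b, r, h₁, h₂⟩, h₃⟩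
    exact ⟨l, b, r, h₁, h₂, h₃⟩

theorem insertOnce_spec (hW : ∀ w, w ∈ W ↔ w ∈ selPaths S) (u : List α)
    (q : Option α × List (Axis × Option α)) :
    (insertOnce W u q = q ∧ ∀ p, ¬ InsertStep S u ⟨q.1, q.2⟩ p) ∨
      InsertStep S u ⟨q.1, q.2⟩ ⟨(insertOnce W u q).1, (insertOnce W u q).2⟩ := by
  rw [insertOnce]
  rcases hf : (insertCands u q).filter fun q => consB W q with _ | ⟨q', l⟩
  · refine Or.inl ⟨rfl, fun p hp => ?_⟩
    have := (insertStep_iff hW (q' := (p.head, p.steps))).1 hp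
    rw [hf] at this
    simp at this
  · refine Or.inr ((insertStep_iff hW).2 ?_)
    rw [hf]
    simp

/-- Each round either finds no insertion, and then nothing changes any more, or lengthens the query.
If all `|v|` rounds succeed, the query becomes at least `|v|` steps longer, which consistency with
`v` rules out. -/
theorem insertMany_spec (hW : ∀ w, w ∈ W ↔ w ∈ selPaths S) {u : List α} (hu : u ≠ []) :
    ∀ (v : List α) (q : Option α × List (Axis × Option α)),
    Relation.ReflTransGen (InsertStep S u) ⟨q.1, q.2⟩
      ⟨(insertMany W v u q).1, (insertMany W v u q).2⟩ ∧
    ((∀ p, ¬ InsertStep S u ⟨(insertMany W v u q).1, (insertMany W v u q).2⟩ p) ∨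
      q.2.length + v.length ≤ (insertMany W v u q).2.length)
  | [], q => ⟨.refl, Or.inr (by simp [insertMany])⟩
  | a :: v, q => by
    obtain ⟨h₁, h₂⟩ := insertMany_spec hW hu v (insertOnce W u q)
    change Relation.ReflTransGen (InsertStep S u) ⟨q.1, q.2⟩
      ⟨(insertMany W v u (insertOnce W u q)).1, (insertMany W v u (insertOnce W u q)).2⟩ ∧
      ((∀ p, ¬ InsertStep S u ⟨(insertMany W v u (insertOnce W u q)).1,
        (insertMany W v u (insertOnce W u q)).2⟩ p) ∨
      q.2.length + (a :: v).length ≤ (insertMany W v u (insertOnce W u q)).2.length)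
    rcases insertOnce_spec hW u q with ⟨h, hno⟩ | h
    · rw [h] at h₁ h₂ ⊢
      refine ⟨h₁, Or.inl ?_⟩
      rcases h₁.cases_head with h₃ | ⟨p, h₃, -⟩
      · rw [← h₃]
        exact hno
      · exact absurd h₃ (hno p)
    · refine ⟨h₁.head h, h₂.imp id fun h₃ => ?_⟩
      have := h.length_lt hu
      simp only [List.length_cons] at *
      omega

theorem insertMany_insertAll (hW : ∀ w, w ∈ W ↔ w ∈ selPaths S) {u v : List α} (hu : u ≠ [])
    (hv : v ∈ W) {q : Option α × List (Axis × Option α)}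
    (hq : PathQuery.Consistent S ⟨q.1, q.2⟩) :
    InsertAll S u ⟨q.1, q.2⟩ ⟨(insertMany W v u q).1, (insertMany W v u q).2⟩ ∧
      PathQuery.Consistent S ⟨(insertMany W v u q).1, (insertMany W v u q).2⟩ := by
  obtain ⟨h₁, h₂⟩ := insertMany_spec hW hu v q
  have hc : PathQuery.Consistent S ⟨(insertMany W v u q).1, (insertMany W v u q).2⟩ := by
    rcases h₁.cases_tail with h | ⟨p, -, l, b, r, -, -, h⟩
    · rw [h]
      exact hq
    · exact h
  refine ⟨⟨h₁, h₂.resolve_right fun h => ?_⟩, hc⟩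
  have := hc.length_lt ((hW v).1 hv)
  simp only at this
  omega

theorem stage1_foldl (hW : ∀ w, w ∈ W ↔ w ∈ selPaths S) {v : List α} (hv : v ∈ W) :
    ∀ (us : List (List α)) (q : Option α × List (Axis × Option α)), (∀ u ∈ us, u ≠ []) →
    PathQuery.Consistent S ⟨q.1, q.2⟩ →
    Stage1 S us ⟨q.1, q.2⟩ ⟨(us.foldl (fun q u => insertMany W v u q) q).1,
      (us.foldl (fun q u => insertMany W v u q) q).2⟩
  | [], q, _, _ => rfl
  | u :: us, q, hu, hq => by
    obtain ⟨h₁, h₂⟩ := insertMany_insertAll hW (hu u (by simp)) hv hq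
    exact ⟨_, h₁, stage1_foldl hW hv us _ (fun u h => hu u (by simp [h])) h₂⟩

open Classical in
theorem stage2_eq (hW : ∀ w, w ∈ W ↔ w ∈ selPaths S) (v : List α)
    (q : Option α × List (Axis × Option α)) :
    (⟨(stage2LastB W v (stage2HeadB W v q)).1, (stage2LastB W v (stage2HeadB W v q)).2⟩ :
      PathQuery α) = stage2 S (v.headD ⊥) (v.reverse.headD ⊥) ⟨q.1, q.2⟩ := by
  have hhead : (⟨(stage2HeadB W v q).1, (stage2HeadB W v q).2⟩ : PathQuery α) =
      if (setHead ⟨q.1, q.2⟩ (v.headD ⊥)).Consistent S then setHead ⟨q.1, q.2⟩ (v.headD ⊥)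
      else ⟨q.1, q.2⟩ := by
    rw [stage2HeadB]
    by_cases h : consB W (some (v.headD ⊥), q.2) = true
    · rw [if_pos h, if_pos]
      · rfl
      · exact (consB_iff hW _).1 h
    · rw [if_neg h, if_neg]
      exact fun h' => h ((consB_iff hW _).2 h')
  rw [stage2]
  simp only [← hhead, ← setLastB_eq]
  rw [stage2LastB]
  by_cases h : consB W (setLastB (stage2HeadB W v q) (v.reverse.headD ⊥)) = true
  · rw [if_pos h, if_pos]
    exact (consB_iff hW _).1 h
  · rw [if_neg h, if_neg]
    exact fun h' => h ((consB_iff hW _).2 h')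

/-- The tails come by decreasing length, so the first success is the greatest. Zero wildcards
succeed by assumption, and a consistent number of wildcards is less than `|v|`, so some tail
represents it. -/
theorem bestStar_spec (hW : ∀ w, w ∈ W ↔ w ∈ selPaths S) {v : List α} (hv : v ∈ W)
    {h b : Option α} {l r : List (Axis × Option α)}
    (hc : PathQuery.Consistent S ⟨h, l ++ (Axis.desc, b) :: r⟩) :
    IsGreatest {j | PathQuery.Consistent S ⟨h, l ++ starSteps Axis.desc j b ++ r⟩}
      (bestStar W v h l b r).length := by
  have hmem : ∀ t : List α, t ∈ (v.tails.filter fun t =>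
      consB W (h, l ++ (starStepsB Axis.desc t b ++ r))) ↔
      t <:+ v ∧ PathQuery.Consistent S ⟨h, l ++ starSteps Axis.desc t.length b ++ r⟩ := by
    intro t
    simp only [List.mem_filter, List.mem_tails, consB_iff hW, starStepsB_eq, List.append_assoc]
  have hsort := (pairwise_tails v).filter fun t =>
    consB W (h, l ++ (starStepsB Axis.desc t b ++ r))
  rw [bestStar]
  rcases hf : v.tails.filter fun t => consB W (h, l ++ (starStepsB Axis.desc t b ++ r)) with
    _ | ⟨t, ts⟩
  · have := (hmem []).2 ⟨List.nil_suffix, by simpa [starSteps] using hc⟩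
    rw [hf] at this
    simp at this
  · rw [hf, List.pairwise_cons] at hsort
    rw [hf] at hmem
    refine ⟨((hmem t).1 (by simp)).2, fun j hj => ?_⟩
    have hlen := hj.length_lt ((hW v).1 hv)
    simp only [List.length_append, length_starSteps] at hlen
    have hdrop : (v.drop (v.length - j)).length = j := by
      rw [List.length_drop]
      omega
    have := (hmem (v.drop (v.length - j))).2 ⟨List.drop_suffix _ _, by rw [hdrop]; exact hj⟩
    rw [List.headD_cons, ← hdrop]
    rcases List.mem_cons.1 this with h | h
    · rw [h]
    · exact hsort.1 _ h

/-- The run treats the edges from left to right: `d` is the finished part and `s` the rest, whose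
descendant edges are still marked. -/
theorem stage3_foldl (hW : ∀ w, w ∈ W ↔ w ∈ selPaths S) {v : List α} (hv : v ∈ W) {h : Option α} :
    ∀ (s d : List (Axis × Option α)), PathQuery.Consistent S ⟨h, d ++ s⟩ →
    Relation.ReflTransGen (ResolveStep S h) (d.map (Prod.mk false) ++ s.map markStep)
      ((s.foldl (resolveB W v h) (d, s)).1.map (Prod.mk false))
  | [], d, _ => by
    simp only [List.map_nil, List.append_nil, List.foldl_nil]
    exact .refl
  | (Axis.child, b) :: s, d, hc => by
    have := stage3_foldl hW hv s (d ++ [(Axis.child, b)]) (by simpa using hc)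
    simpa [resolveB, Axis.isDesc, markStep] using this
  | (Axis.desc, b) :: s, d, hc => by
    have hbest := bestStar_spec hW hv hc
    have hd : (d.map (Prod.mk false)).map Prod.snd = d := by simp [Function.comp_def]
    rw [List.foldl_cons, resolveB]
    simp only [Axis.isDesc, Bool.true_and, List.tail_cons]
    have hiff := consB_iff hW (h, d ++ (starStepsB Axis.child (bestStar W v h d b s) b ++ s))
    by_cases hk : consB W (h, d ++ (starStepsB Axis.child (bestStar W v h d b s) b ++ s)) = true
    · rw [if_pos hk, starStepsB_eq]
      rw [hiff, starStepsB_eq] at hk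
      refine .head ?_ (stage3_foldl hW hv s _ (by simpa using hk))
      refine ⟨d.map (Prod.mk false), b, s.map markStep, (bestStar W v h d b s).length, rfl, ?_,
        Or.inl ⟨?_, by simp⟩⟩
      · simpa only [hd, map_snd_map_markStep] using hbest
      · simpa only [hd, map_snd_map_markStep, List.append_assoc] using hk
    · rw [if_neg hk]
      rw [hiff, starStepsB_eq] at hk
      refine .head ?_ (stage3_foldl hW hv s _ (by simpa using hc))
      refine ⟨d.map (Prod.mk false), b, s.map markStep, (bestStar W v h d b s).length, rfl, ?_,
        Or.inr ⟨?_, by simp⟩⟩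
      · simpa only [hd, map_snd_map_markStep] using hbest
      · simpa only [hd, map_snd_map_markStep, List.append_assoc] using hk

theorem learnWords_spec (hW : ∀ w, w ∈ W ↔ w ∈ selPaths S) (hne : W ≠ []) :
    LearnerAnchPath S ⟨(learnWords W).1, (learnWords W).2⟩ := by
  obtain ⟨hm, hmin⟩ := minWord_spec hne
  obtain ⟨a₀, inner, aₙ, hw⟩ : ∃ a₀ inner aₙ, minWord W = a₀ :: (inner ++ [aₙ]) := by
    obtain ⟨t, -, ht⟩ := mem_selPaths.1 ((hW _).1 hm)
    have hlen := two_le_length_selWord t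
    rw [← ht] at hlen
    rcases hw : minWord W with _ | ⟨a, w⟩
    · simp [hw] at hlen
    · rcases List.eq_nil_or_concat w with rfl | ⟨l, b, rfl⟩
      · simp [hw] at hlen
      · exact ⟨a, l, b, by simp⟩
  have hinner : (minWord W).tail.reverse.tail.reverse = inner := by simp [hw]
  have h₀ : (minWord W).headD ⊥ = a₀ := by simp [hw]
  have hₙ : (minWord W).reverse.headD ⊥ = aₙ := by simp [hw]
  set q₁ := stage1B W (minWord W) (factors inner) with hq₁
  set q₂ := stage2LastB W (minWord W) (stage2HeadB W (minWord W) q₁) with hq₂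
  have hst₁ : Stage1 S (factors inner) (universalQuery α) ⟨q₁.1, q₁.2⟩ :=
    stage1_foldl hW hm (factors inner) (none, [(Axis.desc, none)])
      (fun u hu => (mem_factors.1 hu).1) (universalQuery_consistent S)
  have hst₂ : (⟨q₂.1, q₂.2⟩ : PathQuery α) = stage2 S a₀ aₙ ⟨q₁.1, q₁.2⟩ := by
    rw [hq₂, stage2_eq hW, h₀, hₙ]
  refine ⟨a₀, aₙ, inner, factors inner, ⟨q₁.1, q₁.2⟩, ?_, ?_, fun u => mem_factors,
    pairwise_factors inner, hst₁, ?_⟩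
  · rw [← hw]
    exact (hW _).1 hm
  · rw [← hw]
    exact fun w h => hmin w ((hW w).2 h)
  · rw [← hst₂]
    have hc : PathQuery.Consistent S ⟨q₂.1, q₂.2⟩ := by
      rw [hst₂]
      exact (stage2_isAnchored (hst₁.isAnchored
        ⟨universalQuery_isAnchored, universalQuery_consistent S⟩)).2
    have hlearn : learnWords W = stage3B W (minWord W) q₂ := by
      rw [learnWords, hinner]
    rw [hlearn]
    refine ⟨_, stage3_foldl hW hm q₂.2 [] hc, ?_, ?_⟩
    · simp
    · simp [stage3B, Function.comp_def]

end correct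

/-! ### Reading the selecting word off the representation of a tree -/

section raw

variable {α : Type u}

/-- The components of the representation of a tree. -/
noncomputable def rawTree (t : DTree α) : ℕ × ℕ × List α × List (ℕ × ℕ) :=
  (t.root, t.sel, (List.finRange t.n).map t.lab, t.edges.map fun e => ((e.1 : ℕ), (e.2 : ℕ)))

theorem enc_rawTree (t : DTree α) : (Enc.enc (rawTree t) : Data α) = encodeTree t := by
  simp only [rawTree, encodeTree, Enc.enc, List.map_map]
  rfl

theorem LTree.path_length_le (t : LTree α) {vs : List (Fin t.n)} (h : vs.IsChain t.child) :
    vs.length ≤ t.n := by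
  have h₁ : vs.IsChain (Relation.TransGen t.child) := h.imp fun _ _ => Relation.TransGen.single
  have : IsTrans (Fin t.n) (Relation.TransGen t.child) := ⟨fun _ _ _ => Relation.TransGen.trans⟩
  rw [List.isChain_iff_pairwise] at h₁
  have h₂ : vs.Nodup := h₁.imp fun {a b} hab (heq : a = b) => t.acyclic a (by rwa [← heq] at hab)
  simpa using h₂.length_le_card

theorem LTree.mem_edges (t : LTree α) (u v : Fin t.n) : (u, v) ∈ t.edges ↔ t.child u v := by
  simp [LTree.edges, List.product]

/-- All listed edges into `v` start at its unique predecessor, so the first one found gives the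
parent. -/
theorem parentOf_edges (t : DTree α) {u v : Fin t.n} (h : t.child u v) :
    parentOf (rawTree t).2.2.2 v = u := by
  have hmem : ∀ e : ℕ × ℕ, e ∈ ((rawTree t).2.2.2.filter fun e => decide (e.2 = (v : ℕ))) →
      e.1 = u := by
    intro e he
    simp only [rawTree, List.mem_filter, List.mem_map, decide_eq_true_eq] at he
    obtain ⟨⟨⟨x, y⟩, hxy, rfl⟩, hv⟩ := he
    rw [LTree.mem_edges] at hxy
    have hy : y = v := Fin.ext hv
    subst hy
    rw [t.eq_of_child hxy h]
  rw [parentOf]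
  generalize hf : (rawTree t).2.2.2.filter (fun e => decide (e.2 = (v : ℕ))) = l at *
  cases l with
  | nil =>
    have : ((u : ℕ), (v : ℕ)) ∈ (rawTree t).2.2.2.filter fun e => decide (e.2 = (v : ℕ)) := by
      simp only [rawTree, List.mem_filter, List.mem_map, decide_eq_true_eq, and_true]
      exact ⟨(u, v), (t.mem_edges u v).2 h, rfl⟩
    rw [hf] at this
    simp at this
  | cons e l => exact hmem e (by simp)

variable [LinearOrder α] [OrderBot α]

theorem labAt_finRange (t : DTree α) (v : Fin t.n) : labAt (rawTree t).2.2.1 v = t.lab v := by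
  have h : (v : ℕ) < ((List.finRange t.n).map t.lab).length := by simp
  rw [labAt, rawTree, List.drop_eq_getElem_cons h]
  simp

/-- The list `L` is only a clock. Rounds left after the root has been reached change nothing, and as
an acyclic path visits a node at most once, one round per node is enough. -/
theorem foldl_climb (t : DTree α) : ∀ (L : List α) (pre : List (Fin t.n)) (v : Fin t.n)
    (acc : List α), (pre ++ [v]).head? = some t.root → (pre ++ [v]).IsChain t.child →
    pre.length ≤ L.length →
    (L.foldl (fun st _ => climb (rawTree t) st) ((v : ℕ), acc)).2 = pre.map t.lab ++ acc
  | [], pre, v, acc, _, _, hlen => by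
    have : pre = [] := List.eq_nil_of_length_eq_zero (by simpa using hlen)
    simp [this]
  | a :: L, pre, v, acc, hr, hc, hlen => by
    rw [List.foldl_cons]
    rcases List.eq_nil_or_concat pre with rfl | ⟨pre, u, rfl⟩
    · have hv : v = t.root := by simpa using hr
      have : climb (rawTree t) ((v : ℕ), acc) = ((v : ℕ), acc) := by
        rw [climb, if_pos]
        simp [hv, rawTree]
      rw [this]
      exact foldl_climb t L [] v acc hr hc (by simp)
    · simp only [List.concat_eq_append] at *
      rw [List.isChain_append] at hc
      have huv : t.child u v := hc.2.2 u (by simp) v (by simp)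
      have hv : v ≠ t.root := fun h => t.not_child_root u (h ▸ huv)
      have : climb (rawTree t) ((v : ℕ), acc) = ((u : ℕ), t.lab u :: acc) := by
        rw [climb, if_neg]
        · simp only [parentOf_edges t huv, labAt_finRange]
        · intro h
          exact hv (Fin.ext (of_decide_eq_true h))
      rw [this, foldl_climb t L pre u _ (by simpa using hr) hc.1 (by simp at hlen; omega)]
      simp

theorem rawWord_rawTree (t : DTree α) : rawWord (rawTree t) = selWord t := by
  obtain ⟨vs, h₁, h₂, h₃, h⟩ := isSelPath_selWord t
  rcases List.eq_nil_or_concat vs with rfl | ⟨pre, v, rfl⟩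
  · simp at h₁
  · simp only [List.concat_eq_append, List.getLast?_append, List.getLast?_singleton, Option.some_or,
      Option.some.injEq] at h₁ h₂ h₃ h
    subst h₂
    have hlen := t.path_length_le h₃
    have := foldl_climb t (rawTree t).2.2.1 pre t.sel [t.lab t.sel] h₁ h₃ (by
      simp [rawTree] at hlen ⊢
      omega)
    rw [rawWord, h, List.map_append, List.map_singleton, ← this, ← labAt_finRange t t.sel]
    rfl

end raw

end TwigLearn

namespace TwigLearn

universe u

variable {α : Type u}

/-! ### The learning program -/

theorem length_edges_le (t : DTree α) : t.edges.length ≤ t.n * t.n := by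
  refine (List.length_filter_le _ _).trans ?_
  exact (List.length_product _ _).le.trans (by simp)

/-- Nodes are written in unary and there are at most `n * n` edges, so the representation has size
at most cubic in the number of nodes. -/
theorem esz_rawTree_le (t : DTree α) :
    esz α (rawTree t) ≤ 6 * t.n + 10 + t.n * t.n * (4 * t.n + 5) := by
  have h₁ := esz_list_le α (l := (rawTree t).2.2.1) (M := 1) fun a _ => (esz_atom α a).le
  have h₂ := esz_list_le α (l := (rawTree t).2.2.2) (M := 4 * t.n + 4) fun e he => by
    obtain ⟨⟨u, v⟩, -, rfl⟩ := List.mem_map.1 he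
    have hu := u.isLt
    have hv := v.isLt
    rw [esz_prod, esz_nat, esz_nat]
    simp only
    omega
  have h₃ : (rawTree t).2.2.1.length = t.n := by simp [rawTree]
  have h₄ : (rawTree t).2.2.2.length ≤ t.n * t.n := by
    simpa [rawTree] using length_edges_le t
  have h₅ := Nat.mul_le_mul_right (4 * t.n + 5) h₄
  have h₆ : esz α (rawTree t).1 = 2 * (t.root : ℕ) + 1 := esz_nat α _
  have h₇ : esz α (rawTree t).2.1 = 2 * (t.sel : ℕ) + 1 := esz_nat α _
  have h₈ := t.root.isLt
  have h₉ := t.sel.isLt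
  rw [h₃] at h₁
  change _ ≤ 1 + _ * (4 * t.n + 5) at h₂
  rw [esz_prod, esz_prod, esz_prod, h₆, h₇]
  omega

theorem sampleSize_eq {S : Finset (DTree α)} {l : List (DTree α)} (hl : S.val = (l : Multiset _)) :
    (anchPathSetting α).sampleSize S = (l.map DTree.size).sum := by
  change (S.val.map DTree.size).sum = _
  rw [hl, Multiset.map_coe, Multiset.sum_coe]

theorem DTree.one_le_size (t : DTree α) : 1 ≤ t.size := Nat.one_le_of_lt t.root.isLt

theorem esz_sample_le {l : List (DTree α)} {n : ℕ} (hn : (l.map DTree.size).sum = n) :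
    esz α (l.map rawTree) ≤ 1 + n * (6 * n + 10 + n * n * (4 * n + 5) + 1) := by
  -- Trees are nonempty, so the sample size bounds the number of trees as well as the size of each
  -- one.
  have hlen : l.length ≤ n := by
    have := List.length_le_sum_of_one_le (l.map DTree.size) fun i hi => by
      obtain ⟨t, -, rfl⟩ := List.mem_map.1 hi
      exact t.one_le_size
    rwa [List.length_map, hn] at this
  have h := esz_list_le α (l := l.map rawTree) (M := 6 * n + 10 + n * n * (4 * n + 5)) fun T hT => by
    obtain ⟨t, ht, rfl⟩ := List.mem_map.1 hT
    have h : t.n ≤ n := hn ▸ List.single_le_sum (by simp) _ (List.mem_map_of_mem ht)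
    refine (esz_rawTree_le t).trans ?_
    gcongr
  rw [List.length_map] at h
  exact h.trans (Nat.add_le_add_left (Nat.mul_le_mul_right _ hlen) _)

-- The time bound is polynomial in the size of the representation, which in turn is polynomial in
-- the sample size. The result is anchored because the program carries out an actual run and every
-- run is sound.
variable (α) in
theorem exists_learner [LinearOrder α] [OrderBot α] : ∃ (c : Code) (time : Polynomial ℕ),
    ∀ (S : Finset (DTree α)) (l : List (DTree α)),
      S.Nonempty → S.val = (l : Multiset (DTree α)) →
      ∃ (p : AnchPath α) (k : ℕ), (anchPathSetting α).Returns c S l (some p) k ∧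
        k ≤ time.eval ((anchPathSetting α).sampleSize S) ∧ LearnerAnchPath S p.1 := by
  obtain ⟨c, T, ⟨P, hP⟩, -, hT⟩ := PT.learnTrees (α := α) PT.id
  let X : Polynomial ℕ := Polynomial.X
  refine ⟨c, P.comp (1 + X * (6 * X + 10 + X * X * (4 * X + 5) + 1)), fun S l hS hl => ?_⟩
  have hmem : ∀ t, t ∈ l ↔ t ∈ S := fun t => by rw [← Finset.mem_val, hl, Multiset.mem_coe]
  have hW : ∀ w, w ∈ (l.map rawTree).map rawWord ↔ w ∈ selPaths S := fun w => by
    simp only [mem_selPaths, List.map_map, List.mem_map, Function.comp_apply, rawWord_rawTree,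
      hmem, eq_comm]
  have hne : (l.map rawTree).map rawWord ≠ [] := by
    obtain ⟨t, ht⟩ := hS
    exact List.ne_nil_of_mem (List.mem_map_of_mem (List.mem_map_of_mem ((hmem t).2 ht)))
  have hlearn := learnWords_spec hW hne
  obtain ⟨k, hk, heval⟩ := hT (l.map rawTree)
  refine ⟨⟨_, hlearn.sound.1⟩, k, ⟨hl, ?_⟩, ?_, hlearn⟩
  · have henc : (Enc.enc (l.map rawTree) : Data α) = .list (l.map encodeTree) := by
      change Data.list ((l.map rawTree).map Enc.enc) = _
      rw [List.map_map]
      exact congrArg _ (List.map_congr_left fun t _ => enc_rawTree t)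
    rw [henc] at heval
    exact heval
  · refine (hk.trans (hP _)).trans ?_
    rw [Polynomial.eval_comp]
    refine eval_mono P ((esz_sample_le (sampleSize_eq hl).symm).trans (le_of_eq ?_))
    simp [X]

/-! ### Fresh labels for the match set -/

theorem PathQuery.finite_uses (q : PathQuery α) : {a | q.Uses a}.Finite := by
  have : {a | q.Uses a} ⊆ some ⁻¹' Set.range q.label := fun a ha => ha
  exact ((Set.finite_range _).preimage (Option.some_injective α).injOn).subset this

theorem PathQuery.exists_fresh [Infinite α] [LinearOrder α] [OrderBot α] (q : PathQuery α) :
    ∃ a₁ a₂, ¬ q.Uses a₁ ∧ ¬ q.Uses a₂ ∧ a₁ ≠ a₂ ∧ a₁ ≠ ⊥ ∧ a₂ ≠ ⊥ := by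
  obtain ⟨a₁, h₁⟩ := (q.finite_uses.union (Set.finite_singleton ⊥)).infinite_compl.nonempty
  obtain ⟨a₂, h₂⟩ := (q.finite_uses.union (Set.toFinite {⊥, a₁})).infinite_compl.nonempty
  simp only [Set.mem_compl_iff, Set.mem_union, Set.mem_ofPred_eq, Set.mem_singleton_iff,
    Set.mem_insert_iff, not_or] at h₁ h₂
  exact ⟨a₁, a₂, h₁.1, h₂.1, Ne.symm h₂.2.2, h₁.2, h₂.2.1⟩

end TwigLearn

/-! ### The theorem -/

open TwigLearn

theorem mainTheorem1 {α : Type*} [LinearOrder α] [OrderBot α] [Infinite α] :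
    -- the class is learnable in polynomial time and data
    (anchPathSetting α).Learnable ∧
    -- the learning algorithm runs in polynomial time (some program carries it out)
    (∃ (c : Code) (time : Polynomial ℕ), ∀ (S : Finset (DTree α)) (l : List (DTree α)),
      S.Nonempty → S.val = (l : Multiset (DTree α)) →
      ∃ (p : AnchPath α) (k : ℕ), (anchPathSetting α).Returns c S l (some p) k ∧
        k ≤ time.eval ((anchPathSetting α).sampleSize S) ∧ LearnerAnchPath S p.1) ∧
    -- every run of the learning algorithm is sound
    (∀ (S : Finset (DTree α)) (p : PathQuery α), LearnerAnchPath S p →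
      p.IsAnchored ∧ (S : Set (DTree α)) ⊆ p.lang) ∧
    -- the two-tree match set is a characteristic sample of polynomial size for every run
    (∃ poly : Polynomial ℕ, ∀ (q : AnchPath α) (a₁ a₂ : α),
      ¬ q.1.Uses a₁ → ¬ q.1.Uses a₂ → a₁ ≠ a₂ → a₁ ≠ ⊥ → a₂ ≠ ⊥ →
      (matchSet a₁ a₂ q : Set (DTree α)) ⊆ q.1.lang ∧
      (anchPathSetting α).sampleSize (matchSet a₁ a₂ q) ≤ poly.eval q.1.size ∧
      ∀ (S : Finset (DTree α)) (p : PathQuery α), matchSet a₁ a₂ q ⊆ S →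
        (S : Set (DTree α)) ⊆ q.1.lang → LearnerAnchPath S p → p.lang = q.1.lang) := by
  have hpoly : ∀ (q : AnchPath α) (a₁ a₂ : α), (anchPathSetting α).sampleSize (matchSet a₁ a₂ q) ≤
      (Polynomial.X + (1 + Polynomial.X * (Polynomial.X + 1)) : Polynomial ℕ).eval q.1.size :=
    fun q a₁ a₂ => (sampleSize_matchSet_le a₁ a₂ q).trans (le_of_eq (by simp))
  refine ⟨?_, exists_learner α, fun S p => LearnerAnchPath.sound,
    _, fun q a₁ a₂ hu₁ hu₂ _ hb₁ hb₂ => ⟨matchSet_subset_lang a₁ a₂ q, hpoly q a₁ a₂,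
      fun S p hsub hS hp => congrArg _ (eq_of_matchSet_subset hu₁ hu₂ hb₁ hb₂ hsub hS hp)⟩⟩
  obtain ⟨c, time, h⟩ := exists_learner α
  refine ⟨c, time, Polynomial.X + (1 + Polynomial.X * (Polynomial.X + 1)), fun S l hS hl => ?_, fun q => ?_⟩
  · obtain ⟨p, k, h₁, h₂, h₃⟩ := h S l hS hl
    -- Null is never needed: the universal query is consistent with every sample, and the learner
    -- always returns a query.
    exact ⟨some p, k, h₁, h₂, h₃.sound.2⟩
  · obtain ⟨a₁, a₂, hu₁, hu₂, -, hb₁, hb₂⟩ := q.1.exists_fresh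
    have hne : (matchSet a₁ a₂ q).Nonempty := by
      classical
      exact Finset.insert_nonempty _ _
    refine ⟨matchSet a₁ a₂ q, hne, matchSet_subset_lang a₁ a₂ q, hpoly q a₁ a₂,
      fun S l hsub hS hl => ?_⟩
    obtain ⟨p, k, h₁, -, h₃⟩ := h S l (hne.mono hsub) hl
    exact ⟨p, k, h₁, congrArg PathQuery.lang (eq_of_matchSet_subset hu₁ hu₂ hb₁ hb₂ hsub hS h₃)⟩
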